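/- A graph consists of a set of vertices, a set of edges, and an incidence relation assigning to each edge two (not necessarily distinct) vertices; self-loops (which count twice in the degree) and multiple edges are allowed. All graphs are connected and have a basepoint. A graph $\Gamma$ is viewed as a one-dimensional CW complex with the path metric in which every edge has length one, and $B_r(\Gamma)$ denotes the ball of radius $r$ about the basepoint. For an integer $k\ge 3$ let $\mathcal G_k$ be the set of infinite graphs all of whose vertices have degree $k$, let $\mathcal G_{\le k}$ be the set of infinite graphs all of whose vertices have degree at most $k$, and let $\mathcal G_{<\infty}$ be the set of infinite graphs all of whose vertices have finite degree, each considered up to isomorphism fixing the basepoint. Let $\mathcal G_\star$ be any one of these spaces, with the topology that has as a basis the sets $\{\Delta\in\mathcal G_\star \mid B_r(\Gamma)\cong B_r(\Delta)\}$ for $\Gamma\in\mathcal G_\star$ and integers $r\ge 0$, where $\cong$ is isomorphism fixing the basepoint. The rank of a graph is the rank of its fundamental group. A graph is one-ended if its end space $\varprojlim_{K}\pi_0(\Gamma\setminus K)$, where $K$ runs over the compact subsets of $\Gamma$, is a single point. A map is proper if preimages of compact sets are compact, and a proper homotopy equivalence is a proper continuous map $f$ which has a proper continuous map $g$ such that $f\circ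 g$ and $g\circ f$ are homotopic to the identity through homotopies that are proper maps. The Loch Ness Monster graph is a ray with vertices $0,1,2,\dots$ with one self-loop attached at every vertex. **Proposition.** For every integer $k\ge 3$, the set of one-ended graphs of infinite rank is a dense $G_\delta$ subset of $\mathcal G_k$ and a dense $G_\delta$ subset of $\mathcal G_{\le k}$; it is also a dense $G_\delta$ subset of $\mathcal G_{<\infty}$. In each of these spaces, this set is exactly the set of graphs that are proper homotopy equivalent to the Loch Ness Monster graph. -/

import Mathlib

open scoped unitInterval

/-! ### Pointed graphs, with self-loops and multiple edges allowed -/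

/-- A graph with a basepoint: a set of vertices, a set of edges, an incidence relation giving each
edge its two (not necessarily distinct, and unordered) end vertices, and a base vertex.  Different
edges may have the same end vertices. -/
structure PointedGraph where
  /-- the vertex set -/
  V : Type
  /-- the edge set -/
  E : Type
  /-- the unordered pair of end vertices of an edge -/
  ends : E → Sym2 V
  /-- the basepoint -/
  base : V

namespace PointedGraph

/-- The degree of a vertex: the number of edges incident to it, a self-loop counting twice. -/
noncomputable def degree (Γ : PointedGraph) (v : Γ.V) : ℕ∞ :=
  {e | v ∈ Γ.ends e}.encard + {e | Γ.ends e = s(v, v)}.encard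

/-- The adjacency relation on vertices. -/
def adjGraph (Γ : PointedGraph) : SimpleGraph Γ.V where
  Adj u v := u ≠ v ∧ ∃ e, Γ.ends e = s(u, v)
  symm := ⟨fun _ _ h => ⟨h.1.symm, h.2.imp fun _ he => he.trans Sym2.eq_swap⟩⟩
  loopless := ⟨fun _ h => h.1 rfl⟩

/-- The distance of a vertex from the basepoint in the path metric (all edges have length one). -/
noncomputable def height (Γ : PointedGraph) (v : Γ.V) : ℕ∞ :=
  Γ.adjGraph.edist Γ.base v

/-- Isomorphisms of graphs that fix the basepoint. -/
structure Iso (Γ Δ : PointedGraph) where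
  /-- the bijection of vertices -/
  onV : Γ.V ≃ Δ.V
  /-- the bijection of edges -/
  onE : Γ.E ≃ Δ.E
  ends_onE : ∀ e, Δ.ends (onE e) = (Γ.ends e).map onV
  onV_base : onV Γ.base = Δ.base

/-- The identity isomorphism. -/
def Iso.refl (Γ : PointedGraph) : Iso Γ Γ where
  onV := Equiv.refl _
  onE := Equiv.refl _
  ends_onE e := by simp
  onV_base := rfl

/-- The inverse isomorphism. -/
def Iso.symm {Γ Δ : PointedGraph} (f : Iso Γ Δ) : Iso Δ Γ where
  onV := f.onV.symm
  onE := f.onE.symm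
  ends_onE e := by
    have h := f.ends_onE (f.onE.symm e)
    rw [Equiv.apply_symm_apply] at h
    rw [h, Sym2.map_map]
    simp
  onV_base := by rw [← f.onV_base, Equiv.symm_apply_apply]

/-- The composite of two isomorphisms. -/
def Iso.trans {Γ Δ Θ : PointedGraph} (f : Iso Γ Δ) (g : Iso Δ Θ) : Iso Γ Θ where
  onV := f.onV.trans g.onV
  onE := f.onE.trans g.onE
  ends_onE e := by
    rw [Equiv.trans_apply, g.ends_onE, f.ends_onE, Sym2.map_map]
    rfl
  onV_base := by rw [Equiv.trans_apply, f.onV_base, g.onV_base]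

theorem height_le_of_edge (Γ : PointedGraph) (r : ℕ) (e : Γ.E)
    (h : ∃ v ∈ Γ.ends e, Γ.height v < r) : ∀ w ∈ Γ.ends e, Γ.height w ≤ r := by
  obtain ⟨v, hv, hr⟩ := h
  intro w hw
  by_cases hvw : v = w
  · exact hvw ▸ hr.le
  · have hadj : Γ.adjGraph.Adj v w := ⟨hvw, e, (Sym2.mem_and_mem_iff hvw).1 ⟨hv, hw⟩⟩
    calc Γ.height w ≤ Γ.height v + Γ.adjGraph.edist v w := Γ.adjGraph.edist_triangle
      _ = Γ.height v + 1 := by rw [SimpleGraph.edist_eq_one_iff_adj.2 hadj]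
      _ ≤ r := Order.add_one_le_of_lt hr

/-- The closed ball of radius `r` about the basepoint for the path metric.  Since `r` is an integer
it is a subgraph: it consists of the vertices at distance at most `r` and the edges that have
an end vertex at distance less than `r` (no interior point of an edge joining two vertices at
distance exactly `r` is at distance at most `r`). -/
noncomputable def ball (Γ : PointedGraph) (r : ℕ) : PointedGraph where
  V := {v : Γ.V // Γ.height v ≤ r}
  E := {e : Γ.E // ∃ v ∈ Γ.ends e, Γ.height v < r}
  ends e := (Γ.ends e.1).attachWith (Γ.height_le_of_edge r e.1 e.2)
  base := ⟨Γ.base, by simp [height]⟩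

/-- `B_r(Γ) ≅ B_r(Δ)`, by an isomorphism fixing the basepoint. -/
def BallIso (r : ℕ) (Γ Δ : PointedGraph) : Prop :=
  Nonempty (Iso (Γ.ball r) (Δ.ball r))

/-! ### The graph as a topological space -/

instance (Γ : PointedGraph) : TopologicalSpace Γ.V := ⊥

instance (Γ : PointedGraph) : DiscreteTopology Γ.V := ⟨rfl⟩

instance (Γ : PointedGraph) : TopologicalSpace Γ.E := ⊥

instance (Γ : PointedGraph) : DiscreteTopology Γ.E := ⟨rfl⟩

/-- The gluing of the two ends of the `1`-cell of each edge to the end vertices of that edge.  The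
characteristic map of the cell uses an arbitrarily chosen order of the two end vertices. -/
inductive Glue (Γ : PointedGraph) : Γ.V ⊕ Γ.E × I → Γ.V ⊕ Γ.E × I → Prop
  | left (e : Γ.E) : Glue Γ (Sum.inr (e, 0)) (Sum.inl (Γ.ends e).out.1)
  | right (e : Γ.E) : Glue Γ (Sum.inr (e, 1)) (Sum.inl (Γ.ends e).out.2)

/-- The `1`-dimensional CW complex with a `0`-cell for every vertex and a `1`-cell for every edge,
with its quotient (weak) topology. -/
def Realization (Γ : PointedGraph) : Type := Quot Γ.Glue

instance (Γ : PointedGraph) : TopologicalSpace Γ.Realization :=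
  inferInstanceAs (TopologicalSpace (Quot Γ.Glue))

/-- A vertex as a point of the realization. -/
def vertexPoint (Γ : PointedGraph) (v : Γ.V) : Γ.Realization := Quot.mk _ (Sum.inl v)

end PointedGraph

/-! ### Rank, ends, proper homotopy equivalence -/

/-- The rank of a group: the least cardinality of a generating set (`⊤` if no generating set is
finite).  For a free group this is the cardinality of a basis. -/
noncomputable def groupRank (H : Type*) [Group H] : ℕ∞ :=
  ⨅ S : {S : Set H // Subgroup.closure S = ⊤}, S.1.encard

/-- The rank of a connected graph: the rank of its fundamental group. -/
noncomputable def PointedGraph.rank (Γ : PointedGraph) : ℕ∞ :=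
  groupRank (FundamentalGroup Γ.Realization (Γ.vertexPoint Γ.base))

/-- For `K ⊆ L`, the map `π₀(X \ L) → π₀(X \ K)` induced by inclusion. -/
def piZeroCompl {X : Type*} [TopologicalSpace X] {K L : Set X} (h : K ⊆ L) :
    ZerothHomotopy (Lᶜ : Set X) → ZerothHomotopy (Kᶜ : Set X) :=
  ZerothHomotopy.lift
    (fun x => ZerothHomotopy.mk (Set.inclusion (Set.compl_subset_compl.2 h) x))
    fun _ _ p => ZerothHomotopy.sound (p.map (continuous_inclusion (Set.compl_subset_compl.2 h)))

/-- The set of ends of a space: the inverse limit of the sets `π₀(X \ K)`, over the compact subsets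
`K` of `X` ordered by inclusion. -/
def EndSpace (X : Type*) [TopologicalSpace X] : Type _ :=
  {s : (K : {K : Set X // IsCompact K}) → ZerothHomotopy ((K.1)ᶜ : Set X) //
    ∀ (K L : {K : Set X // IsCompact K}) (h : K.1 ⊆ L.1), piZeroCompl h (s L) = s K}

/-- A space is one-ended if it has exactly one end. -/
def OneEnded (X : Type*) [TopologicalSpace X] : Prop :=
  Nonempty (Unique (EndSpace X))

/-- A map is proper if preimages of compact sets are compact. -/
def ProperFun {X Y : Type*} [TopologicalSpace X] [TopologicalSpace Y] (f : X → Y) : Prop :=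
  ∀ K : Set Y, IsCompact K → IsCompact (f ⁻¹' K)

/-- Two maps are properly homotopic if there is a homotopy `I × X → Y` between them that is a
proper map. -/
def ProperlyHomotopic {X Y : Type*} [TopologicalSpace X] [TopologicalSpace Y] (f g : C(X, Y)) :
    Prop :=
  ∃ H : ContinuousMap.Homotopy f g, ProperFun H

/-- Two spaces are proper homotopy equivalent. -/
def ProperHomotopyEquivalent (X Y : Type*) [TopologicalSpace X] [TopologicalSpace Y] : Prop :=
  ∃ (f : C(X, Y)) (g : C(Y, X)), ProperFun f ∧ ProperFun g ∧
    ProperlyHomotopic (g.comp f) (ContinuousMap.id X) ∧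
    ProperlyHomotopic (f.comp g) (ContinuousMap.id Y)

/-! ### The spaces of graphs -/

/-- The connected, infinite pointed graphs all of whose vertex degrees lie in `D`. -/
structure GraphIn (D : Set ℕ∞) where
  /-- the underlying pointed graph -/
  graph : PointedGraph
  connected : ConnectedSpace graph.Realization
  infinite : Infinite graph.V ∨ Infinite graph.E
  degree_mem : ∀ v, graph.degree v ∈ D

/-- Isomorphism fixing the basepoint. -/
instance GraphIn.isoSetoid (D : Set ℕ∞) : Setoid (GraphIn D) where
  r Γ Δ := Nonempty (PointedGraph.Iso Γ.graph Δ.graph)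
  iseqv :=
    { refl := fun Γ => ⟨.refl Γ.graph⟩
      symm := fun ⟨f⟩ => ⟨f.symm⟩
      trans := fun ⟨f⟩ ⟨g⟩ => ⟨f.trans g⟩ }

/-- The set of connected, infinite graphs with a basepoint and with all vertex degrees in `D`,
considered up to isomorphism fixing the basepoint. -/
def GraphSpace (D : Set ℕ∞) : Type 1 := Quotient (GraphIn.isoSetoid D)

namespace GraphSpace

/-- The set of isomorphism classes of the graphs with a given property. -/
def classes {D : Set ℕ∞} (p : PointedGraph → Prop) : Set (GraphSpace D) :=
  Quotient.mk (GraphIn.isoSetoid D) '' {Γ | p Γ.graph}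

/-- The basic set `𝓤_(Γ, r)` of all `Δ` with `B_r(Γ) ≅ B_r(Δ)`. -/
def basicSet {D : Set ℕ∞} (Γ : GraphIn D) (r : ℕ) : Set (GraphSpace D) :=
  classes (PointedGraph.BallIso r Γ.graph)

/-- The local topology, comparing the `r`-balls of the basepoint. -/
instance (D : Set ℕ∞) : TopologicalSpace (GraphSpace D) :=
  TopologicalSpace.generateFrom {U | ∃ (Γ : GraphIn D) (r : ℕ), U = basicSet Γ r}

/-- The one-ended graphs of infinite rank. -/
def oneEndedInfiniteRank (D : Set ℕ∞) : Set (GraphSpace D) :=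
  classes fun Γ => OneEnded Γ.Realization ∧ Γ.rank = ⊤

/-- The graphs that are proper homotopy equivalent to `Λ`. -/
def properHomotopyClass (D : Set ℕ∞) (Λ : PointedGraph) : Set (GraphSpace D) :=
  classes fun Γ => ProperHomotopyEquivalent Γ.Realization Λ.Realization

end GraphSpace

/-- The space `𝓖_k` of infinite `k`-regular graphs. -/
abbrev RegularGraphs (k : ℕ) : Type 1 := GraphSpace {(k : ℕ∞)}

/-- The space `𝓖_{≤ k}` of infinite graphs with all degrees at most `k`. -/
abbrev BoundedDegreeGraphs (k : ℕ) : Type 1 := GraphSpace (Set.Iic (k : ℕ∞))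

/-- The space `𝓖_{< ∞}` of infinite, locally finite graphs. -/
abbrev LocallyFiniteGraphs : Type 1 := GraphSpace (Set.Iio (⊤ : ℕ∞))

/-- The Loch Ness Monster graph: a ray with vertices `0, 1, 2, …`, and a self-loop attached at every
vertex. -/
def lochNessMonster : PointedGraph where
  V := ℕ
  E := ℕ ⊕ ℕ
  ends := Sum.elim (fun n => s(n, n + 1)) (fun n => s(n, n))
  base := 0

/-! All degree sets `D` in question consist of finite degrees, so a single theorem,
`GraphSpace.dense_isGδ_oneEndedInfiniteRank`, covers the three spaces. Both classes of graphs are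
identified with one combinatorial class: the adjacency graph is one-ended
(`SimpleGraph.OneEndedGraph`), and finite vertex sets can span arbitrarily many more edges than they
have elements (`PointedGraph.Crank`).

Classification. A connected, locally finite, one-ended graph is cut into finite connected layers,
each joined to the next by an edge. Moving inside a layer to its exit and then into the next layer
gives a spanning tree encoded by a self-map `p` of the vertices (`OneEndedGraph.exists_tree`): every
vertex has finitely many predecessors, and any two orbits merge. The remaining edges are slid along
the flow of `p` until both ends of each sit at the same vertex of a fixed ray
(`Net.properHomotopyEquivalent_slide_flow`); then the branches of the tree are retracted onto the
ray (`Net.properHomotopyEquivalent_ray`). Infinitely many remaining edges, pushed far enough out,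
yield the Loch Ness Monster; finitely many yield a graph of finite rank. Conversely, ends and rank
are invariant under proper homotopy equivalence. The Loch Ness Monster is one-ended, and its rank is
infinite because finitely many generators miss some loop, which a map to the circle detects
(`Net.groupRank_ray`). The passage from topological to combinatorial one-endedness uses an
ultrafilter to produce a second end (`oneEndedGraph_of_oneEnded`).

The `G_δ` property. One-endedness says that for each `r` some sphere is linked within a bounded
shell outside the ball of radius `r` (`LinkedShell`), and the surplus condition says that for each
`n` some ball has surplus `n` (`BoundedCrank`). Each of these is witnessed by a finite ball, hence
open, and there are countably many.

Density. Given a ball of radius `r`, the half edges missing on its boundary sphere are attached to a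
ray whose edges have multiplicities chosen so that all new degrees equal a prescribed `K ≥ 3`
(`exists_multiplicities`, `exists_ballIso_crank`). The ball is unchanged, the tail gives a single
end, and the multiple edges give infinite rank. -/

/-! ### Realizations of oriented graphs -/

/-- The gluing of the ends of the `1`-cells of an oriented graph with sources `s` and targets `t`. -/
inductive NetGlue {V E : Type} (s t : E → V) : V ⊕ E × I → V ⊕ E × I → Prop
  | left (e : E) : NetGlue s t (Sum.inr (e, 0)) (Sum.inl (s e))
  | right (e : E) : NetGlue s t (Sum.inr (e, 1)) (Sum.inl (t e))

/-- The realization of the oriented graph with source and target maps `s` and `t`. -/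
def Net {V E : Type} (s t : E → V) : Type := Quot (NetGlue s t)

namespace Net

variable {V E : Type} {s t : E → V}

/-- A vertex as a point of the realization. -/
def vtx (s t : E → V) (v : V) : Net s t := Quot.mk _ (Sum.inl v)

/-- The characteristic map of an edge. -/
def edge (s t : E → V) (e : E) (x : I) : Net s t := Quot.mk _ (Sum.inr (e, x))

/-- Openness is tested on edges alone. This is the quotient topology, because the vertices form a
discrete space; a vertex without edges is isolated. -/
instance : TopologicalSpace (Net s t) := ⨆ e, TopologicalSpace.coinduced (edge s t e) inferInstance

@[simp] theorem edge_zero (e : E) : edge s t e 0 = vtx s t (s e) := Quot.sound (.left e)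

@[simp] theorem edge_one (e : E) : edge s t e 1 = vtx s t (t e) := Quot.sound (.right e)

theorem isOpen_iff {U : Set (Net s t)} : IsOpen U ↔ ∀ e, IsOpen (edge s t e ⁻¹' U) := by
  rw [isOpen_iSup_iff]; simp only [isOpen_coinduced]

theorem isClosed_iff {U : Set (Net s t)} : IsClosed U ↔ ∀ e, IsClosed (edge s t e ⁻¹' U) := by
  simp only [← isOpen_compl_iff, isOpen_iff, Set.preimage_compl]

theorem continuous_iff {Z : Type*} [TopologicalSpace Z] {f : Net s t → Z} :
    Continuous f ↔ ∀ e, Continuous fun x => f (edge s t e x) := by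
  rw [continuous_iSup_dom]; simp only [continuous_coinduced_dom]; rfl

@[fun_prop]
theorem continuous_edge (e : E) : Continuous (edge s t e) := continuous_iff.1 continuous_id e

/-- Every point is a vertex or lies in the interior of an edge. -/
theorem cases (x : Net s t) :
    (∃ v, x = vtx s t v) ∨ ∃ e r, r ≠ 0 ∧ r ≠ 1 ∧ x = edge s t e r := by
  induction x using Quot.ind with
  | mk x =>
    rcases x with v | ⟨e, r⟩
    · exact Or.inl ⟨v, rfl⟩
    · by_cases h0 : r = 0
      · exact Or.inl ⟨s e, by subst h0; exact edge_zero e⟩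
      · by_cases h1 : r = 1
        · exact Or.inl ⟨t e, by subst h1; exact edge_one e⟩
        · exact Or.inr ⟨e, r, h0, h1, rfl⟩

theorem ind {p : Net s t → Prop} (hv : ∀ v, p (vtx s t v)) (he : ∀ e r, p (edge s t e r))
    (x : Net s t) : p x := by
  obtain ⟨v, rfl⟩ | ⟨e, r, -, -, rfl⟩ := cases x
  · exact hv v
  · exact he e r

/-- A map out of the realization, from its values on vertices and on edges. -/
def lift {Z : Type*} (fV : V → Z) (fE : E → I → Z) (h0 : ∀ e, fE e 0 = fV (s e))
    (h1 : ∀ e, fE e 1 = fV (t e)) : Net s t → Z :=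
  Quot.lift (Sum.elim fV fun x => fE x.1 x.2) (by
    rintro _ _ (e | e)
    · exact h0 e
    · exact h1 e)

section lift
variable {Z : Type*} (fV : V → Z) (fE : E → I → Z) (h0 : ∀ e, fE e 0 = fV (s e))
    (h1 : ∀ e, fE e 1 = fV (t e))

@[simp] theorem lift_vtx (v : V) : lift fV fE h0 h1 (vtx s t v) = fV v := rfl

@[simp] theorem lift_edge (e : E) (r : I) : lift fV fE h0 h1 (edge s t e r) = fE e r := rfl

theorem continuous_lift [TopologicalSpace Z] (h : ∀ e, Continuous (fE e)) :
    Continuous (lift fV fE h0 h1) := continuous_iff.2 h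

end lift

open Classical in
/-- The open cell containing a point, with the coordinate of the point in it. -/
noncomputable def cell : Net s t → V ⊕ E × I :=
  lift Sum.inl (fun e r => if r = 0 then Sum.inl (s e) else if r = 1 then Sum.inl (t e)
    else Sum.inr (e, r)) (by simp) (by simp)

theorem cell_vtx (v : V) : cell (vtx s t v) = Sum.inl v := rfl

theorem cell_edge {e : E} {r : I} (h0 : r ≠ 0) (h1 : r ≠ 1) :
    cell (edge s t e r) = Sum.inr (e, r) := by
  simp [cell, h0, h1]

theorem vtx_injective : Function.Injective (vtx s t) := fun v w h => by
  simpa [cell_vtx] using congrArg cell h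

theorem edge_eq_vtx {e : E} {r : I} {v : V} (h : edge s t e r = vtx s t v) :
    (r = 0 ∧ s e = v) ∨ (r = 1 ∧ t e = v) := by
  by_cases h0 : r = 0
  · subst h0; rw [edge_zero] at h; exact Or.inl ⟨rfl, vtx_injective h⟩
  by_cases h1 : r = 1
  · subst h1; rw [edge_one] at h; exact Or.inr ⟨rfl, vtx_injective h⟩
  have := congrArg cell h
  simp [cell_edge h0 h1, cell_vtx] at this

theorem edge_eq_edge {e e' : E} {r r' : I} (h0 : r ≠ 0) (h1 : r ≠ 1)
    (h : edge s t e' r' = edge s t e r) : e' = e ∧ r' = r := by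
  have hc := congrArg cell h
  rw [cell_edge h0 h1] at hc
  by_cases h0' : r' = 0
  · subst h0'; rw [edge_zero, cell_vtx] at hc; simp at hc
  by_cases h1' : r' = 1
  · subst h1'; rw [edge_one, cell_vtx] at hc; simp at hc
  rw [cell_edge h0' h1'] at hc
  simpa using hc

/-- Points are separated by continuous real functions: a tent supported on one edge if one of the
points is interior to it, and otherwise the indicator of a vertex, interpolated linearly along the
edges. -/
instance : T2Space (Net s t) := by
  classical
  have key : ∀ (x y : Net s t), x ≠ y → (∃ e r, r ≠ 0 ∧ r ≠ 1 ∧ x = edge s t e r) →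
      ∃ f : Net s t → ℝ, Continuous f ∧ f x ≠ f y := by
    rintro x y hxy ⟨e, r, h0, h1, rfl⟩
    have hr0 : (0 : ℝ) < r := unitInterval.pos_iff_ne_zero.2 h0
    have hr1 : (r : ℝ) < 1 := unitInterval.lt_one_iff_ne_one.2 h1
    set m : ℝ := min (r : ℝ) (1 - r) with hm
    have hm0 : 0 < m := lt_min hr0 (by linarith)
    refine ⟨lift (fun _ => 0) (fun e' r' => if e' = e then max 0 (m - |(r' : ℝ) - r|) else 0)
      ?_ ?_, continuous_lift _ _ _ _ fun e' => ?_, ?_⟩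
    · intro e'
      split_ifs
      · simp [abs_of_pos hr0, hm]
      · rfl
    · intro e'
      split_ifs
      · simp [abs_of_pos (sub_pos.2 hr1), hm]
      · rfl
    · split_ifs
      · fun_prop
      · fun_prop
    · have hx : (0 : ℝ) < max 0 (m - |(r : ℝ) - r|) := by simp [hm0]
      obtain ⟨v, rfl⟩ | ⟨e', r', -, -, rfl⟩ := cases y
      · simp [hm0.not_ge]
      · simp only [lift_edge, if_true]
        split_ifs with he
        · subst he
          have hrr : (r' : ℝ) - r ≠ 0 := fun h => hxy (by
            rw [Subtype.ext (sub_eq_zero.1 h)])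
          have := abs_pos.2 hrr
          intro h
          rw [sub_self, abs_zero, sub_zero, max_eq_right hm0.le] at h
          rcases max_choice 0 (m - |(r' : ℝ) - r|) with h' | h' <;> linarith
        · exact hx.ne'
  have key' : ∀ (x y : Net s t), x ≠ y → ∃ f : Net s t → ℝ, Continuous f ∧ f x ≠ f y := by
    intro x y hxy
    rcases cases x with ⟨v, rfl⟩ | hx
    · rcases cases y with ⟨w, rfl⟩ | hy
      · refine ⟨lift (fun u => if u = v then 1 else 0) (fun e r => (1 - (r : ℝ)) *
          (if s e = v then 1 else 0) + (r : ℝ) * (if t e = v then 1 else 0)) (by simp) (by simp),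
          continuous_lift _ _ _ _ fun e => by fun_prop, ?_⟩
        have : w ≠ v := fun h => hxy (by rw [h])
        simp [this]
      · obtain ⟨f, hf, h⟩ := key _ _ hxy.symm hy
        exact ⟨f, hf, h.symm⟩
    · exact key x y hxy hx
  refine ⟨fun x y hxy => ?_⟩
  obtain ⟨f, hf, h⟩ := key' x y hxy
  exact separated_by_continuous hf h

/-- A compact subset of a realization meets only finitely many open cells. -/
theorem finite_cells {K : Set (Net s t)} (hK : IsCompact K) :
    {v | vtx s t v ∈ K}.Finite ∧ {e | ∃ r, r ≠ 0 ∧ r ≠ 1 ∧ edge s t e r ∈ K}.Finite := by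
  classical
  -- If `Z` has at most one point in each open edge, every subset of `Z` has finite trace on each
  -- closed edge and is closed. So `Z` is compact and discrete, hence finite.
  have key : ∀ Z : Set (Net s t), Z ⊆ K → (∀ e, (Z ∩ {x | ∃ r, r ≠ 0 ∧ r ≠ 1 ∧
      x = edge s t e r}).Subsingleton) → Z.Finite := by
    intro Z hZ hsub
    have hcl : ∀ W ⊆ Z, IsClosed W := by
      intro W hW
      refine isClosed_iff.2 fun e => Set.Finite.isClosed ?_
      have hsing : ({r | r ≠ 0 ∧ r ≠ 1 ∧ edge s t e r ∈ W} : Set I).Subsingleton := by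
        rintro r ⟨h0, h1, hr⟩ r' ⟨h0', h1', hr'⟩
        exact (edge_eq_edge h0' h1' (hsub e ⟨hW hr, r, h0, h1, rfl⟩
          ⟨hW hr', r', h0', h1', rfl⟩)).2
      refine ((hsing.finite.union (Set.finite_singleton 0)).union (Set.finite_singleton 1)).subset ?_
      intro r hr
      by_cases h0 : r = 0
      · exact Or.inl (Or.inr h0)
      · by_cases h1 : r = 1
        · exact Or.inr h1
        · exact Or.inl (Or.inl ⟨h0, h1, hr⟩)
    refine (hK.of_isClosed_subset (hcl Z le_rfl) hZ).finite ?_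
    rw [isDiscrete_iff_discreteTopology, discreteTopology_iff_isOpen_singleton]
    intro x
    rw [← isClosed_compl_iff, isClosed_induced_iff]
    refine ⟨Z \ {x.1}, hcl _ Set.sdiff_subset, ?_⟩
    ext y
    simp [Subtype.ext_iff]
  constructor
  · have := key (vtx s t '' {v | vtx s t v ∈ K}) (by rintro _ ⟨v, hv, rfl⟩; exact hv) (by
      rintro e _ ⟨⟨v, -, rfl⟩, r, h0, h1, hr⟩
      have := congrArg cell hr
      simp [cell_edge h0 h1, cell_vtx] at this)
    exact this.of_finite_image vtx_injective.injOn
  · choose! r h0 h1 hr using fun (e : E) (h : ∃ r, r ≠ 0 ∧ r ≠ 1 ∧ edge s t e r ∈ K) => h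
    have := key ((fun e => edge s t e (r e)) '' {e | ∃ r, r ≠ 0 ∧ r ≠ 1 ∧ edge s t e r ∈ K})
      (by rintro _ ⟨e, he, rfl⟩; exact hr e he) (by
      rintro e _ ⟨⟨e₁, he₁, rfl⟩, r₁, h01, h11, hr1⟩ _ ⟨⟨e₂, he₂, rfl⟩, r₂, h02, h12, hr2⟩
      rw [(edge_eq_edge h01 h11 hr1).1, (edge_eq_edge h02 h12 hr2).1])
    refine this.of_finite_image fun e he e' he' h => ?_
    exact (edge_eq_edge (h0 e' he') (h1 e' he') h).1

/-- Every vertex meets finitely many edges. -/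
def LocFin (s t : E → V) : Prop := ∀ v, {e | s e = v}.Finite ∧ {e | t e = v}.Finite

theorem finite_edges (h : LocFin s t) {K : Set (Net s t)} (hK : IsCompact K) :
    {e | ∃ r, edge s t e r ∈ K}.Finite := by
  obtain ⟨hv, he⟩ := finite_cells hK
  refine (he.union (hv.biUnion fun v _ => (h v).1.union (h v).2)).subset ?_
  rintro e ⟨r, hr⟩
  by_cases h0 : r = 0
  · subst h0
    exact Or.inr (Set.mem_biUnion (x := s e) (by simpa using hr) (Or.inl rfl))
  by_cases h1 : r = 1
  · subst h1
    exact Or.inr (Set.mem_biUnion (x := t e) (by simpa using hr) (Or.inr rfl))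
  exact Or.inl ⟨r, h0, h1, hr⟩

/-- The subcomplex spanned by vertices and edges. -/
def sub (s t : E → V) (FV : Set V) (FE : Set E) : Set (Net s t) :=
  vtx s t '' FV ∪ ⋃ e ∈ FE, Set.range (edge s t e)

theorem isCompact_sub {FV : Set V} {FE : Set E} (hV : FV.Finite) (hE : FE.Finite) :
    IsCompact (sub s t FV FE) :=
  (hV.image _).isCompact.union (hE.isCompact_biUnion fun e _ => isCompact_range (continuous_edge e))

/-- The preimage of a compact set is closed, the target being Hausdorff, and lies in the finite
subcomplex of the cells whose images meet that set. -/
theorem properFun_of_finite {Y : Type*} [TopologicalSpace Y] [T2Space Y] (f : C(Net s t, Y))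
    (hV : ∀ K, IsCompact K → {v | f (vtx s t v) ∈ K}.Finite)
    (hE : ∀ K, IsCompact K → {e | ∃ r, f (edge s t e r) ∈ K}.Finite) : ProperFun f := by
  intro K hK
  refine (isCompact_sub (hV K hK) (hE K hK)).of_isClosed_subset
    (hK.isClosed.preimage f.continuous) fun x hx => ?_
  induction x using ind with
  | hv v => exact Or.inl ⟨v, hx, rfl⟩
  | he e r => exact Or.inr (Set.mem_biUnion (x := e) ⟨r, hx⟩ ⟨r, rfl⟩)

theorem properFun_of_finite₂ {Y : Type*} [TopologicalSpace Y] [T2Space Y] (f : C(I × Net s t, Y))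
    (hV : ∀ K, IsCompact K → {v | ∃ τ, f (τ, vtx s t v) ∈ K}.Finite)
    (hE : ∀ K, IsCompact K → {e | ∃ τ r, f (τ, edge s t e r) ∈ K}.Finite) : ProperFun f := by
  intro K hK
  refine (isCompact_univ.prod (isCompact_sub (hV K hK) (hE K hK))).of_isClosed_subset
    (hK.isClosed.preimage f.continuous) ?_
  rintro ⟨τ, x⟩ hx
  refine ⟨trivial, ?_⟩
  induction x using ind with
  | hv v => exact Or.inl ⟨v, ⟨τ, hx⟩, rfl⟩
  | he e r => exact Or.inr (Set.mem_biUnion (x := e) ⟨τ, r, hx⟩ ⟨r, rfl⟩)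

/-- A homotopy, from its values on vertices and edges. -/
def homotopy {Z : Type*} [TopologicalSpace Z] (f g : C(Net s t, Z)) (HV : V → C(I, Z))
    (HE : E → C(I × I, Z)) (h0 : ∀ e τ, HE e (0, τ) = HV (s e) τ)
    (h1 : ∀ e τ, HE e (1, τ) = HV (t e) τ) (hfV : ∀ v, HV v 0 = f (vtx s t v))
    (hgV : ∀ v, HV v 1 = g (vtx s t v)) (hf : ∀ e r, HE e (r, 0) = f (edge s t e r))
    (hg : ∀ e r, HE e (r, 1) = g (edge s t e r)) : ContinuousMap.Homotopy f g where
  toFun x := lift (Z := C(I, Z)) HV (fun e r => (HE e).curry r)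
    (fun e => ContinuousMap.ext (h0 e)) (fun e => ContinuousMap.ext (h1 e)) x.2 x.1
  continuous_toFun := by
    -- The curried map into `C(I, Z)` can be checked edge by edge, which avoids the product of a
    -- quotient map with `I`; uncurrying is allowed since `I` is locally compact.
    have h : Continuous (lift (s := s) (t := t) (Z := C(I, Z)) HV (fun e r => (HE e).curry r)
        (fun e => ContinuousMap.ext (h0 e)) (fun e => ContinuousMap.ext (h1 e))) :=
      continuous_lift _ _ _ _ fun e => (HE e).curry.continuous
    exact (ContinuousMap.uncurry ⟨_, h⟩).continuous.comp continuous_swap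
  map_zero_left x := by
    induction x using ind with
    | hv v => exact hfV v
    | he e r => exact hf e r
  map_one_left x := by
    induction x using ind with
    | hv v => exact hgV v
    | he e r => exact hg e r

/-- The characteristic map of an edge, as a path. -/
def edgePath (s t : E → V) (e : E) : Path (vtx s t (s e)) (vtx s t (t e)) where
  toFun := edge s t e
  continuous_toFun := continuous_edge e
  source' := edge_zero e
  target' := edge_one e

end Net

namespace PointedGraph

/-- The realization of a graph may be computed with any orientation and indexing of its edges. -/
noncomputable def realizationHomeo (Γ : PointedGraph) {E : Type} (s t : E → Γ.V) (φ : E ≃ Γ.E)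
    (h : ∀ e, s(s e, t e) = Γ.ends (φ e)) : Net s t ≃ₜ Γ.Realization := by
  classical
  have hs : ∀ e, (s e = (Γ.ends (φ e)).out.1 ∧ t e = (Γ.ends (φ e)).out.2) ∨
      (¬ s e = (Γ.ends (φ e)).out.1 ∧ s e = (Γ.ends (φ e)).out.2 ∧ t e = (Γ.ends (φ e)).out.1) := by
    intro e
    have := (h e).trans (Quot.out_eq (Γ.ends (φ e))).symm
    have h2 : s(s e, t e) = s((Γ.ends (φ e)).out.1, (Γ.ends (φ e)).out.2) := this
    rw [Sym2.eq_iff] at h2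
    by_cases h3 : s e = (Γ.ends (φ e)).out.1
    · refine Or.inl ⟨h3, ?_⟩
      rcases h2 with h2 | h2
      · exact h2.2
      · rw [h2.2, ← h3, h2.1]
    · exact Or.inr ⟨h3, h2.resolve_left fun h => h3 h.1⟩
  -- Edges whose given orientation disagrees with the arbitrary choice in `Glue` are parametrized
  -- backwards.
  let flip (e : E) (r : I) : I := if s e = (Γ.ends (φ e)).out.1 then r else σ r
  have flip_flip : ∀ e r, flip e (flip e r) = r := fun e r => by
    simp only [flip]; split_ifs <;> simp
  have flip_cont : ∀ e, Continuous (flip e) := fun e => by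
    simp only [flip]; split_ifs <;> fun_prop
  let f : Net s t → Γ.Realization := Net.lift Γ.vertexPoint
    (fun e r => Quot.mk _ (Sum.inr (φ e, flip e r)))
    (fun e => by
      rcases hs e with ⟨h1, h2⟩ | ⟨h1, h2, h3⟩
      · simp only [flip, if_pos h1]; rw [h1]; exact Quot.sound (.left _)
      · simp only [flip, if_neg h1, unitInterval.symm_zero]; rw [h2]; exact Quot.sound (.right _))
    (fun e => by
      rcases hs e with ⟨h1, h2⟩ | ⟨h1, h2, h3⟩
      · simp only [flip, if_pos h1]; rw [h2]; exact Quot.sound (.right _)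
      · simp only [flip, if_neg h1, unitInterval.symm_one]; rw [h3]; exact Quot.sound (.left _))
  let g : Γ.Realization → Net s t := Quot.lift (Sum.elim (Net.vtx s t)
    fun x => Net.edge s t (φ.symm x.1) (flip (φ.symm x.1) x.2)) (by
      rintro _ _ (e | e)
      · obtain ⟨e, rfl⟩ := φ.surjective e
        simp only [Sum.elim_inr, Sum.elim_inl, Equiv.symm_apply_apply]
        rcases hs e with ⟨h1, h2⟩ | ⟨h1, h2, h3⟩
        · simp only [flip, if_pos h1, Net.edge_zero]; rw [h1]
        · simp only [flip, if_neg h1, unitInterval.symm_zero, Net.edge_one]; rw [h3]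
      · obtain ⟨e, rfl⟩ := φ.surjective e
        simp only [Sum.elim_inr, Sum.elim_inl, Equiv.symm_apply_apply]
        rcases hs e with ⟨h1, h2⟩ | ⟨h1, h2, h3⟩
        · simp only [flip, if_pos h1, Net.edge_one]; rw [h2]
        · simp only [flip, if_neg h1, unitInterval.symm_one, Net.edge_zero]; rw [h2])
  refine ⟨⟨f, g, fun x => ?_, fun x => ?_⟩, ?_, ?_⟩
  · induction x using Net.ind with
    | hv v => rfl
    | he e r =>
      change Net.edge s t (φ.symm (φ e)) (flip (φ.symm (φ e)) (flip e r)) = _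
      rw [Equiv.symm_apply_apply, flip_flip]
  · induction x using Quot.ind with
    | mk x =>
      rcases x with v | ⟨e, r⟩
      · rfl
      · change Quot.mk _ (Sum.inr (φ (φ.symm e), flip (φ.symm e) (flip (φ.symm e) r))) = _
        rw [Equiv.apply_symm_apply, flip_flip]
  · refine Net.continuous_iff.2 fun e => continuous_quot_mk.comp ?_
    change Continuous fun r => (Sum.inr (φ e, flip e r) : Γ.V ⊕ Γ.E × I)
    exact continuous_inr.comp (continuous_const.prodMk (flip_cont e))
  · refine continuous_quot_lift _ (continuous_sumElim.2 ⟨continuous_of_discreteTopology, ?_⟩)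
    rw [continuous_prod_of_discrete_left]
    intro e
    exact (Net.continuous_edge (φ.symm e)).comp (flip_cont (φ.symm e))

end PointedGraph

/-! ### Proper homotopy equivalences -/

section Proper

variable {X Y Z W : Type*} [TopologicalSpace X] [TopologicalSpace Y] [TopologicalSpace Z]
  [TopologicalSpace W]

theorem ProperFun.comp {g : Y → Z} {f : X → Y} (hg : ProperFun g) (hf : ProperFun f) :
    ProperFun (g ∘ f) := fun K hK => hf _ (hg K hK)

theorem properFun_homeomorph (f : X ≃ₜ Y) : ProperFun f := fun _ hK =>
  f.isCompact_preimage.2 hK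

theorem ProperlyHomotopic.of_proper {f : C(X, Y)} (hf : ProperFun f) : ProperlyHomotopic f f := by
  refine ⟨.refl f, fun K hK => ?_⟩
  have : (ContinuousMap.Homotopy.refl f) ⁻¹' K = Set.univ ×ˢ (f ⁻¹' K) := by ext ⟨τ, x⟩; simp
  rw [this]
  exact isCompact_univ.prod (hf K hK)

theorem ProperlyHomotopic.symm {f g : C(X, Y)} : ProperlyHomotopic f g → ProperlyHomotopic g f := by
  rintro ⟨H, hH⟩
  refine ⟨H.symm, fun K hK => ?_⟩
  have : H.symm ⁻¹' K = (Prod.map σ id) '' (H ⁻¹' K) := by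
    ext ⟨τ, x⟩
    simp only [Set.mem_preimage, ContinuousMap.Homotopy.symm_apply, Set.mem_image, Prod.exists,
      Prod.map_apply, id_eq, Prod.mk.injEq]
    refine ⟨fun h => ⟨σ τ, x, h, by simp, rfl⟩, ?_⟩
    rintro ⟨τ', x', h, rfl, rfl⟩
    simpa using h
  rw [this]
  exact (hH K hK).image (by fun_prop)

theorem ProperlyHomotopic.trans {f g h : C(X, Y)} : ProperlyHomotopic f g →
    ProperlyHomotopic g h → ProperlyHomotopic f h := by
  rintro ⟨H, hH⟩ ⟨H', hH'⟩
  refine ⟨H.trans H', fun K hK => ?_⟩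
  let a : I → I := fun τ => ⟨τ / 2, by constructor <;> linarith [τ.2.1, τ.2.2]⟩
  let b : I → I := fun τ => ⟨(1 + τ) / 2, by constructor <;> linarith [τ.2.1, τ.2.2]⟩
  have ha : Continuous a := by fun_prop
  have hb : Continuous b := by fun_prop
  have : (H.trans H') ⁻¹' K = (Prod.map a id) '' (H ⁻¹' K) ∪ (Prod.map b id) '' (H' ⁻¹' K) := by
    ext ⟨τ, x⟩
    simp only [Set.mem_preimage, Set.mem_union, Set.mem_image, Prod.exists, Prod.map_apply, id_eq,
      Prod.mk.injEq, ContinuousMap.Homotopy.trans_apply]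
    constructor
    · intro hx
      split_ifs at hx with hτ
      · exact Or.inl ⟨_, x, hx, Subtype.ext (by simp [a]), rfl⟩
      · exact Or.inr ⟨_, x, hx, Subtype.ext (by simp [b]), rfl⟩
    · rintro (⟨τ', x', hx, rfl, rfl⟩ | ⟨τ', x', hx, rfl, rfl⟩)
      · rw [dif_pos (show ((a τ' : I) : ℝ) ≤ 1 / 2 by simp only [a]; linarith [τ'.2.2])]
        convert hx using 3
        simp [a, mul_div_cancel₀]
      -- Time `1 / 2` belongs to the first branch of the concatenation, so the start of `H'` has to
      -- be traded for the end of `H`.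
      · by_cases h0 : (τ' : ℝ) = 0
        · rw [dif_pos (show ((b τ' : I) : ℝ) ≤ 1 / 2 by simp [b, h0])]
          have h1 : τ' = 0 := Subtype.ext h0
          subst h1
          rw [H'.apply_zero, ← H.apply_one] at hx
          convert hx using 3
          simp [b]
        · rw [dif_neg (show ¬ ((b τ' : I) : ℝ) ≤ 1 / 2 by
            have := lt_of_le_of_ne τ'.2.1 (Ne.symm h0)
            simp only [b]; linarith)]
          convert hx using 3
          simp only [b]
          ring_nf
  rw [this]
  exact ((hH K hK).image (by fun_prop)).union ((hH' K hK).image (by fun_prop))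

theorem ProperlyHomotopic.comp_left {f g : C(X, Y)} (h : C(Y, Z)) (hh : ProperFun h) :
    ProperlyHomotopic f g → ProperlyHomotopic (h.comp f) (h.comp g) := by
  rintro ⟨H, hH⟩
  exact ⟨(ContinuousMap.Homotopy.refl h).comp H, fun K hK => hH _ (hh K hK)⟩

/-- The preimage of `K` lies over the `h`-preimage of the projection of the compact set `H ⁻¹' K`.
Hausdorffness of `Y` makes `H ⁻¹' K` closed. -/
theorem ProperlyHomotopic.comp_right [T2Space Y] {f g : C(Y, Z)} (h : C(X, Y)) (hh : ProperFun h) :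
    ProperlyHomotopic f g → ProperlyHomotopic (f.comp h) (g.comp h) := by
  rintro ⟨H, hH⟩
  refine ⟨H.comp (ContinuousMap.Homotopy.refl h), fun K hK => ?_⟩
  have h1 := hH K hK
  refine (isCompact_univ.prod (hh _ (h1.image continuous_snd))).of_isClosed_subset
    (h1.isClosed.preimage (f := Prod.map id h) (by fun_prop)) ?_
  rintro ⟨τ, x⟩ hx
  exact ⟨trivial, ⟨(τ, h x), hx, rfl⟩⟩

theorem ProperHomotopyEquivalent.symm : ProperHomotopyEquivalent X Y →
    ProperHomotopyEquivalent Y X := by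
  rintro ⟨f, g, hf, hg, hgf, hfg⟩
  exact ⟨g, f, hg, hf, hfg, hgf⟩

theorem ProperHomotopyEquivalent.trans [T2Space X] [T2Space Y] [T2Space Z] :
    ProperHomotopyEquivalent X Y → ProperHomotopyEquivalent Y Z →
    ProperHomotopyEquivalent X Z := by
  rintro ⟨f, g, hf, hg, hgf, hfg⟩ ⟨f', g', hf', hg', hgf', hfg'⟩
  refine ⟨f'.comp f, g.comp g', hf'.comp hf, hg.comp hg', ?_, ?_⟩
  · exact ((hgf'.comp_right f hf).comp_left g hg).trans hgf
  · exact ((hfg.comp_right g' hg').comp_left f' hf').trans hfg'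

theorem Homeomorph.properHomotopyEquivalent (φ : X ≃ₜ Y) : ProperHomotopyEquivalent X Y := by
  refine ⟨φ, φ.symm, properFun_homeomorph φ, properFun_homeomorph φ.symm, ?_, ?_⟩
  · have : ContinuousMap.comp (φ.symm : C(Y, X)) φ = ContinuousMap.id X := by ext; simp
    rw [this]
    exact .of_proper fun K hK => hK
  · have : ContinuousMap.comp (φ : C(X, Y)) φ.symm = ContinuousMap.id Y := by ext; simp
    rw [this]
    exact .of_proper fun K hK => hK

/-! ### Ends -/

theorem piZeroCompl_mk {K L : Set X} (h : K ⊆ L) (x : (Lᶜ : Set X)) :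
    piZeroCompl h (ZerothHomotopy.mk x) = ZerothHomotopy.mk ⟨x.1, fun hx => x.2 (h hx)⟩ := rfl

/-- The map on path components of complements of `f ⁻¹' K` and `K`. -/
def piZeroMap (f : C(X, Y)) (K : Set Y) :
    ZerothHomotopy ((f ⁻¹' K)ᶜ : Set X) → ZerothHomotopy (Kᶜ : Set Y) :=
  ZerothHomotopy.lift (fun x => ZerothHomotopy.mk ⟨f x.1, x.2⟩)
    fun _ _ p => ZerothHomotopy.sound (p.map (f := fun x : ((f ⁻¹' K)ᶜ : Set X) =>
      (⟨f x.1, x.2⟩ : (Kᶜ : Set Y))) (by fun_prop))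

/-- The path component of the complement of a compact set that contains an end. -/
def EndSpace.comp (ε : EndSpace X) (K : Set X) (hK : IsCompact K) : ZerothHomotopy (Kᶜ : Set X) :=
  ε.1 ⟨K, hK⟩

theorem EndSpace.piZeroCompl_comp (ε : EndSpace X) {K L : Set X} (hK : IsCompact K)
    (hL : IsCompact L) (h : K ⊆ L) : piZeroCompl h (ε.comp L hL) = ε.comp K hK :=
  ε.2 ⟨K, hK⟩ ⟨L, hL⟩ h

@[ext]
theorem EndSpace.ext {ε ε' : EndSpace X} (h : ∀ K hK, ε.comp K hK = ε'.comp K hK) : ε = ε' :=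
  Subtype.ext (funext fun K => h K.1 K.2)

/-- The end given by a compatible family of path components. -/
def EndSpace.mk (c : ∀ K : Set X, IsCompact K → ZerothHomotopy (Kᶜ : Set X))
    (h : ∀ K L hK hL, ∀ h : K ⊆ L, piZeroCompl h (c L hL) = c K hK) : EndSpace X :=
  ⟨fun K => c K.1 K.2, fun K L => h K.1 L.1 K.2 L.2⟩

/-- The map on end spaces induced by a proper map. -/
def endMap (f : C(X, Y)) (hf : ProperFun f) (ε : EndSpace X) : EndSpace Y :=
  .mk (fun K hK => piZeroMap f K (ε.comp (f ⁻¹' K) (hf _ hK))) fun K L hK hL h => by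
    rw [← ε.piZeroCompl_comp (hf _ hK) (hf _ hL) (Set.preimage_mono h)]
    generalize ε.comp (f ⁻¹' L) _ = z
    induction z using ZerothHomotopy.rec with
    | mk x => rfl

theorem comp_endMap (f : C(X, Y)) (hf : ProperFun f) (ε : EndSpace X) (K : Set Y)
    (hK : IsCompact K) :
    (endMap f hf ε).comp K hK = piZeroMap f K (ε.comp (f ⁻¹' K) (hf _ hK)) := rfl

/-- Off the projection to `X` of the compact set `H ⁻¹' K`, the whole track of a point avoids `K`,
and so joins `g (f x)` to `x` in the complement of `K`. -/
theorem endMap_endMap_of_homotopic_id {f : C(X, Y)} {g : C(Y, X)} (hf : ProperFun f)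
    (hg : ProperFun g) (h : ProperlyHomotopic (g.comp f) (ContinuousMap.id X)) (ε : EndSpace X) :
    endMap g hg (endMap f hf ε) = ε := by
  obtain ⟨H, hH⟩ := h
  ext K hK
  have hL : IsCompact (Prod.snd '' (H ⁻¹' K)) := (hH _ hK).image continuous_snd
  have h1 : K ⊆ Prod.snd '' (H ⁻¹' K) := fun x hx =>
    ⟨(1, x), by simpa using hx, rfl⟩
  have h0 : f ⁻¹' (g ⁻¹' K) ⊆ Prod.snd '' (H ⁻¹' K) := fun x hx =>
    ⟨(0, x), by simpa using hx, rfl⟩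
  rw [← ε.piZeroCompl_comp hK hL h1, comp_endMap, comp_endMap,
    ← ε.piZeroCompl_comp (hf _ (hg _ hK)) hL h0]
  generalize ε.comp _ hL = z
  induction z using ZerothHomotopy.rec with
  | mk x =>
    have hx : ∀ τ, H (τ, x.1) ∈ Kᶜ := fun τ hτ => x.2 ⟨(τ, x.1), hτ, rfl⟩
    refine ZerothHomotopy.sound ⟨⟨fun τ => ⟨H (τ, x.1), hx τ⟩, by fun_prop⟩, ?_, ?_⟩
    · exact Subtype.ext (H.apply_zero _)
    · exact Subtype.ext (H.apply_one _)

theorem OneEnded.of_properHomotopyEquivalent (h : ProperHomotopyEquivalent X Y)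
    (hX : OneEnded X) : OneEnded Y := by
  obtain ⟨f, g, hf, hg, hgf, hfg⟩ := h
  obtain ⟨u⟩ := hX
  refine ⟨⟨⟨endMap f hf u.default⟩, fun ε => ?_⟩⟩
  rw [← endMap_endMap_of_homotopic_id hg hf hfg ε]
  exact congrArg _ (u.uniq _)

/-! ### Rank -/

theorem groupRank_le_of_surjective {G H : Type*} [Group G] [Group H] (φ : G →* H)
    (hφ : Function.Surjective φ) : groupRank H ≤ groupRank G := by
  refine le_iInf fun S => ?_
  have h : Subgroup.closure (φ '' S.1) = ⊤ := by
    rw [← MonoidHom.map_closure, S.2, ← MonoidHom.range_eq_map, MonoidHom.range_eq_top.2 hφ]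
  exact (iInf_le _ ⟨φ '' S.1, h⟩).trans (Set.encard_image_le _ _)

theorem groupRank_eq_of_mulEquiv {G H : Type*} [Group G] [Group H] (φ : G ≃* H) :
    groupRank G = groupRank H := by
  refine le_antisymm (groupRank_le_of_surjective φ.symm.toMonoidHom φ.symm.surjective)
    (groupRank_le_of_surjective φ.toMonoidHom φ.surjective)

/-- The equivalence of fundamental groupoids gives the isomorphism without any matching of
basepoints; path connectedness then moves the basepoint in `Y`. -/
theorem groupRank_fundamentalGroup_eq {X Y : Type} [TopologicalSpace X] [TopologicalSpace Y]
    [PathConnectedSpace Y]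
    (h : ProperHomotopyEquivalent X Y) (x : X) (y : Y) :
    groupRank (FundamentalGroup X x) = groupRank (FundamentalGroup Y y) := by
  obtain ⟨f, g, -, -, ⟨H, -⟩, ⟨H', -⟩⟩ := h
  let e : ContinuousMap.HomotopyEquiv X Y := ⟨f, g, ⟨H⟩, ⟨H'⟩⟩
  let F := FundamentalGroupoidFunctor.equivOfHomotopyEquiv (X := TopCat.of X) (Y := TopCat.of Y) e
  have h1 := groupRank_eq_of_mulEquiv (G := FundamentalGroup X x) (H := FundamentalGroup Y (f x))
    (F.fullyFaithfulFunctor.mulEquivEnd (FundamentalGroupoid.mk x))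
  rw [h1]
  exact groupRank_eq_of_mulEquiv
    (FundamentalGroup.fundamentalGroupMulEquivOfPathConnected (X := Y) (f x) y)

end Proper

/-! ### Sliding the ends of edges -/

namespace Net

variable {V E₀ E₁ : Type} {s₀ t₀ : E₀ → V}

/-- The inclusion of a graph into the graph obtained by attaching further edges. -/
def incl (s₀ t₀ : E₀ → V) (a b : E₁ → V) :
    C(Net s₀ t₀, Net (Sum.elim s₀ a) (Sum.elim t₀ b)) where
  toFun := lift (vtx _ _) (fun e => edge _ _ (Sum.inl e)) (fun e => edge_zero (Sum.inl e))
    (fun e => edge_one (Sum.inl e))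
  continuous_toFun := continuous_lift _ _ _ _ fun _ => continuous_edge _

@[simp] theorem incl_vtx (a b : E₁ → V) (v : V) :
    incl s₀ t₀ a b (vtx _ _ v) = vtx _ _ v := rfl

theorem LocFin.sumElim (h : LocFin s₀ t₀) {a b : E₁ → V} (ha : ∀ v, {i | a i = v}.Finite)
    (hb : ∀ v, {i | b i = v}.Finite) : LocFin (Sum.elim s₀ a) (Sum.elim t₀ b) := by
  intro v
  constructor
  · refine (((h v).1.image Sum.inl).union ((ha v).image Sum.inr)).subset ?_
    rintro (e | i) h
    · exact Or.inl ⟨e, h, rfl⟩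
    · exact Or.inr ⟨i, h, rfl⟩
  · refine (((h v).2.image Sum.inl).union ((hb v).image Sum.inr)).subset ?_
    rintro (e | i) h
    · exact Or.inl ⟨e, h, rfl⟩
    · exact Or.inr ⟨i, h, rfl⟩

theorem properFun_incl {a b : E₁ → V} (h : LocFin (Sum.elim s₀ a) (Sum.elim t₀ b)) :
    ProperFun (incl s₀ t₀ a b) := by
  refine properFun_of_finite _ (fun K hK => (finite_cells hK).1) fun K hK => ?_
  exact (finite_edges h hK).preimage (f := Sum.inl) (Sum.inl_injective.injOn)

/-- A family of paths of which only finitely many meet a given compact set. -/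
def LocFinPaths {X J : Type*} [TopologicalSpace X] {x y : J → X} (α : ∀ i, Path (x i) (y i)) :
    Prop :=
  ∀ K, IsCompact K → {i | ∃ r, α i r ∈ K}.Finite

theorem LocFinPaths.symm {X J : Type*} [TopologicalSpace X] {x y : J → X}
    {α : ∀ i, Path (x i) (y i)} (h : LocFinPaths α) : LocFinPaths fun i => (α i).symm := by
  intro K hK
  refine (h K hK).subset ?_
  rintro i ⟨r, hr⟩
  exact ⟨σ r, hr⟩

theorem LocFinPaths.finite_source {J : Type*} {a b : J → V}
    {α : ∀ i, Path (vtx s₀ t₀ (a i)) (vtx s₀ t₀ (b i))} (h : LocFinPaths α) (v : V) :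
    {i | a i = v}.Finite := by
  refine (h {vtx s₀ t₀ v} isCompact_singleton).subset ?_
  rintro i rfl
  exact ⟨0, by simp⟩

theorem LocFinPaths.finite_target {J : Type*} {a b : J → V}
    {α : ∀ i, Path (vtx s₀ t₀ (a i)) (vtx s₀ t₀ (b i))} (h : LocFinPaths α) (v : V) :
    {i | b i = v}.Finite :=
  h.symm.finite_source v

section slide

variable {a b a' b' : E₁ → V}
  (α : ∀ i, Path (vtx s₀ t₀ (a i)) (vtx s₀ t₀ (a' i)))
  (β : ∀ i, Path (vtx s₀ t₀ (b i)) (vtx s₀ t₀ (b' i)))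

/-- The path, parametrized by `[0, 3]`, that runs along `α i`, the edge `i`, and back along `β i`. -/
noncomputable def slidePath (i : E₁) (x : ℝ) : Net (Sum.elim s₀ a') (Sum.elim t₀ b') :=
  if x ≤ 1 then incl s₀ t₀ a' b' ((α i).extend x) else
    if x ≤ 2 then (edgePath (Sum.elim s₀ a') (Sum.elim t₀ b') (Sum.inr i)).extend (x - 1) else
      incl s₀ t₀ a' b' ((β i).extend (3 - x))

theorem continuous_slidePath (i : E₁) : Continuous (slidePath α β i) := by
  refine Continuous.if_le (by fun_prop) (Continuous.if_le (by fun_prop) (by fun_prop)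
    continuous_id continuous_const ?_) continuous_id continuous_const ?_
  · rintro x rfl
    norm_num
  · rintro x rfl
    rw [if_pos one_le_two]
    norm_num

theorem slidePath_zero (i : E₁) : slidePath α β i 0 = vtx _ _ (a i) := by
  simp [slidePath]

theorem slidePath_three (i : E₁) : slidePath α β i 3 = vtx _ _ (b i) := by
  norm_num [slidePath]

theorem slidePath_one_add (i : E₁) (r : I) :
    slidePath α β i (1 + r) = edge _ _ (Sum.inr i) r := by
  by_cases h0 : (r : ℝ) = 0
  · have : r = 0 := Subtype.ext h0
    subst this
    have := edge_zero (s := Sum.elim s₀ a') (t := Sum.elim t₀ b') (Sum.inr i)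
    simp only [Sum.elim_inr] at this
    simp [slidePath, this]
  · have h1 : 0 < (r : ℝ) := lt_of_le_of_ne r.2.1 (Ne.symm h0)
    rw [slidePath, if_neg (by linarith), if_pos (by linarith [r.2.2]), add_sub_cancel_left,
      Path.extend_apply _ r.2]
    rfl

theorem slidePath_mem (i : E₁) (x : ℝ) :
    (∃ r, slidePath α β i x = incl s₀ t₀ a' b' (α i r)) ∨
    (∃ r, slidePath α β i x = edge _ _ (Sum.inr i) r) ∨
    (∃ r, slidePath α β i x = incl s₀ t₀ a' b' (β i r)) := by
  unfold slidePath
  split_ifs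
  · exact Or.inl ⟨_, rfl⟩
  · exact Or.inr (Or.inl ⟨_, rfl⟩)
  · exact Or.inr (Or.inr ⟨_, rfl⟩)

/-- The map between two graphs that differ by sliding the edges along paths. -/
noncomputable def slideMap : C(Net (Sum.elim s₀ a) (Sum.elim t₀ b),
    Net (Sum.elim s₀ a') (Sum.elim t₀ b')) where
  toFun := lift (vtx _ _) (Sum.rec (fun e r => edge _ _ (Sum.inl e) r)
    (fun i r => slidePath α β i (3 * r)))
    (by rintro (e | i)
        · exact edge_zero (Sum.inl e)
        · simpa using slidePath_zero α β i)
    (by rintro (e | i)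
        · exact edge_one (Sum.inl e)
        · simpa using slidePath_three α β i)
  continuous_toFun := continuous_lift _ _ _ _ (by
    rintro (e | i)
    · exact continuous_edge _
    · exact (continuous_slidePath α β i).comp (by fun_prop))

@[simp] theorem slideMap_inr (i : E₁) (r : I) :
    slideMap α β (edge _ _ (Sum.inr i) r) = slidePath α β i (3 * r) := rfl

@[simp] theorem slideMap_incl (x : Net s₀ t₀) :
    slideMap α β (incl s₀ t₀ a b x) = incl s₀ t₀ a' b' x := by
  induction x using ind with
  | hv v => rfl
  | he e r => rfl

variable (h₀ : LocFin s₀ t₀) (hα : LocFinPaths α) (hβ : LocFinPaths β)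
include h₀ hα hβ

theorem finite_slidePath {K : Set (Net (Sum.elim s₀ a') (Sum.elim t₀ b'))} (hK : IsCompact K) :
    {i | ∃ x, slidePath α β i x ∈ K}.Finite := by
  have h := h₀.sumElim hα.finite_target hβ.finite_target
  have hp := properFun_incl h K hK
  refine ((hα _ hp).union (((finite_edges h hK).preimage
    (Sum.inr_injective.injOn)).union (hβ _ hp))).subset ?_
  rintro i ⟨x, hx⟩
  obtain ⟨r, hr⟩ | ⟨r, hr⟩ | ⟨r, hr⟩ := slidePath_mem α β i x
  · exact Or.inl ⟨r, by rwa [hr] at hx⟩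
  · exact Or.inr (Or.inl ⟨r, by rwa [hr] at hx⟩)
  · exact Or.inr (Or.inr ⟨r, by rwa [hr] at hx⟩)

theorem properFun_slideMap : ProperFun (slideMap α β) := by
  refine properFun_of_finite _ (fun K hK => (finite_cells hK).1) fun K hK => ?_
  have h := h₀.sumElim hα.finite_target hβ.finite_target
  refine ((((finite_edges h hK).preimage (Sum.inl_injective.injOn)).image Sum.inl).union
    ((finite_slidePath α β h₀ hα hβ hK).image Sum.inr)).subset ?_
  rintro (e | i) ⟨r, hr⟩
  · exact Or.inl ⟨e, ⟨r, hr⟩, rfl⟩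
  · exact Or.inr ⟨i, ⟨_, hr⟩, rfl⟩

-- On a slid edge, the composite runs through the path of the reverse slide with parameter going
-- from `1` down to `0` (along `α i`), up to `3` (the image of the edge) and back to `2` (backwards
-- along `β i`).
omit h₀ hα hβ in
theorem slideMap_slidePath (i : E₁) (r : I) :
    slideMap (fun i => (α i).symm) (fun i => (β i).symm) (slidePath α β i (3 * r)) =
      slidePath (fun i => (α i).symm) (fun i => (β i).symm) i
        (if (r : ℝ) ≤ 1 / 3 then 1 - 3 * r else if (r : ℝ) ≤ 2 / 3 then 9 * r - 3 else 5 - 3 * r) := by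
  have hr0 := r.2.1
  have hr1 := r.2.2
  split_ifs with h1 h2
  · conv_lhs => rw [slidePath, if_pos (by linarith)]
    conv_rhs => rw [slidePath, if_pos (by linarith)]
    rw [slideMap_incl, Path.extend_symm_apply]
    simp
  · conv_lhs => rw [slidePath, if_neg (by linarith), if_pos (by linarith),
      Path.extend_apply _ (show 3 * (r : ℝ) - 1 ∈ I by constructor <;> linarith)]
    refine (slideMap_inr _ _ _ _).trans ?_
    congr 1
    simp only
    ring
  · conv_lhs => rw [slidePath, if_neg (by linarith), if_neg (by linarith)]
    rw [slideMap_incl]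
    by_cases h3 : (r : ℝ) = 1
    · norm_num [h3, slidePath]
    · have : (r : ℝ) < 1 := lt_of_le_of_ne hr1 h3
      conv_rhs => rw [slidePath, if_neg (by linarith), if_neg (by linarith)]
      rw [Path.extend_symm_apply]
      congr 2
      ring

/-- The parameter function of `slideMap_slidePath` and `r ↦ 1 + r`, which traces just the edge,
agree at both ends; interpolating linearly between them is the homotopy. It never leaves the image
of one slide path, which gives properness. -/
theorem properlyHomotopic_slideMap : ProperlyHomotopic
    ((slideMap (fun i => (α i).symm) (fun i => (β i).symm)).comp (slideMap α β))
    (ContinuousMap.id (Net (Sum.elim s₀ a) (Sum.elim t₀ b))) := by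
  let q : ℝ → ℝ := fun r =>
    if r ≤ 1 / 3 then 1 - 3 * r else if r ≤ 2 / 3 then 9 * r - 3 else 5 - 3 * r
  have hq : Continuous q := by
    refine Continuous.if_le (by fun_prop) (Continuous.if_le (by fun_prop) (by fun_prop)
      continuous_id continuous_const ?_) continuous_id continuous_const ?_
    · rintro x rfl; norm_num
    · rintro x rfl; norm_num
  let w := slidePath (fun i => (α i).symm) (fun i => (β i).symm)
  have hw : ∀ i, Continuous (w i) := continuous_slidePath _ _
  have hw1 : ∀ i, w i 1 = vtx _ _ (a i) := fun i => by
    have := slidePath_one_add (fun i => (α i).symm) (fun i => (β i).symm) i 0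
    rw [edge_zero] at this
    simpa using this
  have hw2 : ∀ i, w i 2 = vtx _ _ (b i) := fun i => by
    have := slidePath_one_add (fun i => (α i).symm) (fun i => (β i).symm) i 1
    rw [edge_one] at this
    norm_num at this
    exact this
  let HE : E₀ ⊕ E₁ → C(I × I, Net (Sum.elim s₀ a) (Sum.elim t₀ b)) := Sum.rec
    (fun e => ⟨fun x => edge _ _ (Sum.inl e) x.1, by fun_prop⟩)
    (fun i => ⟨fun x => w i ((1 - x.2) * q x.1 + x.2 * (1 + x.1)), by fun_prop⟩)
  let H := homotopy
    ((slideMap (fun i => (α i).symm) (fun i => (β i).symm)).comp (slideMap α β))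
    (ContinuousMap.id (Net (Sum.elim s₀ a) (Sum.elim t₀ b)))
    (fun v => ContinuousMap.const _ (vtx _ _ v)) HE
    (by rintro (e | i) τ
        · exact edge_zero _
        · change w i _ = vtx _ _ (a i)
          rw [← hw1]; congr 1; simp [q])
    (by rintro (e | i) τ
        · exact edge_one _
        · change w i _ = vtx _ _ (b i)
          rw [← hw2]; congr 1; norm_num [q]; ring)
    (fun v => rfl) (fun v => rfl)
    (by rintro (e | i) r
        · rfl
        · refine Eq.trans ?_ (slideMap_slidePath α β i r).symm
          change w i _ = _
          simp [q, w])
    (by rintro (e | i) r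
        · rfl
        · refine Eq.trans ?_ (slidePath_one_add (fun i => (α i).symm) (fun i => (β i).symm) i r)
          change w i _ = _
          simp [w])
  refine ⟨H, properFun_of_finite₂ H.toContinuousMap (fun K hK => ?_) fun K hK => ?_⟩
  · refine (finite_cells hK).1.subset ?_
    rintro v ⟨τ, hτ⟩
    exact hτ
  · have h := h₀.sumElim hα.finite_source hβ.finite_source
    refine ((((finite_edges h hK).preimage (Sum.inl_injective.injOn)).image Sum.inl).union
      ((finite_slidePath _ _ h₀ hα.symm hβ.symm hK).image Sum.inr)).subset ?_
    rintro (e | i) ⟨τ, r, hr⟩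
    · exact Or.inl ⟨e, ⟨r, hr⟩, rfl⟩
    · exact Or.inr ⟨i, ⟨_, hr⟩, rfl⟩

/-- Sliding the ends of edges along a locally finite family of paths is a proper homotopy
equivalence. -/
theorem properHomotopyEquivalent_slide : ProperHomotopyEquivalent
    (Net (Sum.elim s₀ a) (Sum.elim t₀ b)) (Net (Sum.elim s₀ a') (Sum.elim t₀ b')) := by
  refine ⟨slideMap α β, slideMap (fun i => (α i).symm) (fun i => (β i).symm),
    properFun_slideMap α β h₀ hα hβ, properFun_slideMap _ _ h₀ hα.symm hβ.symm,
    properlyHomotopic_slideMap α β h₀ hα hβ, ?_⟩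
  have := properlyHomotopic_slideMap _ _ h₀ hα.symm hβ.symm
  simpa only [Path.symm_symm] using this

end slide

/-! ### Flowing along a forest -/

section flow

variable {p : V → V}

/-- The flow line starting at `v`, which stops after `m` edges. -/
noncomputable def flow (p : V → V) : ℕ → V → ℝ → Net (id : V → V) p
  | 0, v, _ => vtx _ _ v
  | m + 1, v, x => if x ≤ 1 then (edgePath (id : V → V) p v).extend x else flow p m (p v) (x - 1)

theorem flow_of_nonpos (m : ℕ) (v : V) {x : ℝ} (hx : x ≤ 0) :
    flow p m v x = vtx _ _ v := by
  cases m with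
  | zero => rfl
  | succ m => rw [flow, if_pos (by linarith), Path.extend_of_le_zero _ hx]; rfl

theorem flow_succ (m : ℕ) (v : V) {x : ℝ} (hx : 1 ≤ x) :
    flow p (m + 1) v x = flow p m (p v) (x - 1) := by
  rcases hx.lt_or_eq with h | rfl
  · rw [flow, if_neg h.not_ge]
  · rw [flow, if_pos le_rfl, flow_of_nonpos _ _ (by simp), Path.extend_one]

theorem flow_edge (m : ℕ) (v : V) (r : I) : flow p (m + 1) v r = edge _ _ v r := by
  rw [flow, if_pos r.2.2, Path.extend_apply _ r.2]
  rfl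

theorem continuous_flow (m : ℕ) (v : V) : Continuous (flow p m v) := by
  induction m generalizing v with
  | zero => exact continuous_const
  | succ m ih =>
    refine Continuous.if_le (by fun_prop) ((ih (p v)).comp (by fun_prop)) continuous_id
      continuous_const ?_
    rintro x rfl
    rw [flow_of_nonpos _ _ (by simp), Path.extend_one]

theorem flow_of_ge (m : ℕ) (v : V) {x : ℝ} (hx : m ≤ x) : flow p m v x = vtx _ _ (p^[m] v) := by
  induction m generalizing v x with
  | zero => rfl
  | succ m ih =>
    push_cast at hx
    rw [flow_succ _ _ (by linarith [(Nat.cast_nonneg m : (0 : ℝ) ≤ m)]), ih _ (by linarith)]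
    rfl

theorem flow_mem (m : ℕ) (v : V) (x : ℝ) :
    (∃ j, flow p m v x = vtx _ _ (p^[j] v)) ∨ ∃ j r, flow p m v x = edge _ _ (p^[j] v) r := by
  induction m generalizing v x with
  | zero => exact Or.inl ⟨0, rfl⟩
  | succ m ih =>
    rw [flow]
    split_ifs
    · exact Or.inr ⟨0, _, rfl⟩
    · rcases ih (p v) (x - 1) with ⟨j, h⟩ | ⟨j, r, h⟩
      · exact Or.inl ⟨j + 1, h⟩
      · exact Or.inr ⟨j + 1, r, h⟩

/-- Every point has finitely many predecessors under iteration of `p`. -/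
def FinDown (p : V → V) : Prop := ∀ v, {u | ∃ j, p^[j] u = v}.Finite

theorem FinDown.locFin (h : FinDown p) : LocFin (id : V → V) p := fun v =>
  ⟨Set.finite_singleton v, (h v).subset fun _ hu => ⟨1, hu⟩⟩

/-- A flow line through a cell starts at a predecessor of that vertex, or of the source of that
edge. A compact set meets finitely many cells, each with finitely many such predecessors. -/
theorem FinDown.finite_flow (h : FinDown p) {K : Set (Net (id : V → V) p)} (hK : IsCompact K) :
    {v | ∃ m x, flow p m v x ∈ K}.Finite := by
  refine (((finite_cells hK).1.biUnion fun v _ => h v).union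
    ((finite_edges h.locFin hK).biUnion fun v _ => h v)).subset ?_
  rintro v ⟨m, x, hx⟩
  rcases flow_mem (p := p) m v x with ⟨j, hj⟩ | ⟨j, r, hj⟩
  · rw [hj] at hx
    exact Or.inl (Set.mem_biUnion (x := p^[j] v) hx ⟨j, rfl⟩)
  · rw [hj] at hx
    exact Or.inr (Set.mem_biUnion (x := p^[j] v) ⟨r, hx⟩ ⟨j, rfl⟩)

/-- The path from `v` to `p^[m] v` along the flow. -/
noncomputable def flowPath (p : V → V) (m : ℕ) (v : V) :
    Path (vtx (id : V → V) p v) (vtx (id : V → V) p (p^[m] v)) where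
  toFun r := flow p m v (m * r)
  continuous_toFun := (continuous_flow m v).comp (by fun_prop)
  source' := flow_of_nonpos _ _ (by simp)
  target' := flow_of_ge _ _ (by simp)

theorem FinDown.locFinPaths (h : FinDown p) {a : E₁ → V} (ha : ∀ v, {i | a i = v}.Finite)
    (m : E₁ → ℕ) : LocFinPaths fun i => flowPath p (m i) (a i) := by
  intro K hK
  refine ((h.finite_flow hK).biUnion fun v _ => ha v).subset ?_
  rintro i ⟨r, hr⟩
  exact Set.mem_biUnion (x := a i) ⟨m i, _, hr⟩ rfl

theorem properHomotopyEquivalent_slide_flow (h : FinDown p) {a b a' b' : E₁ → V}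
    (ha : ∀ v, {i | a i = v}.Finite) (hb : ∀ v, {i | b i = v}.Finite)
    (ha' : ∀ i, ∃ m, p^[m] (a i) = a' i) (hb' : ∀ i, ∃ m, p^[m] (b i) = b' i) :
    ProperHomotopyEquivalent (Net (Sum.elim id a) (Sum.elim p b))
      (Net (Sum.elim id a') (Sum.elim p b')) := by
  choose m hm using ha'
  choose n hn using hb'
  obtain rfl : (fun i => p^[m i] (a i)) = a' := funext hm
  obtain rfl : (fun i => p^[n i] (b i)) = b' := funext hn
  exact properHomotopyEquivalent_slide (fun i => flowPath p (m i) (a i))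
    (fun i => flowPath p (n i) (b i)) h.locFin (h.locFinPaths ha m) (h.locFinPaths hb n)

end flow

end Net

/-! ### One-ended trees with loops are properly homotopy equivalent to a ray with loops -/

namespace Net

variable {V E₁ : Type} {p : V → V}

/-- Any two points have a common iterate under `p`. -/
def Merging (p : V → V) : Prop := ∀ u v, ∃ m n, p^[m] u = p^[n] v

/-- A repetition would make the orbit of `v` finite. As every orbit merges with it, all vertices
would be predecessors of finitely many ones, and `V` would be finite. -/
theorem FinDown.injective_iterate [Infinite V] (h : FinDown p) (hm : Merging p) (v : V) :
    Function.Injective fun n => p^[n] v := by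
  by_contra hinj
  have hfin : (Set.range fun n => p^[n] v).Finite := by
    have : ∃ m n, m < n ∧ p^[m] v = p^[n] v := by
      simp only [Function.Injective, not_forall] at hinj
      obtain ⟨m, n, hmn, hne⟩ := hinj
      rcases lt_or_gt_of_ne hne with h | h
      · exact ⟨m, n, h, hmn⟩
      · exact ⟨n, m, h, hmn.symm⟩
    obtain ⟨m, n, hlt, hmn⟩ := this
    refine ((Set.finite_Iio n).image fun n => p^[n] v).subset ?_
    rintro _ ⟨k, rfl⟩
    induction k using Nat.strong_induction_on with
    | _ k ih =>
      by_cases hk : k < n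
      · exact ⟨k, hk, rfl⟩
      · have : p^[k] v = p^[k - n + m] v := by
          rw [Function.iterate_add_apply, hmn, ← Function.iterate_add_apply]
          congr 1; omega
        simp only [this]
        exact ih _ (by omega)
  refine Set.infinite_univ ((hfin.biUnion fun u _ => h u).subset fun u _ => ?_)
  obtain ⟨m, n, hmn⟩ := hm u v
  exact Set.mem_biUnion (x := p^[n] v) ⟨n, rfl⟩ ⟨m, hmn⟩

section retract

variable (p) (v₀ : V)

open Classical in
/-- The number of steps from `v` to the ray starting at `v₀`. -/
noncomputable def hitTime (hm : Merging p) (v : V) : ℕ := Nat.find (hm v v₀)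

/-- The position at which the flow line of `v` meets the ray starting at `v₀`. -/
noncomputable def hitPos (hm : Merging p) (v : V) : ℕ :=
  open Classical in (Nat.find_spec (hm v v₀)).choose

variable (hm : Merging p)

theorem iterate_hitTime (v : V) : p^[hitTime p v₀ hm v] v = p^[hitPos p v₀ hm v] v₀ := by
  classical
  exact (Nat.find_spec (hm v v₀)).choose_spec

variable (hinj : Function.Injective fun n => p^[n] v₀)

theorem hitTime_ray (n : ℕ) : hitTime p v₀ hm (p^[n] v₀) = 0 := by
  classical
  exact (Nat.find_eq_zero _).2 ⟨n, rfl⟩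

include hinj in
theorem hitPos_ray (n : ℕ) : hitPos p v₀ hm (p^[n] v₀) = n := by
  have := iterate_hitTime p v₀ hm (p^[n] v₀)
  rw [hitTime_ray] at this
  exact (hinj this).symm

theorem eq_ray_of_hitTime {v : V} (h : hitTime p v₀ hm v = 0) :
    v = p^[hitPos p v₀ hm v] v₀ := by
  have := iterate_hitTime p v₀ hm v
  rwa [h] at this

theorem hitTime_succ {v : V} (h : hitTime p v₀ hm v ≠ 0) :
    hitTime p v₀ hm v = hitTime p v₀ hm (p v) + 1 := by
  classical
  refine (Nat.find_eq_iff _).2 ⟨?_, fun k hk => ?_⟩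
  · exact ⟨_, iterate_hitTime p v₀ hm (p v)⟩
  · rintro ⟨n, hn⟩
    cases k with
    | zero => exact h ((Nat.find_eq_zero _).2 ⟨n, hn⟩)
    | succ k => exact Nat.find_min (hm (p v) v₀) (Nat.lt_of_succ_lt_succ hk) ⟨n, hn⟩

include hinj in
theorem hitPos_succ {v : V} (h : hitTime p v₀ hm v ≠ 0) :
    hitPos p v₀ hm (p v) = hitPos p v₀ hm v := by
  refine hinj ?_
  change p^[_] v₀ = p^[_] v₀
  rw [← iterate_hitTime, ← iterate_hitTime, hitTime_succ p v₀ hm h]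
  rfl

include hinj in
theorem hitPos_succ_of_ray {v : V} (h : hitTime p v₀ hm v = 0) :
    hitPos p v₀ hm (p v) = hitPos p v₀ hm v + 1 := by
  have := eq_ray_of_hitTime p v₀ hm h
  conv_lhs => rw [this, ← Function.iterate_succ_apply' p]
  exact hitPos_ray p v₀ hm hinj _

variable (n : E₁ → ℕ)

/-- The inclusion of a ray with loops into a tree with loops. -/
def rayIncl : C(Net (Sum.elim id n) (Sum.elim Nat.succ n),
    Net (Sum.elim id fun i => p^[n i] v₀) (Sum.elim p fun i => p^[n i] v₀)) where
  toFun := lift (fun k => vtx _ _ (p^[k] v₀))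
    (Sum.rec (fun k r => edge _ _ (Sum.inl (p^[k] v₀)) r) fun i r => edge _ _ (Sum.inr i) r)
    (by rintro (k | i)
        · exact edge_zero _
        · exact edge_zero (Sum.inr i))
    (by rintro (k | i)
        · refine (edge_one _).trans ?_
          simp [Function.iterate_succ_apply']
        · exact edge_one (Sum.inr i))
  continuous_toFun := continuous_lift _ _ _ _ (by rintro (k | i) <;> exact continuous_edge _)

/-- The retraction of a tree with loops onto a ray with loops. -/
noncomputable def rayRetr : C(Net (Sum.elim id fun i => p^[n i] v₀) (Sum.elim p fun i => p^[n i] v₀),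
    Net (Sum.elim id n) (Sum.elim Nat.succ n)) where
  toFun := lift (fun v => vtx _ _ (hitPos p v₀ hm v))
    (Sum.rec (fun v r => if hitTime p v₀ hm v = 0 then edge _ _ (Sum.inl (hitPos p v₀ hm v)) r
      else vtx _ _ (hitPos p v₀ hm v)) fun i r => edge _ _ (Sum.inr i) r)
    (by rintro (v | i)
        · change (if _ then _ else _) = _
          split_ifs
          · exact edge_zero _
          · rfl
        · refine (edge_zero _).trans ?_
          simp [hitPos_ray p v₀ hm hinj])
    (by rintro (v | i)
        · change (if _ then _ else _) = _
          split_ifs with h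
          · refine (edge_one _).trans ?_
            simp [hitPos_succ_of_ray p v₀ hm hinj h]
          · exact congrArg _ (hitPos_succ p v₀ hm hinj h).symm
        · refine (edge_one _).trans ?_
          simp [hitPos_ray p v₀ hm hinj])
  continuous_toFun := continuous_lift _ _ _ _ (by
    rintro (k | i)
    · change Continuous fun r => (if hitTime p v₀ hm k = 0 then
        edge _ _ (Sum.inl (hitPos p v₀ hm k)) r else vtx _ _ (hitPos p v₀ hm k))
      split_ifs
      · exact continuous_edge _
      · exact continuous_const
    · exact continuous_edge _)

theorem rayRetr_comp_rayIncl :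
    (rayRetr p v₀ hm hinj n).comp (rayIncl p v₀ n) = ContinuousMap.id _ := by
  ext x
  induction x using ind with
  | hv k => exact congrArg (vtx _ _) (hitPos_ray p v₀ hm hinj k)
  | he e r =>
    rcases e with k | i
    · change (if hitTime p v₀ hm (p^[k] v₀) = 0 then _ else _) = _
      rw [if_pos (hitTime_ray p v₀ hm k), hitPos_ray p v₀ hm hinj]
      rfl
    · rfl

variable {p}

include hinj in
theorem FinDown.locFin_ray (h : FinDown p) (hn : ∀ k, {i | n i = k}.Finite) :
    LocFin (Sum.elim id fun i => p^[n i] v₀) (Sum.elim p fun i => p^[n i] v₀) := by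
  have : ∀ v, {i | p^[n i] v₀ = v}.Finite := by
    intro v
    by_cases hv : ∃ k, p^[k] v₀ = v
    · obtain ⟨k, rfl⟩ := hv
      exact (hn k).subset fun i hi => hinj hi
    · refine Set.finite_empty.subset fun i hi => hv ⟨_, hi⟩
  exact h.locFin.sumElim this this

theorem finDown_succ : FinDown Nat.succ := fun n => (Set.finite_Iic n).subset (by
  rintro k ⟨j, rfl⟩
  simp [Nat.succ_iterate])

theorem locFin_nat (hn : ∀ k, {i | n i = k}.Finite) :
    LocFin (Sum.elim id n) (Sum.elim Nat.succ n) :=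
  finDown_succ.locFin.sumElim hn hn

theorem properFun_rayRetr (h : FinDown p) (hn : ∀ k, {i | n i = k}.Finite) :
    ProperFun (rayRetr p v₀ hm hinj n) := by
  have hpos : ∀ F : Set ℕ, F.Finite → {v | hitPos p v₀ hm v ∈ F}.Finite := fun F hF => by
    refine (hF.biUnion fun k _ => h (p^[k] v₀)).subset fun v hv => ?_
    exact Set.mem_biUnion hv ⟨_, iterate_hitTime p v₀ hm v⟩
  refine properFun_of_finite _ (fun K hK => hpos _ (finite_cells hK).1) fun K hK => ?_
  have hf := finite_edges (locFin_nat n hn) hK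
  refine (((hpos _ ((hf.preimage (f := Sum.inl) Sum.inl_injective.injOn).union
    (finite_cells hK).1)).image Sum.inl).union ((hf.preimage (f := Sum.inr)
    Sum.inr_injective.injOn).image Sum.inr)).subset ?_
  rintro (v | i) ⟨r, hr⟩
  · change (if hitTime p v₀ hm v = 0 then _ else _) ∈ K at hr
    refine Or.inl ⟨v, ?_, rfl⟩
    split_ifs at hr
    · exact Or.inl ⟨r, hr⟩
    · exact Or.inr hr
  · exact Or.inr ⟨i, ⟨r, hr⟩, rfl⟩

include hinj in
theorem properFun_rayIncl (h : FinDown p) (hn : ∀ k, {i | n i = k}.Finite) :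
    ProperFun (rayIncl p v₀ n) := by
  refine properFun_of_finite _ (fun K hK => (finite_cells hK).1.preimage
    (f := fun n => p^[n] v₀) hinj.injOn) fun K hK => ?_
  have hf := finite_edges (h.locFin_ray v₀ hinj n hn) hK
  refine ((((hf.preimage (f := Sum.inl) Sum.inl_injective.injOn).preimage
    (f := fun n => p^[n] v₀) hinj.injOn).image
    Sum.inl).union ((hf.preimage (f := Sum.inr) Sum.inr_injective.injOn).image Sum.inr)).subset ?_
  rintro (v | i) ⟨r, hr⟩
  · exact Or.inl ⟨v, ⟨r, hr⟩, rfl⟩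
  · exact Or.inr ⟨i, ⟨r, hr⟩, rfl⟩

/-- Points off the ray move along their flow lines to the place where these meet the ray, while the
ray and its loops stay fixed. Properness comes from `FinDown.finite_flow`. -/
theorem properlyHomotopic_rayRetr (h : FinDown p) (hn : ∀ k, {i | n i = k}.Finite) :
    ProperlyHomotopic (ContinuousMap.id _) ((rayIncl p v₀ n).comp (rayRetr p v₀ hm hinj n)) := by
  let d := hitTime p v₀ hm
  let ι := incl (id : V → V) p (fun i => p^[n i] v₀) (fun i => p^[n i] v₀)
  let HV : V → C(I, Net (Sum.elim id fun i => p^[n i] v₀) (Sum.elim p fun i => p^[n i] v₀)) :=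
    fun v => ⟨fun τ => ι (flow p (d v) v (τ * d v)),
      ι.continuous.comp ((continuous_flow _ _).comp (by fun_prop))⟩
  let HE : V ⊕ E₁ → C(I × I, Net (Sum.elim id fun i => p^[n i] v₀)
      (Sum.elim p fun i => p^[n i] v₀)) := Sum.rec
    (fun v => if d v = 0 then ⟨fun x => edge _ _ (Sum.inl v) x.1, by fun_prop⟩ else
      -- A point at distance `x.1` along the flow line of `v` has `d v - x.1` left to go. At `x.1 =
      -- 1` this agrees with the motion of `p v`, since `d v = d (p v) + 1`.
      ⟨fun x => ι (flow p (d v) v (x.1 + x.2 * (d v - x.1))),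
        ι.continuous.comp ((continuous_flow _ _).comp (by fun_prop))⟩)
    (fun i => ⟨fun x => edge _ _ (Sum.inr i) x.1, by fun_prop⟩)
  have HE_inl : ∀ v x, HE (Sum.inl v) x = if d v = 0 then edge _ _ (Sum.inl v) x.1 else
      ι (flow p (d v) v (x.1 + x.2 * (d v - x.1))) := by
    intro v x
    change (if d v = 0 then (_ : C(I × I, _)) else _) x = _
    split_ifs <;> rfl
  have HV_zero : ∀ v τ, d v = 0 → HV v τ = vtx _ _ v := by
    intro v τ hv
    change ι (flow p (d v) v _) = _
    rw [hv]; rfl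
  have HV_one : ∀ v, HV v 1 = vtx _ _ (p^[hitPos p v₀ hm v] v₀) := by
    intro v
    change ι (flow p (d v) v _) = _
    rw [flow_of_ge _ _ (by simp), iterate_hitTime]
    rfl
  let H := homotopy (ContinuousMap.id _) ((rayIncl p v₀ n).comp (rayRetr p v₀ hm hinj n)) HV HE
    (by rintro (v | i) τ
        · rw [HE_inl]
          split_ifs with hv
          · exact (edge_zero _).trans (HV_zero v τ hv).symm
          · change ι _ = ι _
            congr 2
            simp
        · exact (edge_zero _).trans (HV_zero _ _ (hitTime_ray p v₀ hm _)).symm)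
    (by rintro (v | i) τ
        · rw [HE_inl]
          split_ifs with hv
          · rw [edge_one, Sum.elim_inl, HV_zero]
            have := eq_ray_of_hitTime p v₀ hm hv
            rw [this, ← Function.iterate_succ_apply' p]
            exact hitTime_ray p v₀ hm _
          · have hd : d v = d (p v) + 1 := hitTime_succ p v₀ hm hv
            change ι (flow p (d v) v _) = ι (flow p (d (p v)) (p v) _)
            have h0 : (0 : ℝ) ≤ τ * d (p v) := mul_nonneg τ.2.1 (Nat.cast_nonneg _)
            rw [hd, flow_succ]
            · congr 2
              simp
            · simpa using h0
        · exact (edge_one _).trans (HV_zero _ _ (hitTime_ray p v₀ hm _)).symm)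
    (by intro v
        change ι (flow p (d v) v _) = _
        rw [flow_of_nonpos _ _ (by simp)]
        rfl)
    (fun v => HV_one v)
    (by rintro (v | i) r
        · rw [HE_inl]
          split_ifs with hv
          · rfl
          · have hd : d v = d (p v) + 1 := hitTime_succ p v₀ hm hv
            have : flow p (d v) v r = edge _ _ v r := by rw [hd]; exact flow_edge _ _ _
            simp only [Set.Icc.coe_zero, zero_mul, add_zero, this]
            rfl
        · rfl)
    (by rintro (v | i) r
        · rw [HE_inl]
          change _ = rayIncl p v₀ n (if hitTime p v₀ hm v = 0 then
            edge _ _ (Sum.inl (hitPos p v₀ hm v)) r else vtx _ _ (hitPos p v₀ hm v))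
          by_cases hv : hitTime p v₀ hm v = 0
          · rw [if_pos (show d v = 0 from hv), if_pos hv]
            change _ = edge _ _ (Sum.inl _) _
            rw [← eq_ray_of_hitTime p v₀ hm hv]
          · rw [if_neg (show ¬ d v = 0 from hv), if_neg hv]
            refine Eq.trans ?_ (HV_one v)
            change ι _ = ι _
            simp
        · rfl)
  have hlf := h.locFin_ray v₀ hinj n hn
  have hfl : ∀ K, IsCompact K → {v | ∃ m x, ι (flow p m v x) ∈ K}.Finite := fun K hK =>
    h.finite_flow (properFun_incl hlf K hK)
  refine ⟨H, properFun_of_finite₂ H.toContinuousMap (fun K hK => ?_) fun K hK => ?_⟩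
  · refine (hfl K hK).subset ?_
    rintro v ⟨τ, hτ⟩
    exact ⟨_, _, hτ⟩
  · have hf := finite_edges hlf hK
    refine ((((hf.preimage (f := Sum.inl) Sum.inl_injective.injOn).union (hfl K hK)).image
      Sum.inl).union ((hf.preimage (f := Sum.inr) Sum.inr_injective.injOn).image Sum.inr)).subset ?_
    rintro (v | i) ⟨τ, r, hr⟩
    · refine Or.inl ⟨v, ?_, rfl⟩
      change HE (Sum.inl v) (r, τ) ∈ K at hr
      rw [HE_inl] at hr
      split_ifs at hr
      · exact Or.inl ⟨r, hr⟩
      · exact Or.inr ⟨_, _, hr⟩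
    · exact Or.inr ⟨i, ⟨r, hr⟩, rfl⟩

include hm hinj in
theorem properHomotopyEquivalent_ray (h : FinDown p) (hn : ∀ k, {i | n i = k}.Finite) :
    ProperHomotopyEquivalent
      (Net (Sum.elim id fun i => p^[n i] v₀) (Sum.elim p fun i => p^[n i] v₀))
      (Net (Sum.elim id n) (Sum.elim Nat.succ n)) := by
  refine ⟨rayRetr p v₀ hm hinj n, rayIncl p v₀ n, properFun_rayRetr v₀ hm hinj n h hn,
    properFun_rayIncl v₀ hinj n h hn, (properlyHomotopic_rayRetr v₀ hm hinj n h hn).symm, ?_⟩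
  rw [rayRetr_comp_rayIncl]
  exact .of_proper fun K hK => hK

end retract

/-- A one-ended tree with a countable number of further edges is properly homotopy equivalent to
a ray with loops; the loops may be moved as far out as desired. -/
theorem exists_properHomotopyEquivalent_ray [Infinite V] (h : FinDown p) (hm : Merging p)
    {a b : E₁ → V} (ha : ∀ v, {i | a i = v}.Finite) (hb : ∀ v, {i | b i = v}.Finite) (f : E₁ → ℕ) :
    ∃ n : E₁ → ℕ, (∀ i, f i ≤ n i) ∧ ((∀ k, {i | n i = k}.Finite) → ProperHomotopyEquivalent
      (Net (Sum.elim id a) (Sum.elim p b)) (Net (Sum.elim id n) (Sum.elim Nat.succ n))) := by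
  obtain ⟨v₀⟩ : Nonempty V := inferInstance
  have hinj := h.injective_iterate hm v₀
  have key : ∀ i, ∃ n, f i ≤ n ∧ (∃ m, p^[m] (a i) = p^[n] v₀) ∧ ∃ m, p^[m] (b i) = p^[n] v₀ := by
    intro i
    obtain ⟨m₁, n₁, h₁⟩ := hm (a i) v₀
    obtain ⟨m₂, n₂, h₂⟩ := hm (b i) v₀
    -- The flow lines of the two ends join the ray at positions `n₁` and `n₂`; the common target
    -- lies beyond both, and beyond `f i`.
    refine ⟨f i + n₁ + n₂, by omega, ⟨f i + n₂ + m₁, ?_⟩, ⟨f i + n₁ + m₂, ?_⟩⟩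
    · rw [Function.iterate_add_apply, h₁, ← Function.iterate_add_apply]
      congr 1; omega
    · rw [Function.iterate_add_apply, h₂, ← Function.iterate_add_apply]
  choose n hfn hna hnb using key
  exact ⟨n, hfn, fun hn => (properHomotopyEquivalent_slide_flow h ha hb hna hnb).trans
    (properHomotopyEquivalent_ray v₀ hm hinj n h hn)⟩

/-- The realization of the Loch Ness Monster graph. -/
noncomputable def lochNessHomeo : Net (Sum.elim id id) (Sum.elim Nat.succ id) ≃ₜ
    lochNessMonster.Realization :=
  lochNessMonster.realizationHomeo (E := ℕ ⊕ ℕ) (Sum.elim id id) (Sum.elim Nat.succ id)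
    (Equiv.refl _) (by rintro (n | n) <;> rfl)

/-- The flow on the ray only goes outwards, so `i ≤ n i` is what allows the loop at `i` to be slid
to `n i`. -/
theorem properHomotopyEquivalent_lochNess (n : ℕ → ℕ) (hn : ∀ i, i ≤ n i) :
    ProperHomotopyEquivalent (Net (Sum.elim id id) (Sum.elim Nat.succ id))
      (Net (Sum.elim id n) (Sum.elim Nat.succ n)) := by
  have hid : ∀ v : ℕ, {i : ℕ | id i = v}.Finite := fun v => Set.finite_singleton v
  have : ∀ i, ∃ m, Nat.succ^[m] (id i) = n i := fun i => ⟨n i - i, by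
    rw [Nat.succ_iterate]; exact Nat.add_sub_cancel' (hn i)⟩
  exact properHomotopyEquivalent_slide_flow finDown_succ hid hid this this

end Net

/-! ### Fundamental groups of realizations -/

namespace Net

open CategoryTheory

variable {V E : Type} {s t : E → V}

/-- The product of the fundamental group composes paths in the opposite order, so the factors are
exchanged. -/
theorem mem_of_trans {X : Type*} [TopologicalSpace X] {b : X} (H : Subgroup (FundamentalGroup X b))
    {p q : Path.Homotopic.Quotient b b} (hp : p ∈ H) (hq : q ∈ H) : p.trans q ∈ H :=
  H.mul_mem (x := q) (y := p) hq hp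

theorem groupoid_rotate {C : Type*} [Groupoid C] {b c x y : C} (f : b ⟶ c) (A : c ⟶ x) (B : c ⟶ y)
    (ρ : x ⟶ b) (ρ' : y ⟶ b) : Groupoid.inv ρ ≫ (Groupoid.inv A ≫ B) ≫ ρ' =
      Groupoid.inv ((f ≫ A) ≫ ρ) ≫ (f ≫ B) ≫ ρ' := by
  simp

theorem groupoid_conj {C D : Type*} [Groupoid C] [Groupoid D] (F : C ⥤ D) {x y : C} (P : x ⟶ y)
    (l : y ⟶ y) (h : F.map ((P ≫ l) ≫ Groupoid.inv P) = 𝟙 _) : F.map l = 𝟙 _ := by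
  rw [F.map_comp, F.map_comp] at h
  have h2 : F.map (Groupoid.inv P) = Groupoid.inv (F.map P) := by simp
  rw [h2, Groupoid.inv_eq_inv, ← IsIso.eq_comp_inv] at h
  rw [← cancel_epi (F.map P)]
  simpa using h

theorem groupoid_trans {C : Type*} [Groupoid C] {b x y z : C} (ρ : x ⟶ b) (ρ' : y ⟶ b)
    (ρ'' : z ⟶ b) (A : x ⟶ y) (B : y ⟶ z) :
    (Groupoid.inv ρ ≫ A ≫ ρ') ≫ Groupoid.inv ρ' ≫ B ≫ ρ'' = Groupoid.inv ρ ≫ (A ≫ B) ≫ ρ'' := by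
  simp

theorem groupoid_cancel {C : Type*} [Groupoid C] {b x y : C} (ρ : x ⟶ b) (ρ' : y ⟶ b)
    (A : x ⟶ y) : ρ ≫ (Groupoid.inv ρ ≫ A ≫ ρ') ≫ Groupoid.inv ρ' = A := by
  simp

/-- The initial segment of an edge, as a path. -/
def edgeTo (s t : E → V) (e : E) (r : I) (x : Net s t) (hx : edge s t e r = x) :
    Path (vtx s t (s e)) x where
  toFun τ := edge s t e (τ * r)
  continuous_toFun := by fun_prop
  source' := by simp
  target' := by simp [hx]

/-- A path inside an edge is determined up to homotopy by its end points. -/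
theorem mk_eq_of_edge {x y : Net s t} (η : Path x y) (e : E) (μ : C(I, I))
    (h : ∀ τ, η τ = edge s t e (μ τ)) :
    Path.Homotopic.Quotient.mk η =
      ((Path.Homotopic.Quotient.mk (edgeTo s t e (μ 0) x (by rw [← h, η.source]))).symm).trans
        (Path.Homotopic.Quotient.mk (edgeTo s t e (μ 1) y (by rw [← h, η.target]))) := by
  have hx : x = edge s t e (μ 0) := by rw [← h, η.source]
  have hy : y = edge s t e (μ 1) := by rw [← h, η.target]
  subst hx hy
  let f : C(I, Net s t) := ⟨edge s t e, continuous_edge e⟩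
  let μ' : Path (μ 0) (μ 1) := ⟨μ, rfl, rfl⟩
  let A : ∀ r : I, Path (0 : I) r := fun r => ⟨⟨fun τ => τ * r, by fun_prop⟩, by simp, by simp⟩
  -- In the contractible interval, paths with equal ends are homotopic; the relation is then pushed
  -- forward by the characteristic map.
  have hI : Path.Homotopic.Quotient.mk μ' = (Path.Homotopic.Quotient.mk (A (μ 0))).symm.trans
      (Path.Homotopic.Quotient.mk (A (μ 1))) := by
    have : ContractibleSpace I := (convex_Icc (0 : ℝ) 1).contractibleSpace ⟨0, by simp⟩
    exact Subsingleton.elim _ _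
  have := congrArg (fun q => q.map f) hI
  have h0 : edge s t e 0 = vtx s t (s e) := edge_zero e
  have key : ∀ (z : Net s t) (hz : z = edge s t e 0) ,
      Path.Homotopic.Quotient.mk η =
      (Path.Homotopic.Quotient.mk (((A (μ 0)).map f.continuous).cast hz rfl)).symm.trans
        (Path.Homotopic.Quotient.mk (((A (μ 1)).map f.continuous).cast hz rfl)) := by
    rintro _ rfl
    refine Eq.trans ?_ (this.trans ?_)
    · refine congrArg _ ?_
      ext τ
      exact h τ
    · exact (congrArg Path.Homotopic.Quotient.mk
        (((A (μ 0)).symm.map_trans (A (μ 1)) f.continuous)))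
  exact key _ h0.symm

/-- The map that collapses the outer thirds of every edge to its ends. -/
noncomputable def stretch (s t : E → V) : C(Net s t, Net s t) where
  toFun := lift (vtx s t) (fun e r => edge s t e (Set.projIcc 0 1 zero_le_one (3 * r - 1)))
    (fun e => by rw [Set.projIcc_of_le_left _ (by simp)]; exact edge_zero e)
    (fun e => by rw [Set.projIcc_of_right_le _ (by norm_num)]; exact edge_one e)
  continuous_toFun := continuous_lift _ _ _ _ fun e =>
    (continuous_edge e).comp (continuous_projIcc.comp (by fun_prop))

/-- Linear interpolation on each edge. Since vertices stay fixed, stretching does not change the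
class of a loop based at a vertex, yet it crushes open stars to vertices. -/
theorem stretch_homotopy (s t : E → V) : ∃ H : ContinuousMap.Homotopy (ContinuousMap.id (Net s t))
    (stretch s t), ∀ τ v, H (τ, vtx s t v) = vtx s t v := by
  let m : I × I → I := fun x => ⟨(1 - x.2) * x.1 + x.2 * Set.projIcc 0 1 zero_le_one (3 * x.1.1 - 1), by
    obtain ⟨h0, h1⟩ := (Set.projIcc (0 : ℝ) 1 zero_le_one (3 * x.1.1 - 1)).2
    obtain ⟨h2, h3⟩ := x.1.2
    obtain ⟨h4, h5⟩ := x.2.2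
    constructor <;> nlinarith⟩
  have hm : Continuous m := by
    refine Continuous.subtype_mk ?_ _
    have : Continuous fun x : I × I => Set.projIcc (0 : ℝ) 1 zero_le_one (3 * x.1.1 - 1) :=
      continuous_projIcc.comp (by fun_prop)
    fun_prop
  refine ⟨homotopy _ _ (fun v => ContinuousMap.const _ (vtx s t v))
    (fun e => ⟨fun x => edge s t e (m x), by fun_prop⟩) (fun e τ => ?_) (fun e τ => ?_)
    (fun v => rfl) (fun v => rfl) (fun e r => ?_) (fun e r => ?_), fun τ v => rfl⟩
  · have : m (0, τ) = 0 := Subtype.ext (by simp [m, Set.projIcc_of_le_left])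
    simp [this]
  · have : m (1, τ) = 1 := Subtype.ext (by
      have : Set.projIcc (0 : ℝ) 1 zero_le_one (3 * (1 : I).1 - 1) = ⟨1, by simp⟩ :=
        Set.projIcc_of_right_le _ (by norm_num)
      simp only [m, this]
      simp)
    simp [this]
  · change edge s t e _ = edge s t e r
    congr 1
    exact Subtype.ext (by simp [m])
  · change edge s t e _ = edge s t e _
    congr 1
    exact Subtype.ext (by simp [m])

/-- The open star of a vertex. -/
def star (s t : E → V) (v : V) : Set (Net s t) :=
  {x | lift (fun w => w = v) (fun e (r : I) => ((r : ℝ) < 1 / 3 ∧ s e = v) ∨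
    (2 / 3 < (r : ℝ) ∧ t e = v)) (fun e => by norm_num) (fun e => by norm_num) x}

/-- The interior of an edge. -/
def openCell (s t : E → V) (e : E) : Set (Net s t) :=
  {x | lift (fun _ => False) (fun e' (r : I) => e' = e ∧ r ≠ 0 ∧ r ≠ 1) (by simp) (by simp) x}

theorem isOpen_star (v : V) : IsOpen (star s t v) := by
  refine isOpen_iff.2 fun e => ?_
  change IsOpen {r : I | ((r : ℝ) < 1 / 3 ∧ s e = v) ∨ (2 / 3 < (r : ℝ) ∧ t e = v)}
  exact ((isOpen_lt continuous_subtype_val continuous_const).inter isOpen_const).union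
    ((isOpen_lt continuous_const continuous_subtype_val).inter isOpen_const)

theorem isOpen_openCell (e : E) : IsOpen (openCell s t e) := by
  refine isOpen_iff.2 fun e' => ?_
  change IsOpen {r : I | e' = e ∧ r ≠ 0 ∧ r ≠ 1}
  exact isOpen_const.inter (isOpen_ne.inter isOpen_ne)

theorem stretch_of_mem_star {v : V} {x : Net s t} (hx : x ∈ star s t v) :
    stretch s t x = vtx s t v := by
  induction x using ind with
  | hv w =>
    change vtx s t w = _
    rw [show w = v from hx]
  | he e r =>
    change edge s t e _ = _
    rcases (show ((r : ℝ) < 1 / 3 ∧ s e = v) ∨ (2 / 3 < (r : ℝ) ∧ t e = v) from hx) with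
      ⟨h, rfl⟩ | ⟨h, rfl⟩
    · rw [Set.projIcc_of_le_left _ (by linarith)]; exact edge_zero e
    · rw [Set.projIcc_of_right_le _ (by linarith)]; exact edge_one e

theorem mem_openCell {e : E} {x : Net s t} (hx : x ∈ openCell s t e) :
    ∃ r, x = edge s t e r ∧ r ≠ 0 ∧ r ≠ 1 := by
  induction x using ind with
  | hv w => exact hx.elim
  | he e' r =>
    obtain ⟨rfl, h⟩ : e' = e ∧ r ≠ 0 ∧ r ≠ 1 := hx
    exact ⟨r, rfl, h⟩

/-- The coordinate of the points in the interior of an edge is continuous. -/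
theorem exists_coord {Z : Type*} [TopologicalSpace Z] (f : C(Z, Net s t)) (e : E)
    (hf : ∀ z, f z ∈ openCell s t e) : ∃ μ : C(Z, I), ∀ z, f z = edge s t e (μ z) := by
  classical
  -- The coordinate equals `b / a`. Both functions vanish at the ends of the edge, hence are
  -- continuous on the whole space, and `a` has no zero inside the edge.
  let a : Net s t → ℝ := lift (fun _ => 0) (fun e' r => if e' = e then (r : ℝ) * (1 - r) else 0)
    (by simp) (by simp)
  let b : Net s t → ℝ := lift (fun _ => 0)
    (fun e' r => if e' = e then (r : ℝ) * ((r : ℝ) * (1 - r)) else 0) (by simp) (by simp)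
  have ha : Continuous a := continuous_lift _ _ _ _ fun e' => by split_ifs <;> fun_prop
  have hb : Continuous b := continuous_lift _ _ _ _ fun e' => by split_ifs <;> fun_prop
  choose r hr h0 h1 using fun z => mem_openCell (hf z)
  have haz : ∀ z, a (f z) = (r z : ℝ) * (1 - r z) := fun z => by simp [hr z, a]
  have hbz : ∀ z, b (f z) = (r z : ℝ) * ((r z : ℝ) * (1 - r z)) := fun z => by simp [hr z, b]
  have hne : ∀ z, a (f z) ≠ 0 := fun z => by
    rw [haz]
    exact mul_ne_zero (fun h => h0 z (Subtype.ext h)) (fun h => h1 z (Subtype.ext (by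
      simp only [Set.Icc.coe_one]; linarith)))
  have hr' : ∀ z, (r z : ℝ) = b (f z) / a (f z) := fun z => by
    rw [eq_div_iff (hne z), haz, hbz]
  refine ⟨⟨r, ?_⟩, hr⟩
  refine continuous_induced_rng.2 ?_
  simp only [Function.comp_def, hr']
  exact (hb.comp f.continuous).div (ha.comp f.continuous) hne

variable {v₀ : V} (c : ∀ v, Path.Homotopic.Quotient (vtx s t v₀) (vtx s t v))
  (H : Subgroup (FundamentalGroup (Net s t) (vtx s t v₀)))
  (hH : ∀ e, ((c (s e)).trans (.mk (edgePath s t e))).trans (c (t e)).symm ∈ H)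

-- At a vertex the return path is `c` backwards, and `hH` handles the edges ending there. A point
-- inside an edge lies on no other edge, so running back to the source and then along `c` backwards
-- works at once.
include hH in
theorem exists_return (x : Net s t) : ∃ ρ : Path.Homotopic.Quotient x (vtx s t v₀),
    ∀ e r hx, ((c (s e)).trans (.mk (edgeTo s t e r x hx))).trans ρ ∈ H := by
  obtain ⟨v, rfl⟩ | ⟨e', r', h0, h1, rfl⟩ := cases x
  · refine ⟨(c v).symm, fun e r hx => ?_⟩
    rcases edge_eq_vtx hx with ⟨rfl, rfl⟩ | ⟨rfl, rfl⟩
    · have : edgeTo s t e 0 (vtx s t (s e)) hx = Path.refl _ := by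
        ext τ
        change edge s t e (τ * 0) = vtx s t (s e)
        rw [mul_zero, edge_zero]
      rw [this, Path.Homotopic.Quotient.mk_refl, Path.Homotopic.Quotient.trans_refl,
        Path.Homotopic.Quotient.trans_symm]
      exact H.one_mem
    · have : edgeTo s t e 1 (vtx s t (t e)) hx = edgePath s t e := by
        ext τ
        change edge s t e (τ * 1) = edge s t e τ
        rw [mul_one]
      rw [this]
      exact hH e
  · refine ⟨((c (s e')).trans (.mk (edgeTo s t e' r' _ rfl))).symm, fun e r hx => ?_⟩
    obtain ⟨rfl, rfl⟩ := edge_eq_edge h0 h1 hx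
    rw [Path.Homotopic.Quotient.trans_symm]
    exact H.one_mem

include hH in
/-- The fundamental group is generated by the loops given by the edges and a choice of paths to
the vertices. -/
theorem eq_top_of_edges (hc : c v₀ = .refl _) (hs : ∀ v, ∃ e, s e = v) : H = ⊤ := by
  choose ρ hρ using exists_return c H hH
  -- The chosen return path at the base vertex need not be constant; being in `H` is enough to undo
  -- it at the end.
  have hb : ρ (vtx s t v₀) ∈ H := by
    obtain ⟨e, rfl⟩ := hs v₀
    have := hρ (vtx s t (s e)) e 0 (edge_zero e)
    have h2 : edgeTo s t e 0 (vtx s t (s e)) (edge_zero e) = Path.refl _ := by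
      ext τ
      change edge s t e (τ * 0) = vtx s t (s e)
      rw [mul_zero, edge_zero]
    rw [h2, hc, Path.Homotopic.Quotient.mk_refl, Path.Homotopic.Quotient.trans_refl,
      Path.Homotopic.Quotient.refl_trans] at this
    exact this
  have hloc : ∀ {x y : Net s t} (η : Path x y) (e : E) (μ : C(I, I)),
      (∀ τ, η τ = edge s t e (μ τ)) →
      ((ρ x).symm.trans ((Path.Homotopic.Quotient.mk η).trans (ρ y))) ∈ H := by
    intro x y η e μ hμ
    rw [mk_eq_of_edge η e μ hμ]
    have h1 := hρ x e (μ 0) (by rw [← hμ, η.source])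
    have h2 := hρ y e (μ 1) (by rw [← hμ, η.target])
    have := groupoid_rotate (C := FundamentalGroupoid (Net s t)) (b := ⟨vtx s t v₀⟩)
      (c := ⟨vtx s t (s e)⟩) (x := ⟨x⟩) (y := ⟨y⟩) (c (s e))
      (.mk (edgeTo s t e (μ 0) x (by rw [← hμ, η.source])))
      (.mk (edgeTo s t e (μ 1) y (by rw [← hμ, η.target]))) (ρ x) (ρ y)
    refine (congrArg (· ∈ H) this).mpr ?_
    exact mem_of_trans H (H.inv_mem h1) h2
  refine (Subgroup.eq_top_iff' H).2 fun g => ?_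
  induction g using Path.Homotopic.Quotient.ind with
  | mk γ =>
  obtain ⟨F, hF⟩ := stretch_homotopy s t
  let δ : Path (vtx s t v₀) (vtx s t v₀) := γ.map (stretch s t).continuous
  have hγδ : Path.Homotopic.Quotient.mk γ = .mk δ := by
    refine Path.Homotopic.Quotient.eq.2 ⟨⟨⟨⟨fun x => F (x.1, γ x.2), by fun_prop⟩, fun x => ?_,
      fun x => ?_⟩, ?_⟩⟩
    · exact F.apply_zero _
    · exact F.apply_one _
    · rintro τ x (rfl | rfl)
      · change F (τ, γ 0) = γ 0
        rw [γ.source, hF]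
      · change F (τ, γ 1) = γ 1
        rw [γ.target, hF]
  -- The loop `γ` is subdivided so that each piece lies in an open star or an open edge. After
  -- stretching, a piece of the first kind is constant and one of the second kind stays in its edge,
  -- so `hloc` applies to the pieces of `δ`.
  obtain ⟨u, hu0, hmono, ⟨N, hN⟩, hcov⟩ := exists_monotone_Icc_subset_open_cover_unitInterval
    (c := fun i : V ⊕ E => γ ⁻¹' (Sum.elim (star s t) (openCell s t) i))
    (by rintro (v | e)
        · exact (isOpen_star v).preimage γ.continuous
        · exact (isOpen_openCell e).preimage γ.continuous)
    (fun τ _ => by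
      rw [Set.mem_iUnion]
      obtain ⟨v, hv⟩ | ⟨e, r, h0, h1, hr⟩ := cases (γ τ)
      · exact ⟨Sum.inl v, by rw [Set.mem_preimage, hv]; exact rfl⟩
      · exact ⟨Sum.inr e, by rw [Set.mem_preimage, hr]; exact ⟨rfl, h0, h1⟩⟩)
  have hstep : ∀ n, ((ρ (δ (u n))).symm.trans ((Path.Homotopic.Quotient.mk
      (δ.subpath (u n) (u (n + 1)))).trans (ρ (δ (u (n + 1)))))) ∈ H := by
    intro n
    let f : C(I, Net s t) := ⟨fun τ => γ (Set.Icc.convexComb (u n) (u (n + 1)) τ), by fun_prop⟩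
    have hf : ∀ τ, (δ.subpath (u n) (u (n + 1))) τ = stretch s t (f τ) := fun τ => rfl
    have hmem : ∀ τ, Set.Icc.convexComb (u n) (u (n + 1)) τ ∈ Set.Icc (u n) (u (n + 1)) :=
      fun τ => by
        have := Set.mem_range_self (f := Set.Icc.convexComb (u n) (u (n + 1))) τ
        rwa [Path.range_subpathAux, Set.uIcc_of_le (hmono n.le_succ)] at this
    obtain ⟨v | e, hi⟩ := hcov n
    · obtain ⟨e, rfl⟩ := hs v
      refine hloc _ e (ContinuousMap.const _ 0) fun τ => ?_
      have : f τ ∈ star s t (s e) := hi (hmem τ)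
      rw [hf, stretch_of_mem_star this]
      exact (edge_zero e).symm
    · obtain ⟨μ, hμ⟩ := exists_coord f e fun τ => hi (hmem τ)
      refine hloc _ e ⟨fun τ => Set.projIcc 0 1 zero_le_one (3 * μ τ - 1),
        continuous_projIcc.comp (by fun_prop)⟩ fun τ => ?_
      rw [hf, hμ]
      rfl
  have hall : ∀ n, ((ρ (δ (u 0))).symm.trans ((Path.Homotopic.Quotient.mk
      (δ.subpath (u 0) (u n))).trans (ρ (δ (u n))))) ∈ H := by
    intro n
    induction n with
    | zero =>
      rw [Path.subpath_self, Path.Homotopic.Quotient.mk_refl, Path.Homotopic.Quotient.refl_trans,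
        Path.Homotopic.Quotient.symm_trans]
      exact H.one_mem
    | succ n ih =>
      have h1 : Path.Homotopic.Quotient.mk (δ.subpath (u 0) (u (n + 1))) =
          (Path.Homotopic.Quotient.mk (δ.subpath (u 0) (u n))).trans
            (.mk (δ.subpath (u n) (u (n + 1)))) :=
        (Path.Homotopic.Quotient.eq.2 ⟨Path.Homotopy.subpathTransSubpath _ _ _ _⟩).symm
      have h2 := mem_of_trans H ih (hstep n)
      have h3 := groupoid_trans (C := FundamentalGroupoid (Net s t)) (b := ⟨vtx s t v₀⟩)
        (x := ⟨δ (u 0)⟩) (y := ⟨δ (u n)⟩) (z := ⟨δ (u (n + 1))⟩) (ρ (δ (u 0))) (ρ (δ (u n)))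
        (ρ (δ (u (n + 1)))) (.mk (δ.subpath (u 0) (u n))) (.mk (δ.subpath (u n) (u (n + 1))))
      rw [h1]
      exact (congrArg (· ∈ H) h3).mp h2
  have h1 := hall N
  rw [hN N le_rfl, hu0] at h1
  have h2 : ∀ (x y : Net s t) (hx : x = vtx s t v₀) (hy : y = vtx s t v₀),
      ((ρ x).symm.trans ((Path.Homotopic.Quotient.mk (δ.cast hx hy)).trans (ρ y))) ∈ H →
      Path.Homotopic.Quotient.mk δ ∈ H := by
    rintro _ _ rfl rfl h
    have h3 := mem_of_trans H hb (mem_of_trans H h (H.inv_mem hb))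
    have h4 := groupoid_cancel (C := FundamentalGroupoid (Net s t)) (b := ⟨vtx s t v₀⟩)
      (x := ⟨vtx s t v₀⟩) (y := ⟨vtx s t v₀⟩) (ρ _) (ρ _) (.mk δ)
    exact (congrArg (· ∈ H) h4).mp h3
  rw [hγδ]
  rw [Path.subpath_zero_one] at h1
  exact h2 _ _ δ.source δ.target h1

end Net

/-! ### The ray with loops: its rank and its end -/

namespace Net

variable {V E : Type} {s t : E → V}

theorem joinedIn_edge {F : Set (Net s t)} {e : E} (h : ∀ r, edge s t e r ∈ F) (r : I) :
    JoinedIn F (vtx s t (s e)) (edge s t e r) :=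
  ⟨edgeTo s t e r _ rfl, fun τ => h (τ * r)⟩

theorem joinedIn_ends {F : Set (Net s t)} {e : E} (h : ∀ r, edge s t e r ∈ F) :
    JoinedIn F (vtx s t (s e)) (vtx s t (t e)) :=
  ⟨edgePath s t e, h⟩

section ray

variable {E₁ : Type} (n : E₁ → ℕ)

theorem joinedIn_ray {F : Set (Net (Sum.elim id n) (Sum.elim Nat.succ n))} {N : ℕ}
    (h0 : vtx _ _ N ∈ F) (h : ∀ k, N ≤ k → ∀ r, edge _ _ (Sum.inl k) r ∈ F) {k : ℕ} (hk : N ≤ k) :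
    JoinedIn F (vtx _ _ N) (vtx _ _ k) := by
  induction k, hk using Nat.le_induction with
  | base => exact JoinedIn.refl h0
  | succ k hk ih => exact ih.trans (joinedIn_ends (e := Sum.inl k) (h k hk))

instance pathConnectedSpace_ray : PathConnectedSpace (Net (Sum.elim id n) (Sum.elim Nat.succ n)) := by
  have hv : ∀ k, Joined (vtx (Sum.elim id n) (Sum.elim Nat.succ n) 0) (vtx _ _ k) := fun k =>
    joinedIn_univ.1 (joinedIn_ray n (F := Set.univ) trivial (fun _ _ _ => trivial) k.zero_le)
  have : ∀ x, Joined (vtx (Sum.elim id n) (Sum.elim Nat.succ n) 0) x := by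
    intro x
    induction x using ind with
    | hv k => exact hv k
    | he e r => exact (hv _).trans (joinedIn_univ.1 (joinedIn_edge (F := Set.univ) (fun _ => trivial) r))
  exact ⟨⟨vtx _ _ 0⟩, fun x y => (this x).symm.trans (this y)⟩

/-- The classes of the paths along the ray. -/
noncomputable def rayPath : ∀ k : ℕ, Path.Homotopic.Quotient
    (vtx (Sum.elim id n) (Sum.elim Nat.succ n) 0) (vtx (Sum.elim id n) (Sum.elim Nat.succ n) k)
  | 0 => .refl _
  | k + 1 => (rayPath k).trans (.mk (edgePath (Sum.elim id n) (Sum.elim Nat.succ n) (Sum.inl k)))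

/-- A ray with finitely many loops has finite rank. -/
theorem groupRank_ray_ne_top [Finite E₁] : groupRank
    (FundamentalGroup (Net (Sum.elim id n) (Sum.elim Nat.succ n)) (vtx _ _ 0)) ≠ ⊤ := by
  let S : Set (FundamentalGroup (Net (Sum.elim id n) (Sum.elim Nat.succ n)) (vtx _ _ 0)) :=
    Set.range fun i => ((rayPath n (n i)).trans (.mk (edgePath (Sum.elim id n)
      (Sum.elim Nat.succ n) (Sum.inr i)))).trans (rayPath n (n i)).symm
  have hS : Subgroup.closure S = ⊤ := by
    refine eq_top_of_edges (rayPath n) _ ?_ rfl fun v => ⟨Sum.inl v, rfl⟩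
    rintro (k | i)
    · change ((rayPath n k).trans _).trans ((rayPath n k).trans _).symm ∈ _
      have := Path.Homotopic.Quotient.trans_symm ((rayPath n k).trans
        (.mk (edgePath (Sum.elim id n) (Sum.elim Nat.succ n) (Sum.inl k))))
      exact (congrArg (· ∈ Subgroup.closure S) this).mpr (Subgroup.one_mem _)
    · exact Subgroup.subset_closure ⟨i, rfl⟩
  have h1 : groupRank (FundamentalGroup (Net (Sum.elim id n) (Sum.elim Nat.succ n)) (vtx _ _ 0)) ≤
      S.encard := iInf_le _ (⟨S, hS⟩ : {S : Set _ // Subgroup.closure S = ⊤})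
  exact (h1.trans_lt (Set.finite_range _).encard_lt_top).ne

end ray

/-- The realization of the Loch Ness Monster graph is one-ended. -/
theorem oneEnded_ray : OneEnded (Net (Sum.elim id id) (Sum.elim Nat.succ id)) := by
  set X := Net (Sum.elim id id) (Sum.elim Nat.succ id) with hX
  have hfar : ∀ K : Set X, IsCompact K → ∃ N, ∀ e : ℕ ⊕ ℕ, N ≤ Sum.elim id id e →
      ∀ r, edge _ _ e r ∈ Kᶜ := by
    intro K hK
    have hlf := locFin_nat id (fun k => Set.finite_singleton k)
    obtain ⟨N, hN⟩ := ((finite_edges hlf hK).image (Sum.elim id id)).bddAbove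
    refine ⟨N + 1, fun e he r hr => ?_⟩
    have := hN ⟨e, ⟨r, hr⟩, rfl⟩
    omega
  have hvtx : ∀ {K : Set X} {N k : ℕ}, (∀ e : ℕ ⊕ ℕ, N ≤ Sum.elim id id e →
      ∀ r, edge _ _ e r ∈ Kᶜ) → N ≤ k → vtx _ _ k ∈ Kᶜ := by
    intro K N k h hk
    have := h (Sum.inl k) hk 0
    rwa [edge_zero] at this
  have hjoin : ∀ {K : Set X} {N k l : ℕ} (h : ∀ e : ℕ ⊕ ℕ, N ≤ Sum.elim id id e →
      ∀ r, edge _ _ e r ∈ Kᶜ) (hk : N ≤ k) (hl : N ≤ l),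
      JoinedIn Kᶜ (vtx (Sum.elim id id) (Sum.elim Nat.succ id) k) (vtx _ _ l) := by
    intro K N k l h hk hl
    have key : ∀ m, N ≤ m → JoinedIn Kᶜ (vtx (Sum.elim id id) (Sum.elim Nat.succ id) N) (vtx _ _ m) :=
      fun m hm => joinedIn_ray id (hvtx h le_rfl) (fun k hk => h (Sum.inl k) hk) hm
    exact (key k hk).symm.trans (key l hl)
  choose N hN using hfar
  let ε : EndSpace X := .mk (fun K hK => .mk ⟨vtx _ _ (N K hK), hvtx (hN K hK) le_rfl⟩) (by
    intro K L hK hL h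
    rw [piZeroCompl_mk]
    have h1 := (hjoin (hN L hL) le_rfl (le_max_left _ (N K hK))).mono (Set.compl_subset_compl.2 h)
    have h2 := hjoin (hN K hK) le_rfl (le_max_right (N L hL) _)
    exact ZerothHomotopy.sound (h1.trans h2.symm).joined_subtype.somePath)
  refine ⟨⟨⟨ε⟩, fun ε' => ?_⟩⟩
  ext K hK
  change _ = ZerothHomotopy.mk (⟨vtx _ _ (N K hK), hvtx (hN K hK) le_rfl⟩ : (Kᶜ : Set X))
  -- An arbitrary end is evaluated at `K` enlarged by the finitely many edges near the origin; any
  -- representative there lies on an edge far out, and so is joined to the ray outside `K`.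
  have hF : {e : ℕ ⊕ ℕ | Sum.elim id id e < N K hK}.Finite := by
    refine (((Set.finite_Iio (N K hK)).image Sum.inl).union
      ((Set.finite_Iio (N K hK)).image Sum.inr)).subset ?_
    rintro (k | k) h
    · exact Or.inl ⟨k, h, rfl⟩
    · exact Or.inr ⟨k, h, rfl⟩
  have hL := hK.union (isCompact_sub (s := Sum.elim id id) (t := Sum.elim Nat.succ id)
    Set.finite_empty hF)
  rw [← ε'.piZeroCompl_comp hK hL Set.subset_union_left]
  generalize ε'.comp _ hL = z
  induction z using ZerothHomotopy.rec with
  | mk x =>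
    rw [piZeroCompl_mk]
    refine ZerothHomotopy.sound (JoinedIn.joined_subtype ?_).somePath
    obtain ⟨x, hx⟩ := x
    have hx' : x ∉ sub (Sum.elim id id) (Sum.elim Nat.succ id) ∅
      {e : ℕ ⊕ ℕ | Sum.elim id id e < N K hK} := fun h => hx (Or.inr h)
    have he : ∀ e r, x = edge (Sum.elim id id) (Sum.elim Nat.succ id) e r →
        N K hK ≤ Sum.elim id id e := by
      rintro e r rfl
      by_contra! h
      exact hx' (Or.inr (Set.mem_biUnion (x := e) h ⟨r, rfl⟩))
    have : ∃ e r, x = edge (Sum.elim id id) (Sum.elim Nat.succ id) e r := by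
      induction x using ind with
      | hv k => exact ⟨Sum.inl k, 0,
        (edge_zero (s := Sum.elim id id) (t := Sum.elim Nat.succ id) (Sum.inl k)).symm⟩
      | he e r => exact ⟨e, r, rfl⟩
    obtain ⟨e, r, rfl⟩ := this
    have hm := he e r rfl
    exact (joinedIn_edge (hN K hK e hm) r).symm.trans (hjoin (hN K hK) hm le_rfl)

/-- A loop that is not null-homotopic in the circle. -/
theorem circle_loop_ne_refl (γ : Path (0 : AddCircle (1 : ℝ)) 0)
    (h : ∀ τ : I, γ τ = ((τ : ℝ) : AddCircle (1 : ℝ))) :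
    Path.Homotopic.Quotient.mk γ ≠ .refl 0 := by
  intro heq
  have cov := AddCircle.isCoveringMap_coe (1 : ℝ)
  -- The lift of the loop ends at `1`, whereas the lift of the constant loop ends at `0`.
  let η : Path (0 : ℝ) 1 := ⟨⟨fun τ => τ, by fun_prop⟩, rfl, rfl⟩
  have h1 := cov.monodromy_map (Path.Homotopic.Quotient.mk η)
  have h0 : ((1 : ℝ) : AddCircle (1 : ℝ)) = 0 := AddCircle.coe_period 1
  have h2 : ∀ (y : AddCircle (1 : ℝ)) (hy : y = 0) (q : Path.Homotopic.Quotient 0 y),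
      q = Path.Homotopic.Quotient.mk (γ.cast rfl hy) →
      ((cov.monodromy q ⟨0, rfl⟩ : _) : ℝ) = 0 := by
    rintro _ rfl q rfl
    rw [Path.cast_rfl_rfl, heq, cov.monodromy_refl]
    rfl
  have h3 := h2 _ h0 ((Path.Homotopic.Quotient.mk η).map ⟨_, cov.continuous⟩) (by
    refine congrArg Path.Homotopic.Quotient.mk ?_
    ext τ
    exact (h τ).symm)
  rw [h1] at h3
  exact one_ne_zero h3

/-- The realization of the Loch Ness Monster graph has infinite rank. -/
theorem groupRank_ray : groupRank
    (FundamentalGroup (Net (Sum.elim id id) (Sum.elim Nat.succ id)) (vtx _ _ 0)) = ⊤ := by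
  classical
  refine iInf_eq_top.2 fun S => Set.encard_eq_top_iff.2 fun hfin => ?_
  obtain ⟨S, hS⟩ := S
  set X := Net (Sum.elim id id) (Sum.elim Nat.succ id) with hX
  have hlf := locFin_nat id (fun k => Set.finite_singleton k)
  choose rep hrep using fun g : FundamentalGroup X (vtx _ _ 0) =>
    Path.Homotopic.Quotient.mk_surjective g
  -- Representatives of finitely many generators meet finitely many loops of the graph, so all of
  -- them miss some loop `m`.
  have hfin' := (hfin.biUnion fun g _ =>
    (finite_edges hlf (isCompact_range (rep g).continuous)).preimage (f := Sum.inr)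
      Sum.inr_injective.injOn)
  obtain ⟨m, hm⟩ := hfin'.exists_notMem
  -- Everything except the loop `m` is collapsed to a point. The induced map kills all generators
  -- but not the conjugate of the loop `m`.
  let q : C(X, AddCircle (1 : ℝ)) := ⟨lift (fun _ => 0) (Sum.rec (fun _ _ => 0)
      (fun i (r : I) => if i = m then ((r : ℝ) : AddCircle (1 : ℝ)) else 0))
    (by rintro (k | i)
        · rfl
        · simp)
    (by rintro (k | i)
        · rfl
        · change (if i = m then ((1 : ℝ) : AddCircle (1 : ℝ)) else 0) = 0
          rw [AddCircle.coe_period, ite_self]), continuous_lift _ _ _ _ (by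
    rintro (k | i)
    · exact continuous_const
    · change Continuous fun r : I => if i = m then ((r : ℝ) : AddCircle (1 : ℝ)) else 0
      split_ifs
      · exact (AddCircle.isCoveringMap_coe (1 : ℝ)).continuous.comp continuous_subtype_val
      · exact continuous_const)⟩
  have hq : ∀ g ∈ S, ∀ τ, q (rep g τ) = 0 := by
    intro g hg τ
    have : ∀ x, x ∈ Set.range (rep g) → q x = 0 := by
      intro x hx
      induction x using ind with
      | hv k => rfl
      | he e r =>
        rcases e with k | i
        · rfl
        · change (if i = m then _ else _) = _
          rw [if_neg]
          rintro rfl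
          exact hm (Set.mem_biUnion hg ⟨r, hx⟩)
    exact this _ ⟨τ, rfl⟩
  let φ : FundamentalGroup X (vtx _ _ 0) →* FundamentalGroup (AddCircle (1 : ℝ)) (0 : AddCircle (1 : ℝ)) :=
    FundamentalGroup.map q _
  have hφ : φ = 1 := by
    refine MonoidHom.eq_of_eqOn_dense hS fun g hg => ?_
    rw [← hrep g]
    refine congrArg Path.Homotopic.Quotient.mk ?_
    ext τ
    exact hq g hg τ
  let ℓ : Path.Homotopic.Quotient (vtx (Sum.elim id id) (Sum.elim Nat.succ id) m) (vtx _ _ m) :=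
    .mk (edgePath _ _ (Sum.inr m))
  let P := rayPath (id : ℕ → ℕ) m
  have h1 : φ ((P.trans ℓ).trans P.symm) = 1 := by rw [hφ]; rfl
  have h2 : ℓ.map q = .refl _ := by
    have h3 := groupoid_conj (FundamentalGroupoid.map q) (x := ⟨vtx _ _ 0⟩) (y := ⟨vtx _ _ m⟩) P ℓ h1
    exact h3
  exact circle_loop_ne_refl ((edgePath (Sum.elim id id) (Sum.elim Nat.succ id) (Sum.inr m)).map
    q.continuous) (fun τ => if_pos rfl) h2

end Net

/-! ### One-ended spanning trees -/

namespace SimpleGraph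

variable {V : Type} (G : SimpleGraph V)

/-- Adjacency within a set of vertices. -/
def StepIn (A : Set V) (u v : V) : Prop := u ∈ A ∧ v ∈ A ∧ G.Adj u v

/-- Two vertices are linked in `A` if they are equal or joined by a walk in `A`. -/
def LinkedIn (A : Set V) : V → V → Prop := Relation.ReflTransGen (G.StepIn A)

variable {G} {A B : Set V} {u v w : V}

theorem StepIn.symm (h : G.StepIn A u v) : G.StepIn A v u := ⟨h.2.1, h.1, h.2.2.symm⟩

theorem LinkedIn.symm (h : G.LinkedIn A u v) : G.LinkedIn A v u := by
  have : Std.Symm (G.StepIn A) := ⟨fun _ _ h => h.symm⟩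
  exact Std.Symm.symm (r := Relation.ReflTransGen (G.StepIn A)) _ _ h

theorem LinkedIn.trans (h : G.LinkedIn A u v) (h' : G.LinkedIn A v w) : G.LinkedIn A u w :=
  Relation.ReflTransGen.trans h h'

theorem LinkedIn.mono (h : A ⊆ B) (h' : G.LinkedIn A u v) : G.LinkedIn B u v :=
  Relation.ReflTransGen.mono (show G.StepIn A ≤ G.StepIn B from
    fun _ _ h'' => ⟨h h''.1, h h''.2.1, h''.2.2⟩) _ _ h'

theorem LinkedIn.mem (h : G.LinkedIn A u v) (hu : u ∈ A) : v ∈ A := by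
  induction h with
  | refl => exact hu
  | tail _ h _ => exact h.2.1

theorem LinkedIn.exists_crossing {p : V → Prop} (h : G.LinkedIn A u v) (hu : p u) (hv : ¬ p v) :
    ∃ x y, G.StepIn A x y ∧ p x ∧ ¬ p y := by
  induction h with
  | refl => exact absurd hu hv
  | @tail b c _ h ih =>
    by_cases hb : p b
    · exact ⟨b, c, h, hb, hv⟩
    · exact ih hb

theorem LinkedIn.component (h : G.LinkedIn A u v) :
    G.LinkedIn {x | x ∈ A ∧ G.LinkedIn A u x} u v := by
  induction h with
  | refl => exact .refl
  | @tail b c hb h ih => exact ih.tail ⟨⟨h.1, hb⟩, ⟨h.2.1, hb.tail h⟩, h.2.2⟩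

theorem LinkedIn.exists_finite (h : G.LinkedIn A u v) (hu : u ∈ A) :
    ∃ C ⊆ A, C.Finite ∧ u ∈ C ∧ v ∈ C ∧ ∀ x ∈ C, G.LinkedIn C u x := by
  induction h with
  | refl => exact ⟨{u}, by simpa, Set.finite_singleton u, rfl, rfl, by rintro _ rfl; exact .refl⟩
  | @tail b c _ h ih =>
    obtain ⟨C, hCA, hC, huC, hbC, hl⟩ := ih
    refine ⟨insert c C, Set.insert_subset h.2.1 hCA, hC.insert c, Or.inr huC, Or.inl rfl, ?_⟩
    rintro x (rfl | hx)
    · exact ((hl b hbC).mono (Set.subset_insert _ _)).tail ⟨Or.inr hbC, Or.inl rfl, h.2.2⟩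
    · exact (hl x hx).mono (Set.subset_insert _ _)

/-- Combinatorial one-endedness: every finite set of vertices is avoided by a cofinite set of
vertices that is connected. -/
def OneEndedGraph (G : SimpleGraph V) : Prop :=
  ∀ D : Set V, D.Finite → ∃ A : Set V, Aᶜ.Finite ∧ Disjoint A D ∧ ∀ u ∈ A, ∀ v ∈ A, G.LinkedIn A u v

/-- Choose a finite connected `C ⊆ A` through `n`, and through `v` if `v ∈ A`, and let `A'` be the
cofinite component of `A \ C`. The layer `A \ A'` is connected: a walk in `A` from the layer to `n`
can enter `A'` only after meeting `C`, and from `C` one reaches `n` inside `C`. -/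
theorem OneEndedGraph.exists_layer [Infinite V] (hG : G.OneEndedGraph) {n v : V}
    (hA : Aᶜ.Finite) (hl : ∀ u ∈ A, ∀ v ∈ A, G.LinkedIn A u v) (hn : n ∈ A) :
    ∃ (A' : Set V) (c n' : V), A'ᶜ.Finite ∧ (∀ u ∈ A', ∀ v ∈ A', G.LinkedIn A' u v) ∧ n' ∈ A' ∧
      A' ⊆ A ∧ n ∉ A' ∧ v ∉ A' ∧ c ∈ A \ A' ∧ G.Adj c n' ∧
      ∀ x ∈ A \ A', G.LinkedIn (A \ A') x c := by
  obtain ⟨C, hCA, hC, hnC, hvC, hCl⟩ : ∃ C ⊆ A, C.Finite ∧ n ∈ C ∧ (v ∈ A → v ∈ C) ∧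
      ∀ x ∈ C, G.LinkedIn C n x := by
    by_cases hv : v ∈ A
    · obtain ⟨C, h1, h2, h3, h4, h5⟩ := (hl n hn v hv).exists_finite hn
      exact ⟨C, h1, h2, h3, fun _ => h4, h5⟩
    · exact ⟨{n}, by simpa, Set.finite_singleton n, rfl, fun h => absurd h hv,
        by rintro _ rfl; exact .refl⟩
  set D := Aᶜ ∪ C with hD
  obtain ⟨B, hB, hBD, hBl⟩ := hG D (hA.union hC)
  obtain ⟨b, hb⟩ : B.Nonempty := by
    have := hB.infinite_compl
    rw [compl_compl] at this
    exact this.nonempty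
  have hBD' : B ⊆ Dᶜ := hBD.subset_compl_right
  let A' : Set V := {x | x ∈ Dᶜ ∧ G.LinkedIn Dᶜ b x}
  have hA'A : A' ⊆ A := fun x hx => by
    by_contra h
    exact hx.1 (Or.inl h)
  have hbA' : b ∈ A' := ⟨hBD' hb, .refl⟩
  have hCA' : C ⊆ A \ A' := fun x hx => ⟨hCA hx, fun h => h.1 (Or.inr hx)⟩
  have hA'l : ∀ x ∈ A', G.LinkedIn A' b x := fun x hx => hx.2.component
  have hLn : ∀ x, G.LinkedIn A x n → x ∈ A \ A' → G.LinkedIn (A \ A') x n := by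
    intro x h
    induction h using Relation.ReflTransGen.head_induction_on with
    | refl => exact fun _ => .refl
    | @head x y hxy _ ih =>
      intro hx
      by_cases hxC : x ∈ C
      · exact (hCl x hxC).symm.mono hCA'
      · have hxD : x ∈ Dᶜ := by
          rintro (h | h)
          · exact h hx.1
          · exact hxC h
        have hy : y ∈ A \ A' := ⟨hxy.2.1, fun hy =>
          hx.2 ⟨hxD, hy.2.tail ⟨hy.1, hxD, hxy.2.2.symm⟩⟩⟩
        exact Relation.ReflTransGen.head ⟨hx, hy, hxy.2.2⟩ (ih hy)
  -- A walk in `A` from `n` to `b` has to cross into `A'`; the crossing edge is the exit of the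
  -- layer.
  obtain ⟨c, n', hcn, hc, hn'⟩ := (hl n hn b (hA'A hbA')).exists_crossing (p := fun x => x ∉ A')
    (hCA' hnC).2 (not_not.2 hbA')
  have hcL : c ∈ A \ A' := ⟨hcn.1, hc⟩
  refine ⟨A', c, n', hB.subset (Set.compl_subset_compl.2 fun x hx => ⟨hBD' hx, ?_⟩),
    fun u hu v hv => (hA'l u hu).symm.trans (hA'l v hv), not_not.1 hn', hA'A, (hCA' hnC).2,
    fun h => (hCA' (hvC (hA'A h))).2 h, hcL, hcn.2.2, fun x hx => ?_⟩
  · exact (hBl b hb x hx).mono hBD'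
  · exact (hLn x (hl x hx.1 n hn) hx).trans (hLn c (hl c hcL.1 n hn) hcL).symm

/-- In a connected set one can move towards a given vertex. -/
theorem exists_descent {L : Set V} {c : V} (h : ∀ x ∈ L, G.LinkedIn L x c) :
    ∃ (q : V → V) (d : V → ℕ), ∀ x ∈ L, x ≠ c → q x ∈ L ∧ G.Adj x (q x) ∧ d (q x) < d x := by
  classical
  let G' : SimpleGraph V := ⟨G.StepIn L, ⟨fun _ _ h => h.symm⟩, ⟨fun x h => h.2.2.ne rfl⟩⟩
  have key : ∀ x, x ∈ L → x ≠ c → ∃ y, y ∈ L ∧ G.Adj x y ∧ G'.dist y c < G'.dist x c := by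
    intro x hx hxc
    have hr : G'.Reachable x c := (G'.reachable_iff_reflTransGen x c).2 (h x hx)
    obtain ⟨w, hw⟩ := hr.exists_walk_length_eq_dist
    cases w with
    | nil => exact absurd rfl hxc
    | @cons _ y _ hxy w =>
      refine ⟨y, hxy.2.1, hxy.2.2, ?_⟩
      rw [← hw]
      exact (SimpleGraph.dist_le w).trans_lt (by simp)
  choose! q hq using key
  exact ⟨q, fun x => G'.dist x c, fun x hx hxc => hq x hx hxc⟩

/-- A connected one-ended countable graph has a one-ended spanning tree, given by the map that
moves every vertex one step towards the end. -/
theorem OneEndedGraph.exists_tree [Infinite V] [Countable V] (hG : G.OneEndedGraph)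
    (hconn : ∀ u v, G.LinkedIn Set.univ u v) :
    ∃ p : V → V, (∀ v, G.Adj v (p v)) ∧ Net.FinDown p ∧ Net.Merging p := by
  classical
  obtain ⟨f, hf⟩ := exists_surjective_nat V
  let St := {x : Set V × V // x.1ᶜ.Finite ∧ (∀ u ∈ x.1, ∀ v ∈ x.1, G.LinkedIn x.1 u v) ∧ x.2 ∈ x.1}
  have key : ∀ (j : ℕ) (x : St), ∃ (y : St) (c : V), y.1.1 ⊆ x.1.1 ∧ x.1.2 ∉ y.1.1 ∧ f j ∉ y.1.1 ∧
      c ∈ x.1.1 \ y.1.1 ∧ G.Adj c y.1.2 ∧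
      ∀ z ∈ x.1.1 \ y.1.1, G.LinkedIn (x.1.1 \ y.1.1) z c := by
    rintro j ⟨⟨A, n⟩, h1, h2, h3⟩
    obtain ⟨A', c, n', h4, h5, h6, h7⟩ := hG.exists_layer (v := f j) h1 h2 h3
    exact ⟨⟨⟨A', n'⟩, h4, h5, h6⟩, c, h7⟩
  choose next cen hsub hn hfj hc hadj hlink using key
  -- A state is a cofinite connected set with an entry vertex. The step `j` leaves `f j` behind, so
  -- the layers exhaust the graph.
  let S : ℕ → St := fun j => Nat.rec ⟨⟨Set.univ, f 0⟩, by simp, fun u _ v _ => hconn u v, trivial⟩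
    (fun j x => next j x) j
  let A : ℕ → Set V := fun j => (S j).1.1
  let n : ℕ → V := fun j => (S j).1.2
  let c : ℕ → V := fun j => cen j (S j)
  let L : ℕ → Set V := fun j => A j \ A (j + 1)
  have hA0 : A 0 = Set.univ := rfl
  have hAfin : ∀ j, (A j)ᶜ.Finite := fun j => (S j).2.1
  have hAanti : Antitone A := antitone_nat_of_succ_le fun j => hsub j (S j)
  have hnL : ∀ j, n j ∈ L j := fun j => ⟨(S j).2.2.2, hn j (S j)⟩
  have hcL : ∀ j, c j ∈ L j := fun j => hc j (S j)
  have hcn : ∀ j, G.Adj (c j) (n (j + 1)) := fun j => hadj j (S j)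
  have hLl : ∀ j, ∀ z ∈ L j, G.LinkedIn (L j) z (c j) := fun j => hlink j (S j)
  have hex : ∀ v, ∃ j, v ∉ A (j + 1) := fun v => by
    obtain ⟨j, rfl⟩ := hf v
    exact ⟨j, hfj j (S j)⟩
  let lev : V → ℕ := fun v => Nat.find (hex v)
  have hlev : ∀ v, v ∈ L (lev v) := fun v => by
    refine ⟨?_, Nat.find_spec (hex v)⟩
    rcases h : lev v with _ | j
    · rw [hA0]; trivial
    · exact not_not.1 (Nat.find_min (hex v) (show j < lev v by omega))
  have hlev_eq : ∀ v j, v ∈ L j → lev v = j := fun v j hv => by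
    refine (Nat.find_eq_iff (hex v)).2 ⟨hv.2, fun k hk h => h (hAanti (show k + 1 ≤ j by omega) hv.1)⟩
  choose q d hqd using fun j => exists_descent (hLl j)
  -- Within a layer descend to its exit; from the exit cross to the entry of the next layer.
  let p : V → V := fun v => if v = c (lev v) then n (lev v + 1) else q (lev v) v
  have hp_c : ∀ j, p (c j) = n (j + 1) := fun j => by
    simp only [p, hlev_eq _ _ (hcL j), if_true]
  have hp_ne : ∀ v, v ≠ c (lev v) → p v = q (lev v) v := fun v hv => if_neg hv
  have hp_lev : ∀ v, v ≠ c (lev v) → lev (p v) = lev v := fun v hv => by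
    rw [hp_ne v hv]
    exact hlev_eq _ _ (hqd _ v (hlev v) hv).1
  have hreach : ∀ k v, d (lev v) v ≤ k → ∃ m, p^[m] v = c (lev v) := by
    intro k
    induction k with
    | zero =>
      intro v hv
      by_contra h
      have := (hqd _ v (hlev v) fun h' => h ⟨0, h'⟩).2.2
      omega
    | succ k ih =>
      intro v hv
      by_cases hvc : v = c (lev v)
      · exact ⟨0, hvc⟩
      · have h1 := (hqd _ v (hlev v) hvc).2.2
        have h2 := hp_lev v hvc
        obtain ⟨m, hm⟩ := ih (p v) (by
          rw [h2, hp_ne v hvc]; omega)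
        exact ⟨m + 1, by rw [Function.iterate_succ_apply, hm, h2]⟩
  have hreach' : ∀ v i, ∃ m, p^[m] v = c (lev v + i) := by
    intro v i
    induction i with
    | zero => exact hreach _ v le_rfl
    | succ i ih =>
      obtain ⟨m, hm⟩ := ih
      obtain ⟨m', hm'⟩ := hreach _ (n (lev v + i + 1)) le_rfl
      refine ⟨m' + (m + 1), ?_⟩
      rw [Function.iterate_add_apply, Function.iterate_succ_apply', hm, hp_c, hm']
      exact congrArg c (hlev_eq _ _ (hnL (lev v + i + 1)))
  refine ⟨p, fun v => ?_, fun v => ?_, fun u v => ?_⟩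
  · by_cases hv : v = c (lev v)
    · have := hcn (lev v)
      rw [← hp_c, ← hv] at this
      exact this
    · rw [hp_ne v hv]
      exact (hqd _ v (hlev v) hv).2.1
  -- Levels never decrease along orbits, so every predecessor of `v` lies outside the cofinite set
  -- `A (lev v + 1)`.
  · have hmono : ∀ u, lev u ≤ lev (p u) := fun u => by
      by_cases hu : u = c (lev u)
      · have : lev (p u) = lev u + 1 := by
          conv_lhs => rw [hu, hp_c]
          exact hlev_eq _ _ (hnL (lev u + 1))
        omega
      · exact (hp_lev u hu).ge
    refine (hAfin (lev v + 1)).subset ?_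
    rintro u ⟨j, rfl⟩
    have : lev u ≤ lev (p^[j] u) := by
      induction j with
      | zero => exact le_rfl
      | succ j ih => rw [Function.iterate_succ_apply']; exact ih.trans (hmono _)
    exact fun hu => (hlev u).2 (hAanti (show lev u + 1 ≤ lev (p^[j] u) + 1 by omega) hu)
  -- An orbit visits the exit of every layer from its own level on; layer `lev u + lev v` serves for
  -- both.
  · obtain ⟨m, hm⟩ := hreach' u (lev v)
    obtain ⟨m', hm'⟩ := hreach' v (lev u)
    exact ⟨m, m', by rw [hm, hm', add_comm]⟩

end SimpleGraph

/-! ### Distances, walks and ends of pointed graphs -/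

namespace PointedGraph

variable (Γ : PointedGraph)

/-- The source of an edge in the chosen orientation. -/
noncomputable def src (e : Γ.E) : Γ.V := (Γ.ends e).out.1

/-- The target of an edge in the chosen orientation. -/
noncomputable def tgt (e : Γ.E) : Γ.V := (Γ.ends e).out.2

theorem mk_src_tgt (e : Γ.E) : s(Γ.src e, Γ.tgt e) = Γ.ends e := Quot.out_eq (Γ.ends e)

/-- The realization as an oriented graph. -/
noncomputable def netHomeo : Net Γ.src Γ.tgt ≃ₜ Γ.Realization :=
  Γ.realizationHomeo Γ.src Γ.tgt (Equiv.refl _) Γ.mk_src_tgt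

/-- All vertex degrees are finite. -/
def LocallyFinite : Prop := ∀ v, Γ.degree v < ⊤

/-- Any two vertices are joined by a walk. -/
def WalkConnected : Prop := ∀ u v, Γ.adjGraph.LinkedIn Set.univ u v

variable {Γ}

theorem LocallyFinite.finite_incident (h : Γ.LocallyFinite) (v : Γ.V) :
    {e | v ∈ Γ.ends e}.Finite :=
  Set.encard_lt_top_iff.1 (lt_of_le_of_lt le_self_add (h v))

theorem src_mem (e : Γ.E) : Γ.src e ∈ Γ.ends e := by rw [← mk_src_tgt]; simp

theorem tgt_mem (e : Γ.E) : Γ.tgt e ∈ Γ.ends e := by rw [← mk_src_tgt]; simp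

theorem mem_ends {e : Γ.E} {v : Γ.V} : v ∈ Γ.ends e ↔ v = Γ.src e ∨ v = Γ.tgt e := by
  rw [← mk_src_tgt]; simp

theorem LocallyFinite.locFin (h : Γ.LocallyFinite) : Net.LocFin Γ.src Γ.tgt := fun v =>
  ⟨(h.finite_incident v).subset fun e he => by
    rw [Set.mem_ofPred_eq, ← (he : Γ.src e = v)]; exact src_mem e,
   (h.finite_incident v).subset fun e he => by
    rw [Set.mem_ofPred_eq, ← (he : Γ.tgt e = v)]; exact tgt_mem e⟩

theorem linkedIn_src_tgt {A : Set Γ.V} {e : Γ.E} (hs : Γ.src e ∈ A) (ht : Γ.tgt e ∈ A) :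
    Γ.adjGraph.LinkedIn A (Γ.src e) (Γ.tgt e) := by
  by_cases h : Γ.src e = Γ.tgt e
  · rw [h]; exact .refl
  · exact .single ⟨hs, ht, h, e, (mk_src_tgt Γ e).symm⟩

theorem exists_edge_of_adj {u v : Γ.V} (h : Γ.adjGraph.Adj u v) :
    ∃ e, (Γ.src e = u ∧ Γ.tgt e = v) ∨ (Γ.src e = v ∧ Γ.tgt e = u) := by
  obtain ⟨-, e, he⟩ := h
  refine ⟨e, ?_⟩
  rw [← mk_src_tgt, Sym2.eq_iff] at he
  exact he

/-! ### Heights -/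

theorem height_base : Γ.height Γ.base = 0 := SimpleGraph.edist_self

theorem height_le_succ_of_adj {u v : Γ.V} (h : Γ.adjGraph.Adj u v) :
    Γ.height v ≤ Γ.height u + 1 := by
  have := Γ.adjGraph.edist_triangle (u := Γ.base) (v := u) (w := v)
  rwa [SimpleGraph.edist_eq_one_iff_adj.2 h] at this

theorem exists_adj_of_height {v : Γ.V} {n : ℕ} (h : Γ.height v = (n + 1 : ℕ)) :
    ∃ u, Γ.adjGraph.Adj u v ∧ Γ.height u = n := by
  have hne : Γ.adjGraph.edist v Γ.base ≠ ⊤ := by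
    rw [SimpleGraph.edist_comm]
    have : Γ.height v ≠ ⊤ := by rw [h]; exact ENat.natCast_ne_top _
    exact this
  obtain ⟨w, hw⟩ := SimpleGraph.exists_walk_of_edist_ne_top hne
  rw [SimpleGraph.edist_comm] at hw
  change _ = Γ.height v at hw
  cases w with
  | nil =>
    rw [h, SimpleGraph.Walk.length_nil] at hw
    exact absurd hw (by exact_mod_cast (Nat.succ_ne_zero n).symm)
  | @cons _ u _ hadj w =>
    refine ⟨u, hadj.symm, le_antisymm ?_ ?_⟩
    · have h1 := SimpleGraph.edist_le w
      rw [SimpleGraph.edist_comm] at h1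
      refine h1.trans ?_
      rw [h, SimpleGraph.Walk.length_cons] at hw
      exact_mod_cast (Nat.succ_injective (by exact_mod_cast hw)).le
    · have h1 := height_le_succ_of_adj hadj.symm
      rw [h] at h1
      push_cast at h1
      exact (ENat.add_le_add_iff_right (by simp)).1 h1

theorem WalkConnected.height_ne_top (h : Γ.WalkConnected) (v : Γ.V) : Γ.height v ≠ ⊤ := by
  have := h Γ.base v
  induction this with
  | refl => rw [height_base]; simp
  | tail _ h ih =>
    refine ne_top_of_le_ne_top ?_ (height_le_succ_of_adj h.2.2)
    simpa using ih

theorem WalkConnected.exists_height (h : Γ.WalkConnected) (v : Γ.V) : ∃ n : ℕ, Γ.height v = n :=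
  ⟨_, (ENat.natCast_toNat (h.height_ne_top v)).symm⟩

theorem LocallyFinite.finite_ball (h : Γ.LocallyFinite) (r : ℕ) :
    {v | Γ.height v ≤ r}.Finite := by
  induction r with
  | zero =>
    refine (Set.finite_singleton Γ.base).subset fun v hv => ?_
    have : Γ.height v = 0 := by simpa using hv
    exact (SimpleGraph.edist_eq_zero_iff.1 this).symm
  | succ r ih =>
    refine (ih.union (ih.biUnion fun u _ => (h.finite_incident u).biUnion fun e _ =>
      ((Set.finite_singleton (Γ.src e)).insert (Γ.tgt e)))).subset fun v hv => ?_
    by_cases hr : Γ.height v ≤ r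
    · exact Or.inl hr
    · obtain ⟨u, hadj, hu⟩ := exists_adj_of_height (v := v) (n := r) (le_antisymm hv (by
        push_cast; exact Order.add_one_le_of_lt (not_le.1 hr)))
      refine Or.inr (Set.mem_biUnion (x := u) hu.le ?_)
      obtain ⟨e, he⟩ := exists_edge_of_adj hadj
      have hue : u ∈ Γ.ends e := by rw [mem_ends]; tauto
      refine Set.mem_biUnion (x := e) hue ?_
      rcases he with ⟨-, h⟩ | ⟨h, -⟩
      · exact Or.inl h.symm
      · exact Or.inr h.symm

theorem countable_of_walkConnected (h : Γ.LocallyFinite) (hc : Γ.WalkConnected) : Countable Γ.V := by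
  have : (Set.univ : Set Γ.V) = ⋃ r : ℕ, {v | Γ.height v ≤ r} := by
    ext v
    obtain ⟨n, hn⟩ := hc.exists_height v
    simp only [Set.mem_univ, Set.mem_iUnion, true_iff]
    exact ⟨n, hn.le⟩
  rw [← Set.countable_univ_iff, this]
  exact Set.countable_iUnion fun r => (h.finite_ball r).countable

theorem exists_radius (hc : Γ.WalkConnected) {D : Set Γ.V} (hD : D.Finite) :
    ∃ r : ℕ, ∀ v ∈ D, Γ.height v ≤ r := by
  choose f hf using hc.exists_height
  obtain ⟨r, hr⟩ := (hD.image f).bddAbove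
  refine ⟨r, fun v hv => ?_⟩
  rw [hf v]
  exact_mod_cast hr ⟨v, hv, rfl⟩

/-- Outside of a ball, every vertex is linked to a vertex on the sphere around the ball. -/
theorem WalkConnected.exists_linkedIn_sphere (hc : Γ.WalkConnected) {r R : ℕ} (hrR : r < R) (v : Γ.V)
    (hv : R ≤ Γ.height v) :
    ∃ w, Γ.height w = R ∧ Γ.adjGraph.LinkedIn {x | r < Γ.height x} v w := by
  obtain ⟨n, hn⟩ := hc.exists_height v
  rw [hn] at hv
  have hRn : R ≤ n := by exact_mod_cast hv
  clear hv
  induction n, hRn using Nat.le_induction generalizing v with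
  | base => exact ⟨v, hn, .refl⟩
  | succ n hRn ih =>
    obtain ⟨u, hadj, hu⟩ := exists_adj_of_height hn
    obtain ⟨w, hw, hl⟩ := ih u hu
    refine ⟨w, hw, Relation.ReflTransGen.head ⟨?_, ?_, hadj.symm⟩ hl⟩
    · rw [Set.mem_ofPred_eq, hn]; exact_mod_cast (by omega : r < n + 1)
    · rw [Set.mem_ofPred_eq, hu]; exact_mod_cast (by omega : r < n)

/-! ### Path components of the realization -/

theorem joinedIn_of_adj {F : Set (Net Γ.src Γ.tgt)} {u v : Γ.V} (h : Γ.adjGraph.Adj u v)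
    (hF : ∀ e, (u ∈ Γ.ends e ∧ v ∈ Γ.ends e) → ∀ r, Net.edge _ _ e r ∈ F) :
    JoinedIn F (Net.vtx _ _ u) (Net.vtx _ _ v) := by
  obtain ⟨e, ⟨rfl, rfl⟩ | ⟨rfl, rfl⟩⟩ := exists_edge_of_adj h
  · exact Net.joinedIn_ends (hF e ⟨src_mem e, tgt_mem e⟩)
  · exact (Net.joinedIn_ends (hF e ⟨tgt_mem e, src_mem e⟩)).symm

theorem joinedIn_of_linkedIn {F : Set (Net Γ.src Γ.tgt)} {A : Set Γ.V} {u v : Γ.V}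
    (h : Γ.adjGraph.LinkedIn A u v) (hu : Net.vtx _ _ u ∈ F)
    (hF : ∀ e, (∀ v ∈ Γ.ends e, v ∈ A) → ∀ r, Net.edge _ _ e r ∈ F) :
    JoinedIn F (Net.vtx _ _ u) (Net.vtx _ _ v) := by
  induction h with
  | refl => exact JoinedIn.refl hu
  | @tail b c _ h ih =>
    refine ih.trans (joinedIn_of_adj h.2.2 fun e he => hF e fun w hw => ?_)
    rw [(Sym2.mem_and_mem_iff h.2.2.ne).1 he] at hw
    rcases Sym2.mem_iff.1 hw with rfl | rfl
    · exact h.1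
    · exact h.2.1

/-- The open set spanned by the vertices linked to `u` outside of `D`. -/
def component (Γ : PointedGraph) (D : Set Γ.V) (u : Γ.V) : Set (Net Γ.src Γ.tgt) :=
  {x | Net.lift (fun w => w ∉ D ∧ Γ.adjGraph.LinkedIn Dᶜ u w)
    (fun e (r : I) => (r ≠ 1 ∧ Γ.src e ∉ D ∧ Γ.adjGraph.LinkedIn Dᶜ u (Γ.src e)) ∨
      (r ≠ 0 ∧ Γ.tgt e ∉ D ∧ Γ.adjGraph.LinkedIn Dᶜ u (Γ.tgt e))) (by simp) (by simp) x}

theorem isOpen_component (D : Set Γ.V) (u : Γ.V) : IsOpen (Γ.component D u) := by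
  refine Net.isOpen_iff.2 fun e => ?_
  change IsOpen {r : I | (r ≠ 1 ∧ Γ.src e ∉ D ∧ Γ.adjGraph.LinkedIn Dᶜ u (Γ.src e)) ∨
      (r ≠ 0 ∧ Γ.tgt e ∉ D ∧ Γ.adjGraph.LinkedIn Dᶜ u (Γ.tgt e))}
  exact (isOpen_ne.inter isOpen_const).union (isOpen_ne.inter isOpen_const)

/-- An edge with one end in the component has its other end there or in `D`, so its trace on the
union is everything; every other edge meets the union at most in its ends. -/
theorem isClosed_component_union (D : Set Γ.V) (u : Γ.V) :
    IsClosed (Γ.component D u ∪ Net.vtx _ _ '' D) := by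
  refine Net.isClosed_iff.2 fun e => ?_
  set P := Γ.src e ∉ D ∧ Γ.adjGraph.LinkedIn Dᶜ u (Γ.src e)
  set Q := Γ.tgt e ∉ D ∧ Γ.adjGraph.LinkedIn Dᶜ u (Γ.tgt e)
  have hmem : ∀ r, r ∈ Net.edge Γ.src Γ.tgt e ⁻¹' (Γ.component D u ∪ Net.vtx _ _ '' D) ↔
      ((r ≠ 1 ∧ P) ∨ (r ≠ 0 ∧ Q)) ∨ ((r = 0 ∧ Γ.src e ∈ D) ∨ (r = 1 ∧ Γ.tgt e ∈ D)) := by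
    intro r
    refine or_congr Iff.rfl ⟨?_, ?_⟩
    · rintro ⟨v, hv, h⟩
      rcases Net.edge_eq_vtx h.symm with ⟨h0, rfl⟩ | ⟨h1, rfl⟩
      · exact Or.inl ⟨h0, hv⟩
      · exact Or.inr ⟨h1, hv⟩
    · rintro (⟨rfl, h⟩ | ⟨rfl, h⟩)
      · exact ⟨_, h, (Net.edge_zero e).symm⟩
      · exact ⟨_, h, (Net.edge_one e).symm⟩
  by_cases hPQ : P ∨ Q
  · have : Net.edge Γ.src Γ.tgt e ⁻¹' (Γ.component D u ∪ Net.vtx _ _ '' D) = Set.univ := by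
      refine Set.eq_univ_of_forall fun r => (hmem r).2 ?_
      have h1 : P → Γ.tgt e ∈ D ∨ Q := fun hP => by
        by_cases ht : Γ.tgt e ∈ D
        · exact Or.inl ht
        · exact Or.inr ⟨ht, hP.2.trans (linkedIn_src_tgt hP.1 ht)⟩
      have h2 : Q → Γ.src e ∈ D ∨ P := fun hQ => by
        by_cases hs : Γ.src e ∈ D
        · exact Or.inl hs
        · exact Or.inr ⟨hs, hQ.2.trans (linkedIn_src_tgt hs hQ.1).symm⟩
      by_cases hr0 : r = 0
      · have : r ≠ 1 := by rw [hr0]; exact zero_ne_one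
        tauto
      · by_cases hr1 : r = 1 <;> tauto
    rw [this]
    exact isClosed_univ
  · refine (((Set.finite_singleton (1 : I)).insert 0).subset fun r hr => ?_).isClosed
    have := (hmem r).1 hr
    have : r = 0 ∨ r = 1 := by tauto
    exact this

/-- In the complement of the vertices of `D` the component of `u` is clopen, so a path starting in
it never leaves it. -/
theorem linkedIn_of_joinedIn {D : Set Γ.V} {u v : Γ.V}
    (h : JoinedIn (Net.vtx Γ.src Γ.tgt '' D)ᶜ (Net.vtx _ _ u) (Net.vtx _ _ v)) :
    Γ.adjGraph.LinkedIn Dᶜ u v := by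
  obtain ⟨γ, hγ⟩ := h
  have hu : u ∉ D := fun hu => by
    have := hγ 0
    rw [γ.source] at this
    exact this ⟨u, hu, rfl⟩
  have heq : γ ⁻¹' (Γ.component D u) = γ ⁻¹' (Γ.component D u ∪ Net.vtx _ _ '' D) := by
    ext τ
    have := hγ τ
    simp only [Set.mem_preimage, Set.mem_union]
    simp only [Set.mem_compl_iff] at this
    tauto
  have hclopen : IsClopen (γ ⁻¹' (Γ.component D u)) :=
    ⟨heq ▸ (isClosed_component_union D u).preimage γ.continuous,
      (isOpen_component D u).preimage γ.continuous⟩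
  have huniv := hclopen.eq_univ ⟨0, by
    rw [Set.mem_preimage, γ.source]
    exact ⟨hu, .refl⟩⟩
  have h1 : (1 : I) ∈ γ ⁻¹' (Γ.component D u) := huniv ▸ Set.mem_univ _
  rw [Set.mem_preimage, γ.target] at h1
  exact (show v ∉ D ∧ Γ.adjGraph.LinkedIn Dᶜ u v from h1).2

theorem walkConnected_of_connectedSpace [ConnectedSpace Γ.Realization] : Γ.WalkConnected := by
  intro u v
  have : ConnectedSpace (Net Γ.src Γ.tgt) := Γ.netHomeo.symm.surjective.connectedSpace
    Γ.netHomeo.symm.continuous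
  have hclopen : IsClopen (Γ.component ∅ u) :=
    ⟨by simpa using isClosed_component_union (Γ := Γ) ∅ u, isOpen_component ∅ u⟩
  have huniv := hclopen.eq_univ ⟨Net.vtx _ _ u, ⟨by simp, .refl⟩⟩
  have hv : Net.vtx _ _ v ∈ Γ.component ∅ u := huniv ▸ Set.mem_univ _
  have := (show v ∉ (∅ : Set Γ.V) ∧ Γ.adjGraph.LinkedIn ∅ᶜ u v from hv).2
  rwa [Set.compl_empty] at this

theorem WalkConnected.pathConnectedSpace (h : Γ.WalkConnected) :
    PathConnectedSpace Γ.Realization := by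
  have hv : ∀ u, Joined (Net.vtx Γ.src Γ.tgt Γ.base) (Net.vtx _ _ u) := fun u =>
    joinedIn_univ.1 (joinedIn_of_linkedIn (h Γ.base u) trivial fun _ _ _ => trivial)
  have hx : ∀ x, Joined (Net.vtx Γ.src Γ.tgt Γ.base) x := by
    intro x
    induction x using Net.ind with
    | hv v => exact hv v
    | he e r => exact (hv _).trans (joinedIn_univ.1
        (Net.joinedIn_edge (F := Set.univ) (fun _ => trivial) r))
  have : PathConnectedSpace (Net Γ.src Γ.tgt) :=
    ⟨⟨Net.vtx _ _ Γ.base⟩, fun x y => (hx x).symm.trans (hx y)⟩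
  exact Γ.netHomeo.surjective.pathConnectedSpace Γ.netHomeo.continuous

/-- A one-ended locally finite graph is one-ended combinatorially. -/
theorem oneEndedGraph_of_oneEnded (hlf : Γ.LocallyFinite) (hc : Γ.WalkConnected)
    (h : OneEnded Γ.Realization) : Γ.adjGraph.OneEndedGraph := by
  intro D hD
  have h' : OneEnded (Net Γ.src Γ.tgt) :=
    h.of_properHomotopyEquivalent Γ.netHomeo.symm.properHomotopyEquivalent
  obtain ⟨u⟩ := h'
  set ε := u.default with hε
  have hK : IsCompact (Net.vtx Γ.src Γ.tgt '' D) := (hD.image _).isCompact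
  have hedge : ∀ e, (∀ v ∈ Γ.ends e, v ∈ Dᶜ) → ∀ r,
      Net.edge Γ.src Γ.tgt e r ∈ (Net.vtx Γ.src Γ.tgt '' D)ᶜ := by
    rintro e he r ⟨v, hv, hr⟩
    rcases Net.edge_eq_vtx hr.symm with ⟨-, rfl⟩ | ⟨-, rfl⟩
    · exact he _ (src_mem e) hv
    · exact he _ (tgt_mem e) hv
  have hvtx : ∀ v ∉ D, Net.vtx Γ.src Γ.tgt v ∈ (Net.vtx Γ.src Γ.tgt '' D)ᶜ := by
    rintro v hv ⟨w, hw, hwv⟩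
    exact hv (Net.vtx_injective hwv ▸ hw)
  -- The vertices in the component selected by the unique end.
  let A : Set Γ.V := {v | ∃ h : Net.vtx Γ.src Γ.tgt v ∈ (Net.vtx Γ.src Γ.tgt '' D)ᶜ,
    ZerothHomotopy.mk ⟨_, h⟩ = ε.comp _ hK}
  have hAD : ∀ v ∈ A, v ∉ D := fun v ⟨hv, _⟩ hvD => hv ⟨v, hvD, rfl⟩
  have hA : ∀ v ∈ A, ∀ w ∈ A, Γ.adjGraph.LinkedIn Dᶜ v w := by
    rintro v ⟨hv, hv'⟩ w ⟨hw, hw'⟩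
    have := Quotient.exact (hv'.trans hw'.symm)
    exact linkedIn_of_joinedIn ((joinedIn_iff_joined hv hw).2 this)
  have hA' : ∀ v ∈ A, ∀ w, w ∈ Dᶜ ∧ Γ.adjGraph.LinkedIn Dᶜ v w → w ∈ A := by
    rintro v ⟨hv, hv'⟩ w ⟨hw, hvw⟩
    refine ⟨hvtx w hw, Eq.trans ?_ hv'⟩
    exact (ZerothHomotopy.sound (joinedIn_of_linkedIn hvw hv hedge).joined_subtype.somePath).symm
  refine ⟨A, ?_, Set.disjoint_left.2 hAD, fun v hv w hw =>
    ((hA v hv w hw).component).mono (hA' v hv)⟩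
  by_contra hinf
  have hinf' : Infinite (Aᶜ : Set Γ.V) := Set.infinite_coe_iff.2 hinf
  -- If `A` missed infinitely many vertices, a nonprincipal ultrafilter on them would converge to an
  -- end, which uniqueness forbids.
  let 𝒰 : Ultrafilter Γ.V := (Filter.hyperfilter (Aᶜ : Set Γ.V)).map Subtype.val
  have hcof : ∀ B : Set Γ.V, Bᶜ.Finite → B ∈ 𝒰 := fun B hB =>
    Filter.compl_mem_hyperfilter_of_finite (s := (Subtype.val ⁻¹' Bᶜ : Set (Aᶜ : Set Γ.V)))
      (hB.preimage Subtype.val_injective.injOn) |> fun h => by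
        simpa [𝒰, Ultrafilter.mem_map] using h
  have hAc : Aᶜ ∈ 𝒰 := by
    rw [Ultrafilter.mem_map]
    have : (Subtype.val ⁻¹' Aᶜ : Set (Aᶜ : Set Γ.V)) = Set.univ :=
      Set.eq_univ_of_forall fun x => x.2
    rw [this]
    exact Filter.univ_mem
  have hex : ∀ L : Set (Net Γ.src Γ.tgt), IsCompact L → ∃ z : ZerothHomotopy (Lᶜ : Set _),
      {v | ∃ h : Net.vtx _ _ v ∈ Lᶜ, ZerothHomotopy.mk ⟨_, h⟩ = z} ∈ 𝒰 := by
    intro L hL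
    obtain ⟨r, hr⟩ := exists_radius hc (D := {v | Net.vtx Γ.src Γ.tgt v ∈ L} ∪
      Γ.src '' {e | ∃ r, Net.edge Γ.src Γ.tgt e r ∈ L})
      ((Net.finite_cells hL).1.union ((Net.finite_edges hlf.locFin hL).image _))
    -- Each distant vertex is joined outside `L` to the finite sphere of radius `r + 1`. So finitely
    -- many components of the complement of `L` contain all distant vertices, and the ultrafilter
    -- selects one of them.
    have hsub : {v | (r + 1 : ℕ) ≤ Γ.height v} ⊆ ⋃ w ∈ {w | Γ.height w ≤ (r + 1 : ℕ)},
        {v | JoinedIn Lᶜ (Net.vtx Γ.src Γ.tgt v) (Net.vtx _ _ w)} := by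
      intro v hv
      obtain ⟨w, hw, hl⟩ := hc.exists_linkedIn_sphere (Nat.lt_succ_self r) v hv
      refine Set.mem_biUnion (x := w) hw.le (joinedIn_of_linkedIn hl ?_ ?_)
      · intro hvL
        have h1 := (show ((r + 1 : ℕ) : ℕ∞) ≤ Γ.height v from hv).trans (hr v (Or.inl hvL))
        have : r + 1 ≤ r := by exact_mod_cast h1
        omega
      · intro e he ρ hρ
        exact (not_le.2 (he _ (src_mem e))) (hr _ (Or.inr ⟨e, ⟨ρ, hρ⟩, rfl⟩))
    have hmem := Filter.mem_of_superset (hcof _ ((hlf.finite_ball r).subset fun v hv => by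
      simp only [Set.mem_compl_iff, Set.mem_ofPred_eq, not_le] at hv ⊢
      push_cast at hv
      exact Order.le_of_lt_add_one hv)) hsub
    obtain ⟨w, -, hw⟩ := (Ultrafilter.finite_biUnion_mem_iff (hlf.finite_ball _)).1 hmem
    obtain ⟨v, hv⟩ := Ultrafilter.nonempty_of_mem hw
    refine ⟨ZerothHomotopy.mk ⟨_, hv.target_mem⟩, Filter.mem_of_superset hw fun v hv => ?_⟩
    exact ⟨hv.source_mem, ZerothHomotopy.sound hv.joined_subtype.somePath⟩
  choose z hz using hex
  let ε' : EndSpace (Net Γ.src Γ.tgt) := .mk z (by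
    intro K L hK hL h
    obtain ⟨v, ⟨h1, h2⟩, ⟨h3, h4⟩⟩ := Ultrafilter.nonempty_of_mem
      (Filter.inter_mem (hz K hK) (hz L hL))
    rw [← h2, ← h4, piZeroCompl_mk])
  have heq : ε' = ε := u.uniq ε'
  obtain ⟨v, hv, ⟨h1, h2⟩⟩ := Ultrafilter.nonempty_of_mem (Filter.inter_mem hAc (hz _ hK))
  exact hv ⟨h1, by rw [h2, ← heq]; rfl⟩

end PointedGraph

/-! ### Surplus edges and the proper homotopy classification -/

namespace PointedGraph

variable {Γ : PointedGraph}

/-- There are finite sets of vertices spanning arbitrarily many more edges than they have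
vertices. -/
def Crank (Γ : PointedGraph) (n : ℕ) : Prop :=
  ∃ (S : Finset Γ.V) (F : Finset Γ.E), (∀ e ∈ F, ∀ v ∈ Γ.ends e, v ∈ S) ∧ S.card + n ≤ F.card

section tree

variable {p : Γ.V → Γ.V} {τ : Γ.V → Γ.E}

/-- Two vertices could share their tree edge only if `p` exchanged them, but orbits have no
repetitions. -/
theorem injective_treeEdge [Infinite Γ.V] (hτ : ∀ v, Γ.ends (τ v) = s(v, p v))
    (hp : Net.FinDown p) (hm : Net.Merging p) : Function.Injective τ := by
  intro u v huv
  have h := hτ u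
  rw [huv, hτ v, Sym2.eq_iff] at h
  rcases h with ⟨h, -⟩ | ⟨h1, h2⟩
  · exact h.symm
  · have := hp.injective_iterate hm v (a₁ := 0) (a₂ := 2) (by
      change v = p (p v)
      rw [h2, ← h1])
    omega

/-- The realization, with its edges divided into the edges of a tree and the other edges. -/
noncomputable def treeHomeo (hτ : ∀ v, Γ.ends (τ v) = s(v, p v)) (hinj : Function.Injective τ)
    {E₁ : Type} (ν : E₁ ≃ ((Set.range τ)ᶜ : Set Γ.E)) :
    Net (Sum.elim id fun i => Γ.src (ν i)) (Sum.elim p fun i => Γ.tgt (ν i)) ≃ₜ Γ.Realization := by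
  classical
  exact Γ.realizationHomeo _ _ ((Equiv.sumCongr (Equiv.ofInjective τ hinj) ν).trans
    (Equiv.Set.sumCompl (Set.range τ))) (by
      rintro (v | i)
      · exact (hτ v).symm
      · exact mk_src_tgt Γ _)

theorem exists_properHomotopyEquivalent_ray_realization [Infinite Γ.V] (hlf : Γ.LocallyFinite)
    (hτ : ∀ v, Γ.ends (τ v) = s(v, p v)) (hp : Net.FinDown p) (hm : Net.Merging p)
    {E₁ : Type} (ν : E₁ ≃ ((Set.range τ)ᶜ : Set Γ.E)) (f : E₁ → ℕ) :
    ∃ n : E₁ → ℕ, (∀ i, f i ≤ n i) ∧ ((∀ k, {i | n i = k}.Finite) → ProperHomotopyEquivalent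
      Γ.Realization (Net (Sum.elim id n) (Sum.elim Nat.succ n))) := by
  have hν : Function.Injective fun i => (ν i : Γ.E) := Subtype.val_injective.comp ν.injective
  obtain ⟨n, hn, h⟩ := Net.exists_properHomotopyEquivalent_ray hp hm
    (a := fun i => Γ.src (ν i)) (b := fun i => Γ.tgt (ν i))
    (fun v => (hlf.locFin v).1.preimage hν.injOn) (fun v => (hlf.locFin v).2.preimage hν.injOn) f
  have : T2Space Γ.Realization := Γ.netHomeo.t2Space
  exact ⟨n, hn, fun hfin => (treeHomeo hτ (injective_treeEdge hτ hp hm) ν).symm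
    |>.properHomotopyEquivalent.trans (h hfin)⟩

/-- The extra edges are numbered by `ℕ`, and the `i`-th becomes a loop at a position at least `i`.
This keeps the loops locally finite, and allows them to be compared with one loop per vertex. -/
theorem properHomotopyEquivalent_lochNess_of_infinite [Infinite Γ.V] [Countable Γ.V]
    (hlf : Γ.LocallyFinite)
    (hτ : ∀ v, Γ.ends (τ v) = s(v, p v)) (hp : Net.FinDown p) (hm : Net.Merging p)
    (hinf : (Set.range τ)ᶜ.Infinite) :
    ProperHomotopyEquivalent Γ.Realization lochNessMonster.Realization := by
  have hcE : Countable Γ.E := by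
    rw [← Set.countable_univ_iff]
    refine (Set.countable_iUnion fun v => (hlf.finite_incident v).countable).mono fun e _ =>
      Set.mem_iUnion.2 ⟨Γ.src e, src_mem e⟩
  have : Infinite ((Set.range τ)ᶜ : Set Γ.E) := hinf.to_subtype
  obtain ⟨ν⟩ : Nonempty (ℕ ≃ ((Set.range τ)ᶜ : Set Γ.E)) := by
    obtain ⟨_⟩ := nonempty_denumerable ((Set.range τ)ᶜ : Set Γ.E)
    exact ⟨(Denumerable.eqv _).symm⟩
  obtain ⟨n, hn, h⟩ := exists_properHomotopyEquivalent_ray_realization hlf hτ hp hm ν id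
  have : T2Space Γ.Realization := Γ.netHomeo.t2Space
  have : T2Space lochNessMonster.Realization := lochNessMonster.netHomeo.t2Space
  exact ((h fun k => (Set.finite_Iic k).subset fun i hi => (hn i).trans (le_of_eq hi)).trans
    (Net.properHomotopyEquivalent_lochNess n hn).symm).trans
    Net.lochNessHomeo.properHomotopyEquivalent

theorem rank_ne_top_of_finite [Infinite Γ.V] (hlf : Γ.LocallyFinite)
    (hτ : ∀ v, Γ.ends (τ v) = s(v, p v)) (hp : Net.FinDown p) (hm : Net.Merging p)
    (hfin : (Set.range τ)ᶜ.Finite) : Γ.rank ≠ ⊤ := by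
  have : Finite ((Set.range τ)ᶜ : Set Γ.E) := hfin
  obtain ⟨n, -, h⟩ := exists_properHomotopyEquivalent_ray_realization hlf hτ hp hm
    (Equiv.refl _) fun _ => 0
  have := Net.pathConnectedSpace_ray n
  rw [rank, groupRank_fundamentalGroup_eq (h fun k => Set.toFinite _) _ (Net.vtx _ _ 0)]
  exact Net.groupRank_ray_ne_top n

theorem exists_common_iterate [Nonempty Γ.V] (hm : Net.Merging p) (W : Finset Γ.V) :
    ∃ x, ∀ w ∈ W, ∃ j, p^[j] w = x := by
  classical
  induction W using Finset.induction_on with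
  | empty => exact ⟨Classical.arbitrary _, by simp⟩
  | insert a W _ ih =>
    obtain ⟨x, hx⟩ := ih
    obtain ⟨m, n, hmn⟩ := hm a x
    refine ⟨p^[n] x, fun w hw => ?_⟩
    rcases Finset.mem_insert.1 hw with rfl | hw
    · exact ⟨m, hmn⟩
    · obtain ⟨j, hj⟩ := hx w hw
      exact ⟨n + j, by rw [Function.iterate_add_apply, hj]⟩

/-- Let `S` be the finite set of predecessors of a common iterate `x` of all ends of `n + 1` extra
edges. Every vertex of `S` but `x` contributes its tree edge, so `S` spans `|S| - 1` tree edges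
besides the `n + 1` others. -/
theorem crank_of_infinite [Infinite Γ.V] (hτ : ∀ v, Γ.ends (τ v) = s(v, p v))
    (hp : Net.FinDown p) (hm : Net.Merging p) (hinf : (Set.range τ)ᶜ.Infinite) (n : ℕ) :
    Γ.Crank n := by
  classical
  obtain ⟨F₀, hF₀, hcard⟩ := hinf.exists_subset_card_eq (n + 1)
  obtain ⟨x, hx⟩ := exists_common_iterate hm (F₀.image Γ.src ∪ F₀.image Γ.tgt)
  let S := (hp x).toFinset
  have hS : ∀ v, v ∈ S ↔ ∃ j, p^[j] v = x := fun v => Set.Finite.mem_toFinset _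
  have hxS : x ∈ S := (hS x).2 ⟨0, rfl⟩
  have hinj := injective_treeEdge hτ hp hm
  refine ⟨S, F₀ ∪ (S.erase x).image τ, fun e he v hv => ?_, ?_⟩
  · rcases Finset.mem_union.1 he with he | he
    · rw [hS]
      refine hx v (Finset.mem_union.2 ?_)
      rcases mem_ends.1 hv with rfl | rfl
      · exact Or.inl (Finset.mem_image_of_mem _ he)
      · exact Or.inr (Finset.mem_image_of_mem _ he)
    · obtain ⟨u, hu, rfl⟩ := Finset.mem_image.1 he
      obtain ⟨hux, hu⟩ := Finset.mem_erase.1 hu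
      rw [hτ, Sym2.mem_iff] at hv
      rcases hv with rfl | rfl
      · exact hu
      · obtain ⟨j, hj⟩ := (hS u).1 hu
        cases j with
        | zero => exact absurd hj hux
        | succ j => exact (hS _).2 ⟨j, hj⟩
  · rw [Finset.card_union_of_disjoint, Finset.card_image_of_injective _ hinj, hcard,
      Finset.card_erase_of_mem hxS]
    · have := Finset.card_pos.2 ⟨x, hxS⟩
      omega
    · refine Finset.disjoint_left.2 fun e he he' => hF₀ he ?_
      obtain ⟨u, -, rfl⟩ := Finset.mem_image.1 he'
      exact ⟨u, rfl⟩

/-- A tree edge `τ v` spanned by `S` has `v ∈ S`, so at most `|S|` tree edges are spanned, and any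
surplus consists of other edges. -/
theorem infinite_of_crank (hτ : ∀ v, Γ.ends (τ v) = s(v, p v)) (h : ∀ n, Γ.Crank n) :
    (Set.range τ)ᶜ.Infinite := by
  classical
  intro hfin
  obtain ⟨S, F, hF, hcard⟩ := h (hfin.toFinset.card + 1)
  have hsub : F ⊆ S.image τ ∪ hfin.toFinset := by
    intro e he
    by_cases h : e ∈ Set.range τ
    · obtain ⟨v, rfl⟩ := h
      exact Finset.mem_union_left _ (Finset.mem_image_of_mem _
        (hF _ he v (by rw [hτ]; exact Sym2.mem_mk_left _ _)))
    · exact Finset.mem_union_right _ (hfin.mem_toFinset.2 h)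
  have h1 := Finset.card_le_card hsub
  have h2 := Finset.card_union_le (S.image τ) hfin.toFinset
  have h3 := Finset.card_image_le (s := S) (f := τ)
  omega

end tree

theorem oneEnded_lochNess : OneEnded lochNessMonster.Realization :=
  Net.oneEnded_ray.of_properHomotopyEquivalent Net.lochNessHomeo.properHomotopyEquivalent

theorem rank_eq_top_of_properHomotopyEquivalent (hc : Γ.WalkConnected)
    (h : ProperHomotopyEquivalent Γ.Realization lochNessMonster.Realization) : Γ.rank = ⊤ := by
  have := hc.pathConnectedSpace
  have : T2Space Γ.Realization := Γ.netHomeo.t2Space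
  have : T2Space lochNessMonster.Realization := lochNessMonster.netHomeo.t2Space
  rw [rank, ← groupRank_fundamentalGroup_eq
    (Net.lochNessHomeo.properHomotopyEquivalent.trans h.symm) (Net.vtx _ _ 0)]
  exact Net.groupRank_ray

theorem exists_treeEdges [Infinite Γ.V] (hlf : Γ.LocallyFinite) (hc : Γ.WalkConnected)
    (h : Γ.adjGraph.OneEndedGraph) : ∃ (p : Γ.V → Γ.V) (τ : Γ.V → Γ.E),
      (∀ v, Γ.ends (τ v) = s(v, p v)) ∧ Net.FinDown p ∧ Net.Merging p := by
  have := countable_of_walkConnected hlf hc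
  obtain ⟨p, hadj, hp, hm⟩ := h.exists_tree hc
  choose τ hτ using fun v => (hadj v).2
  exact ⟨p, τ, hτ, hp, hm⟩

theorem properHomotopyEquivalent_lochNess_iff [Infinite Γ.V] (hlf : Γ.LocallyFinite)
    (hc : Γ.WalkConnected) : ProperHomotopyEquivalent Γ.Realization lochNessMonster.Realization ↔
      Γ.adjGraph.OneEndedGraph ∧ ∀ n, Γ.Crank n := by
  have := countable_of_walkConnected hlf hc
  constructor
  · intro h
    have h1 := oneEndedGraph_of_oneEnded hlf hc (oneEnded_lochNess.of_properHomotopyEquivalent h.symm)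
    obtain ⟨p, τ, hτ, hp, hm⟩ := exists_treeEdges hlf hc h1
    refine ⟨h1, crank_of_infinite hτ hp hm fun hfin => rank_ne_top_of_finite hlf hτ hp hm hfin ?_⟩
    exact rank_eq_top_of_properHomotopyEquivalent hc h
  · rintro ⟨h1, h2⟩
    obtain ⟨p, τ, hτ, hp, hm⟩ := exists_treeEdges hlf hc h1
    exact properHomotopyEquivalent_lochNess_of_infinite hlf hτ hp hm (infinite_of_crank hτ h2)

/-- For the converse neither the end space nor the fundamental group of `Γ` is computed: both
properties are transported from the Loch Ness Monster. -/
theorem oneEnded_and_rank_iff [Infinite Γ.V] (hlf : Γ.LocallyFinite) (hc : Γ.WalkConnected) :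
    OneEnded Γ.Realization ∧ Γ.rank = ⊤ ↔ Γ.adjGraph.OneEndedGraph ∧ ∀ n, Γ.Crank n := by
  constructor
  · rintro ⟨h, hr⟩
    have h1 := oneEndedGraph_of_oneEnded hlf hc h
    obtain ⟨p, τ, hτ, hp, hm⟩ := exists_treeEdges hlf hc h1
    exact ⟨h1, crank_of_infinite hτ hp hm fun hfin => rank_ne_top_of_finite hlf hτ hp hm hfin hr⟩
  · intro h
    have h' := (properHomotopyEquivalent_lochNess_iff hlf hc).2 h
    exact ⟨oneEnded_lochNess.of_properHomotopyEquivalent h'.symm,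
      rank_eq_top_of_properHomotopyEquivalent hc h'⟩

end PointedGraph

/-! ### Balls and local properties -/

namespace PointedGraph

variable {Γ Δ Θ : PointedGraph}

/-- The image of a geodesic from the base is a walk. All its vertices but the last have height below
`r`, so adjacency has to be preserved only from there. -/
theorem height_le_of_adj_map {r : ℕ} (α : Γ.V → Δ.V) (hb : α Γ.base = Δ.base)
    (h : ∀ u v, Γ.height u < r → Γ.adjGraph.Adj u v → Δ.adjGraph.Adj (α u) (α v))
    {v : Γ.V} (hv : Γ.height v ≤ r) : Δ.height (α v) ≤ Γ.height v := by
  have key : ∀ n : ℕ, n ≤ r → ∀ v, Γ.height v = n → Δ.height (α v) ≤ n := by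
    intro n
    induction n with
    | zero =>
      intro _ v hv
      have : Γ.base = v := SimpleGraph.edist_eq_zero_iff.1 (hv.trans Nat.cast_zero)
      rw [← this, hb, height_base]
      simp
    | succ n ih =>
      intro hn v hv
      obtain ⟨u, huv, hu⟩ := exists_adj_of_height hv
      refine (height_le_succ_of_adj (h u v ?_ huv)).trans ?_
      · rw [hu]; exact_mod_cast hn
      · push_cast
        gcongr
        exact ih (by omega) u hu
  obtain ⟨n, hn⟩ := ENat.ne_top_iff_exists.1 (ne_top_of_le_ne_top (ENat.natCast_ne_top r) hv)
  rw [← hn]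
  exact key n (by rw [← hn] at hv; exact_mod_cast hv) v hn.symm

/-- The inclusion of the vertices of a ball. -/
def ofBall {r : ℕ} (v : (Γ.ball r).V) : Γ.V := Subtype.val v

/-- The inclusion of the edges of a ball. -/
def ofBallE {r : ℕ} (e : (Γ.ball r).E) : Γ.E := Subtype.val e

/-- A vertex of small height, as a vertex of a ball. -/
def toBall {r : ℕ} (v : Γ.V) (h : Γ.height v ≤ r) : (Γ.ball r).V := ⟨v, h⟩

/-- An edge with an end of small height, as an edge of a ball. -/
def toBallE {r : ℕ} (e : Γ.E) (h : ∃ v ∈ Γ.ends e, Γ.height v < r) : (Γ.ball r).E := ⟨e, h⟩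

theorem ofBall_toBall {r : ℕ} (v : Γ.V) (h : Γ.height v ≤ r) : ofBall (toBall v h) = v := rfl

theorem ofBall_le {r : ℕ} (v : (Γ.ball r).V) : Γ.height (ofBall v) ≤ r := Subtype.prop v

theorem ofBallE_lt {r : ℕ} (e : (Γ.ball r).E) : ∃ v ∈ Γ.ends (ofBallE e), Γ.height v < r :=
  Subtype.prop e

theorem ofBall_injective {r : ℕ} : Function.Injective (ofBall : (Γ.ball r).V → Γ.V) :=
  Subtype.val_injective

theorem ofBallE_injective {r : ℕ} : Function.Injective (ofBallE : (Γ.ball r).E → Γ.E) :=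
  Subtype.val_injective

theorem ball_ends_map {r : ℕ} (e : (Γ.ball r).E) :
    ((Γ.ball r).ends e).map ofBall = Γ.ends (ofBallE e) :=
  Sym2.attachWith_map_subtypeVal _

theorem mem_ball_ends {r : ℕ} {e : (Γ.ball r).E} {v : (Γ.ball r).V} :
    v ∈ (Γ.ball r).ends e ↔ ofBall v ∈ Γ.ends (ofBallE e) := by
  rw [← ball_ends_map, Sym2.mem_map]
  exact ⟨fun h => ⟨v, h, rfl⟩, fun ⟨w, hw, h⟩ => ofBall_injective h ▸ hw⟩

theorem adj_of_ball_adj {r : ℕ} {u v : (Γ.ball r).V} (h : (Γ.ball r).adjGraph.Adj u v) :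
    Γ.adjGraph.Adj (ofBall u) (ofBall v) := by
  obtain ⟨hne, e, he⟩ := h
  exact ⟨fun h => hne (ofBall_injective h), ofBallE e, by rw [← ball_ends_map, he]; rfl⟩

theorem ball_adj {r : ℕ} {u v : Γ.V} (h : Γ.adjGraph.Adj u v) (hr : Γ.height u < r)
    (hu : Γ.height u ≤ r) (hv : Γ.height v ≤ r) :
    (Γ.ball r).adjGraph.Adj (toBall u hu) (toBall v hv) := by
  obtain ⟨hne, e, he⟩ := h
  refine ⟨fun h => hne (congrArg ofBall h), toBallE e ⟨u, by rw [he]; simp, hr⟩, ?_⟩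
  refine Sym2.map.injective ofBall_injective ?_
  rw [ball_ends_map]
  exact he

theorem ball_height {r : ℕ} (v : (Γ.ball r).V) : (Γ.ball r).height v = Γ.height (ofBall v) := by
  classical
  apply le_antisymm
  -- The value outside the ball is irrelevant, since an edge from a vertex of height below `r` ends
  -- in the ball.
  · let α : Γ.V → (Γ.ball r).V := fun v =>
      if h : Γ.height v ≤ r then toBall v h else (Γ.ball r).base
    have hα : ∀ v (h : Γ.height v ≤ r), α v = toBall v h := fun v h => dif_pos h
    have := height_le_of_adj_map (Δ := Γ.ball r) α (hα _ (by rw [height_base]; simp))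
      (fun u v hu huv => by
        have hv : Γ.height v ≤ r :=
          (height_le_succ_of_adj huv).trans (Order.add_one_le_of_lt hu)
        rw [hα u hu.le, hα v hv]
        exact ball_adj huv hu _ _) (ofBall_le v)
    rwa [hα _ (ofBall_le v)] at this
  · by_cases h : (Γ.ball r).height v = ⊤
    · rw [h]; exact le_top
    · obtain ⟨n, hn⟩ := ENat.ne_top_iff_exists.1 h
      exact height_le_of_adj_map (r := n) (Δ := Γ) ofBall rfl
        (fun u v _ huv => adj_of_ball_adj huv) hn.ge

theorem Iso.adj (f : Iso Γ Δ) {u v : Γ.V} (h : Γ.adjGraph.Adj u v) :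
    Δ.adjGraph.Adj (f.onV u) (f.onV v) := by
  obtain ⟨hne, e, he⟩ := h
  exact ⟨fun h => hne (f.onV.injective h), f.onE e, by rw [f.ends_onE, he]; rfl⟩

theorem Iso.height_le (f : Iso Γ Δ) (v : Γ.V) : Δ.height (f.onV v) ≤ Γ.height v := by
  by_cases h : Γ.height v = ⊤
  · rw [h]; exact le_top
  · obtain ⟨n, hn⟩ := ENat.ne_top_iff_exists.1 h
    exact height_le_of_adj_map (r := n) f.onV f.onV_base (fun u v _ => f.adj) hn.ge

theorem Iso.height (f : Iso Γ Δ) (v : Γ.V) : Δ.height (f.onV v) = Γ.height v := by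
  refine le_antisymm (f.height_le v) ?_
  have := f.symm.height_le (f.onV v)
  rwa [show f.symm.onV (f.onV v) = v from f.onV.symm_apply_apply v] at this

theorem Iso.exists_lt_iff (f : Iso Γ Δ) (r : ℕ) (e : Γ.E) :
    (∃ v ∈ Γ.ends e, Γ.height v < r) ↔ ∃ v ∈ Δ.ends (f.onE e), Δ.height v < r := by
  rw [f.ends_onE]
  simp only [Sym2.mem_map]
  constructor
  · rintro ⟨v, hv, h⟩
    exact ⟨_, ⟨v, hv, rfl⟩, by rwa [f.height]⟩
  · rintro ⟨_, ⟨v, hv, rfl⟩, h⟩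
    exact ⟨v, hv, by rwa [f.height] at h⟩

/-- The isomorphism of balls induced by an isomorphism. -/
def Iso.ball (f : Iso Γ Δ) (r : ℕ) : Iso (Γ.ball r) (Δ.ball r) where
  onV :=
    { toFun := fun v => toBall (f.onV (ofBall v)) (by rw [f.height]; exact ofBall_le v)
      invFun := fun v => toBall (f.onV.symm (ofBall v)) (by
        rw [← f.height, f.onV.apply_symm_apply]; exact ofBall_le v)
      left_inv := fun v => ofBall_injective (f.onV.symm_apply_apply _)
      right_inv := fun v => ofBall_injective (f.onV.apply_symm_apply _) }
  onE :=
    { toFun := fun e => toBallE (f.onE (ofBallE e)) ((f.exists_lt_iff r _).1 (ofBallE_lt e))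
      invFun := fun e => toBallE (f.onE.symm (ofBallE e)) (by
        rw [f.exists_lt_iff, f.onE.apply_symm_apply]; exact ofBallE_lt e)
      left_inv := fun v => ofBallE_injective (f.onE.symm_apply_apply _)
      right_inv := fun v => ofBallE_injective (f.onE.apply_symm_apply _) }
  ends_onE e := by
    refine Sym2.map.injective ofBall_injective ?_
    rw [ball_ends_map, Sym2.map_map]
    change Δ.ends (f.onE (ofBallE e)) = Sym2.map (f.onV ∘ ofBall) _
    rw [f.ends_onE, ← ball_ends_map, Sym2.map_map]
  onV_base := ofBall_injective f.onV_base

theorem ball_exists_lt_iff {r s : ℕ} (e : (Γ.ball s).E) :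
    (∃ v ∈ (Γ.ball s).ends e, (Γ.ball s).height v < r) ↔
      ∃ v ∈ Γ.ends (ofBallE e), Γ.height v < r := by
  rw [← ball_ends_map]
  simp only [Sym2.mem_map, ball_height]
  constructor
  · rintro ⟨v, hv, h⟩
    exact ⟨_, ⟨v, hv, rfl⟩, h⟩
  · rintro ⟨_, ⟨v, hv, rfl⟩, h⟩
    exact ⟨v, hv, h⟩

/-- A ball of a larger ball is a ball. -/
noncomputable def ballBall (Γ : PointedGraph) {r s : ℕ} (h : r ≤ s) :
    Iso ((Γ.ball s).ball r) (Γ.ball r) where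
  onV :=
    { toFun := fun v => toBall (ofBall (ofBall v)) (by rw [← ball_height]; exact ofBall_le v)
      invFun := fun v => toBall (toBall (ofBall v) ((ofBall_le v).trans (by exact_mod_cast h))) (by
        rw [ball_height]; exact ofBall_le v)
      left_inv := fun v => rfl
      right_inv := fun v => rfl }
  onE :=
    { toFun := fun e => toBallE (ofBallE (ofBallE e)) ((ball_exists_lt_iff _).1 (ofBallE_lt e))
      invFun := fun e => toBallE (toBallE (ofBallE e) ((ofBallE_lt e).imp fun v hv =>
        ⟨hv.1, hv.2.trans_le (by exact_mod_cast h)⟩))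
          ((ball_exists_lt_iff _).2 (ofBallE_lt e))
      left_inv := fun v => rfl
      right_inv := fun v => rfl }
  ends_onE e := by
    refine Sym2.map.injective ofBall_injective ?_
    rw [ball_ends_map, Sym2.map_map]
    change Γ.ends (ofBallE (ofBallE e)) = Sym2.map (ofBall ∘ ofBall) _
    rw [← Sym2.map_map, ball_ends_map, ball_ends_map]
  onV_base := rfl

theorem Iso.ballIso (f : Iso Γ Δ) (r : ℕ) : BallIso r Γ Δ := ⟨f.ball r⟩

theorem BallIso.refl (r : ℕ) (Γ : PointedGraph) : BallIso r Γ Γ := ⟨.refl _⟩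

theorem BallIso.trans {r : ℕ} : BallIso r Γ Δ → BallIso r Δ Θ → BallIso r Γ Θ :=
  fun ⟨f⟩ ⟨g⟩ => ⟨f.trans g⟩

theorem BallIso.mono {r s : ℕ} (h : r ≤ s) : BallIso s Γ Δ → BallIso r Γ Δ :=
  fun ⟨f⟩ => ⟨((Γ.ballBall h).symm.trans (f.ball r)).trans (Δ.ballBall h)⟩

/-- A property of pointed graphs that, if it holds, is implied by the isomorphism type of some
ball. -/
def IsLocal (P : PointedGraph → Prop) : Prop :=
  ∀ Γ, P Γ → ∃ s, ∀ Δ, BallIso s Γ Δ → P Δ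

theorem IsLocal.and {P Q : PointedGraph → Prop} (hP : IsLocal P) (hQ : IsLocal Q) :
    IsLocal fun Γ => P Γ ∧ Q Γ := by
  rintro Γ ⟨h1, h2⟩
  obtain ⟨s, hs⟩ := hP Γ h1
  obtain ⟨t, ht⟩ := hQ Γ h2
  exact ⟨max s t, fun Δ h => ⟨hs Δ (h.mono (le_max_left _ _)), ht Δ (h.mono (le_max_right _ _))⟩⟩

/-- The vertices on some sphere of radius larger than `r` are linked within a shell that avoids
the ball of radius `r`. -/
def LinkedShell (r : ℕ) (Γ : PointedGraph) : Prop :=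
  ∃ R R' : ℕ, r < R ∧ R ≤ R' ∧ ∀ u v, Γ.height u = R → Γ.height v = R →
    Γ.adjGraph.LinkedIn {x | r < Γ.height x ∧ Γ.height x ≤ R'} u v

/-- A cofinite connected set off the ball contains a sphere, whose finitely many vertices are joined
by walks of bounded height. Conversely, every vertex beyond the sphere descends to it outside the
smaller ball, so the vertices linked to the sphere there form a cofinite connected set. -/
theorem oneEndedGraph_iff (hlf : Γ.LocallyFinite) (hc : Γ.WalkConnected) :
    Γ.adjGraph.OneEndedGraph ↔ ∀ r, Γ.LinkedShell r := by
  constructor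
  · intro h r
    obtain ⟨A, hA, hdisj, hl⟩ := h _ (hlf.finite_ball r)
    obtain ⟨R, hR⟩ := exists_radius hc (hA.union (hlf.finite_ball r))
    have hsphere : ∀ v, Γ.height v = ((max R r + 1 : ℕ) : ℕ∞) → v ∈ A := by
      intro v hv
      by_contra hvA
      have := hR v (Or.inl hvA)
      rw [hv] at this
      have : max R r + 1 ≤ R := by exact_mod_cast this
      omega
    have key : ∀ u ∈ A, ∀ v ∈ A, ∃ R', Γ.adjGraph.LinkedIn
        {x | r < Γ.height x ∧ Γ.height x ≤ (R' : ℕ)} u v := by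
      intro u hu v hv
      obtain ⟨C, hCA, hC, -, hvC, hCl⟩ := (hl u hu v hv).exists_finite hu
      obtain ⟨R', hR'⟩ := exists_radius hc hC
      exact ⟨R', (hCl v hvC).mono fun x hx => ⟨not_le.1 fun h =>
        Set.disjoint_left.1 hdisj (hCA hx) h, hR' x hx⟩⟩
    choose! f hf using key
    have hfin : {v | Γ.height v = ((max R r + 1 : ℕ) : ℕ∞)}.Finite :=
      (hlf.finite_ball _).subset fun v hv => le_of_eq hv
    obtain ⟨R', hR'⟩ := ((hfin.prod hfin).image fun x => f x.1 x.2).bddAbove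
    refine ⟨max R r + 1, max (max R r + 1) R', by omega, le_max_left _ _, fun u v hu hv =>
      (hf u (hsphere u hu) v (hsphere v hv)).mono fun x hx => ⟨hx.1, hx.2.trans ?_⟩⟩
    exact_mod_cast (hR' ⟨(u, v), ⟨hu, hv⟩, rfl⟩).trans (le_max_right _ _)
  · intro h D hD
    obtain ⟨r, hr⟩ := exists_radius hc hD
    obtain ⟨R, R', hrR, -, hR⟩ := h r
    refine ⟨{v | r < Γ.height v ∧
      ∃ w, Γ.height w = R ∧ Γ.adjGraph.LinkedIn {x | r < Γ.height x} v w}, ?_, ?_, ?_⟩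
    · refine (hlf.finite_ball R).subset fun v hv => ?_
      by_contra hvR
      rw [Set.mem_ofPred_eq, not_le] at hvR
      exact hv ⟨lt_trans (by exact_mod_cast hrR) hvR, hc.exists_linkedIn_sphere hrR v hvR.le⟩
    · exact Set.disjoint_left.2 fun v hv hvD => not_le.2 hv.1 (hr v hvD)
    · rintro u ⟨hu, w, hw, huw⟩ v ⟨hv, w', hw', hvw'⟩
      have := (huw.trans ((hR w w' hw hw').mono fun x hx => hx.1)).trans hvw'.symm
      exact this.component.mono fun x hx => ⟨hx.1, w, hw, hx.2.symm.trans huw⟩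

theorem isLocal_linkedShell (r : ℕ) : IsLocal (LinkedShell r) := by
  rintro Γ ⟨R, R', hr, hR, h⟩
  -- Radius `R' + 1`, because edges between two vertices of height `R'` are not in the ball of
  -- radius `R'`.
  refine ⟨R' + 1, fun Δ ⟨f⟩ => ⟨R, R', hr, hR, fun u v hu hv => ?_⟩⟩
  have hheight : ∀ w : (Γ.ball (R' + 1)).V, Δ.height (ofBall (f.onV w)) = Γ.height (ofBall w) :=
    fun w => by rw [← ball_height, f.height, ball_height]
  have hle : ∀ w, Δ.height w = R → Δ.height w ≤ (R' + 1 : ℕ) := fun w hw => by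
    rw [hw]; exact_mod_cast hR.trans R'.le_succ
  obtain ⟨u₀, hu₀⟩ := f.onV.surjective (toBall u (hle u hu))
  obtain ⟨v₀, hv₀⟩ := f.onV.surjective (toBall v (hle v hv))
  have hu' : Γ.height (ofBall u₀) = R := by rw [← hheight, hu₀]; exact hu
  have hv' : Γ.height (ofBall v₀) = R := by rw [← hheight, hv₀]; exact hv
  have key : ∀ y, Γ.adjGraph.LinkedIn {x | r < Γ.height x ∧ Γ.height x ≤ R'} (ofBall u₀) y →
      ∀ hy : Γ.height y ≤ (R' + 1 : ℕ), Δ.adjGraph.LinkedIn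
        {x | r < Δ.height x ∧ Δ.height x ≤ R'} u (ofBall (f.onV (toBall y hy))) := by
    intro y hy
    induction hy with
    | refl =>
      intro hy
      rw [show toBall (ofBall u₀) hy = u₀ from rfl, hu₀]
      exact .refl
    | @tail x y _ hxy ih =>
      intro hy
      have hlt : Γ.height x < (R' + 1 : ℕ) :=
        lt_of_le_of_lt hxy.1.2 (by exact_mod_cast R'.lt_succ_self)
      refine (ih hlt.le).tail ⟨?_, ?_, adj_of_ball_adj (f.adj (ball_adj hxy.2.2 hlt hlt.le hy))⟩
      · rw [Set.mem_ofPred_eq, hheight]; exact hxy.1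
      · rw [Set.mem_ofPred_eq, hheight]; exact hxy.2.1
  have := key _ (h _ _ hu' hv') (ofBall_le v₀)
  rwa [show toBall (ofBall v₀) (ofBall_le v₀) = v₀ from rfl, hv₀] at this

theorem Crank.of_injective {n : ℕ} (α : Γ.V → Δ.V) (β : Γ.E → Δ.E)
    (hα : Function.Injective α) (hβ : Function.Injective β)
    (hαβ : ∀ e, Δ.ends (β e) = (Γ.ends e).map α) (h : Γ.Crank n) : Δ.Crank n := by
  obtain ⟨S, F, hF, hcard⟩ := h
  refine ⟨S.map ⟨α, hα⟩, F.map ⟨β, hβ⟩, ?_, by simpa⟩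
  intro e he v hv
  obtain ⟨e, he, rfl⟩ := Finset.mem_map.1 he
  rw [Function.Embedding.coeFn_mk, hαβ, Sym2.mem_map] at hv
  obtain ⟨w, hw, rfl⟩ := hv
  exact Finset.mem_map_of_mem _ (hF e ‹_› w hw)

/-- Some ball has a finite set of vertices that spans sufficiently many edges. -/
def BoundedCrank (n : ℕ) (Γ : PointedGraph) : Prop :=
  ∃ s : ℕ, (Γ.ball s).Crank n

theorem isLocal_boundedCrank (n : ℕ) : IsLocal (BoundedCrank n) := fun _ ⟨s, h⟩ =>
  ⟨s, fun _ ⟨f⟩ => ⟨s, h.of_injective f.onV f.onE f.onV.injective f.onE.injective f.ends_onE⟩⟩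

theorem crank_iff (hc : Γ.WalkConnected) (n : ℕ) : Γ.Crank n ↔ Γ.BoundedCrank n := by
  classical
  constructor
  · rintro ⟨S, F, hF, hcard⟩
    obtain ⟨s, hs⟩ := exists_radius hc S.finite_toSet
    have hS : ∀ v ∈ S, Γ.height v ≤ (s + 1 : ℕ) := fun v hv =>
      (hs v hv).trans (by exact_mod_cast s.le_succ)
    -- The ball of radius `s` would omit the edges both of whose ends have height `s`.
    have hF' : ∀ e ∈ F, ∃ v ∈ Γ.ends e, Γ.height v < (s + 1 : ℕ) := fun e he =>
      ⟨Γ.src e, src_mem e, lt_of_le_of_lt (hs _ (hF e he _ (src_mem e)))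
        (by exact_mod_cast s.lt_succ_self)⟩
    let α : {v // v ∈ S} ↪ (Γ.ball (s + 1)).V :=
      ⟨fun v => toBall v.1 (hS _ v.2), fun _ _ h => Subtype.ext (congrArg ofBall h)⟩
    let β : {e // e ∈ F} ↪ (Γ.ball (s + 1)).E :=
      ⟨fun e => toBallE e.1 (hF' _ e.2), fun _ _ h => Subtype.ext (congrArg ofBallE h)⟩
    refine ⟨s + 1, S.attach.map α, F.attach.map β, fun e he v hv => ?_, by simpa⟩
    obtain ⟨e, -, rfl⟩ := Finset.mem_map.1 he
    exact Finset.mem_map.2 ⟨⟨ofBall v, hF _ e.2 _ (mem_ball_ends.1 hv)⟩, Finset.mem_attach _ _, rfl⟩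
  · rintro ⟨s, h⟩
    exact h.of_injective ofBall ofBallE ofBall_injective ofBallE_injective fun e =>
      (ball_ends_map e).symm

end PointedGraph

/-! ### Local properties and open sets of graphs -/

namespace GraphSpace

open PointedGraph

variable {D : Set ℕ∞}

/-- The isomorphism class of a graph. -/
def mk (Γ : GraphIn D) : GraphSpace D := Quotient.mk _ Γ

theorem mk_surjective : Function.Surjective (mk : GraphIn D → GraphSpace D) :=
  Quotient.exists_rep

/-- Membership only provides some isomorphic graph with the property; locality makes the property
invariant, as isomorphic graphs have isomorphic balls. -/
theorem mk_mem_classes {P : PointedGraph → Prop} (hP : IsLocal P) (Γ : GraphIn D) :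
    mk Γ ∈ classes P ↔ P Γ.graph := by
  refine ⟨?_, fun h => ⟨Γ, h, rfl⟩⟩
  rintro ⟨Δ, hΔ, h⟩
  obtain ⟨f⟩ : Nonempty (Iso Δ.graph Γ.graph) := Quotient.exact h
  obtain ⟨s, hs⟩ := hP _ hΔ
  exact hs _ (f.ballIso s)

theorem isLocal_ballIso (r : ℕ) (Γ : PointedGraph) : IsLocal (BallIso r Γ) :=
  fun _ h => ⟨r, fun _ h' => h.trans h'⟩

theorem mk_mem_basicSet (Γ Δ : GraphIn D) (r : ℕ) :
    mk Δ ∈ basicSet Γ r ↔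
      BallIso r Γ.graph Δ.graph :=
  mk_mem_classes (isLocal_ballIso r Γ.graph) Δ

theorem isOpen_classes {P : PointedGraph → Prop} (hP : IsLocal P) :
    IsOpen (classes P : Set (GraphSpace D)) := by
  refine isOpen_iff_forall_mem_open.2 fun x hx => ?_
  obtain ⟨Γ, hΓ, rfl⟩ := hx
  obtain ⟨s, hs⟩ := hP _ hΓ
  refine ⟨basicSet Γ s, ?_, .basic _ ⟨Γ, s, rfl⟩, (mk_mem_basicSet Γ Γ s).2 (.refl _ _)⟩
  rintro _ ⟨Δ, hΔ, rfl⟩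
  exact ⟨Δ, hs _ hΔ, rfl⟩

/-- The generating sets form a basis: any point of a basic set can serve as its centre, and
intersections are handled by the larger radius. -/
theorem exists_basicSet_subset {U : Set (GraphSpace D)} (hU : IsOpen U) (Γ : GraphIn D)
    (h : mk Γ ∈ U) :
    ∃ r, basicSet Γ r ⊆ U := by
  induction hU with
  | basic U hU =>
    obtain ⟨Δ, r, rfl⟩ := hU
    refine ⟨r, ?_⟩
    rintro _ ⟨Θ, hΘ, rfl⟩
    exact (mk_mem_basicSet Δ Θ r).2 (((mk_mem_basicSet Δ Γ r).1 h).trans hΘ)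
  | univ => exact ⟨0, Set.subset_univ _⟩
  | inter U V _ _ ihU ihV =>
    obtain ⟨r, hr⟩ := ihU h.1
    obtain ⟨s, hs⟩ := ihV h.2
    refine ⟨max r s, Set.subset_inter ?_ ?_⟩
    · rintro _ ⟨Θ, hΘ, rfl⟩
      exact hr ⟨Θ, hΘ.mono (le_max_left _ _), rfl⟩
    · rintro _ ⟨Θ, hΘ, rfl⟩
      exact hs ⟨Θ, hΘ.mono (le_max_right _ _), rfl⟩
  | sUnion S _ ih =>
    obtain ⟨U, hU, hΓ⟩ := h
    obtain ⟨r, hr⟩ := ih U hU hΓ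
    exact ⟨r, hr.trans (Set.subset_sUnion_of_mem hU)⟩

theorem dense_classes {P : PointedGraph → Prop}
    (h : ∀ (Γ : GraphIn D) (r : ℕ), ∃ Δ : GraphIn D, BallIso r Γ.graph Δ.graph ∧ P Δ.graph) :
    Dense (classes P : Set (GraphSpace D)) := by
  refine dense_iff_inter_open.2 fun U hU ⟨x, hx⟩ => ?_
  obtain ⟨Γ, rfl⟩ := mk_surjective x
  obtain ⟨r, hr⟩ := exists_basicSet_subset hU Γ hx
  obtain ⟨Δ, hΔ, hP⟩ := h Γ r
  exact ⟨_, hr ⟨Δ, hΔ, rfl⟩, Δ, hP, rfl⟩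

theorem _root_.GraphIn.locallyFinite (hD : ∀ d ∈ D, d < ⊤) (Γ : GraphIn D) :
    Γ.graph.LocallyFinite := fun v => hD _ (Γ.degree_mem v)

theorem _root_.GraphIn.walkConnected (Γ : GraphIn D) : Γ.graph.WalkConnected :=
  have := Γ.connected
  walkConnected_of_connectedSpace

/-- With finite degrees, finitely many vertices could carry only finitely many edges. -/
theorem _root_.GraphIn.infinite_vertices (hD : ∀ d ∈ D, d < ⊤) (Γ : GraphIn D) :
    Infinite Γ.graph.V := by
  rcases Γ.infinite with h | h
  · exact h
  · by_contra hV
    rw [not_infinite_iff_finite] at hV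
    refine Set.infinite_univ (α := Γ.graph.E) ((Set.finite_iUnion fun v =>
      (Γ.locallyFinite hD).finite_incident v).subset fun e _ =>
        Set.mem_iUnion.2 ⟨Γ.graph.src e, src_mem e⟩)

theorem classes_congr {P Q : PointedGraph → Prop} (h : ∀ Γ : GraphIn D, P Γ.graph ↔ Q Γ.graph) :
    (classes P : Set (GraphSpace D)) = classes Q := by
  unfold classes
  congr 1
  ext Γ
  exact h Γ

theorem isGδ_classes {P : ℕ → PointedGraph → Prop} (hP : ∀ n, IsLocal (P n)) :
    IsGδ (classes (fun Γ => ∀ n, P n Γ) : Set (GraphSpace D)) := by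
  have : (classes (fun Γ => ∀ n, P n Γ) : Set (GraphSpace D)) = ⋂ n, classes (P n) := by
    ext x
    obtain ⟨Γ, rfl⟩ := mk_surjective x
    rw [Set.mem_iInter]
    constructor
    · rintro ⟨Δ, hΔ, h⟩ n
      exact ⟨Δ, hΔ n, h⟩
    · intro h
      exact ⟨Γ, fun n => (mk_mem_classes (hP n) Γ).1 (h n), rfl⟩
  rw [this]
  exact .iInter_of_isOpen fun n => isOpen_classes (hP n)

theorem oneEndedInfiniteRank_eq (hD : ∀ d ∈ D, d < ⊤) : oneEndedInfiniteRank D =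
    classes fun Γ => Γ.adjGraph.OneEndedGraph ∧ ∀ n, Γ.Crank n :=
  classes_congr fun Γ =>
    have := Γ.infinite_vertices hD
    oneEnded_and_rank_iff (Γ.locallyFinite hD) Γ.walkConnected

theorem properHomotopyClass_lochNess_eq (hD : ∀ d ∈ D, d < ⊤) :
    properHomotopyClass D lochNessMonster =
      classes fun Γ => Γ.adjGraph.OneEndedGraph ∧ ∀ n, Γ.Crank n :=
  classes_congr fun Γ =>
    have := Γ.infinite_vertices hD
    properHomotopyEquivalent_lochNess_iff (Γ.locallyFinite hD) Γ.walkConnected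

theorem isGδ_oneEndedInfiniteRank (hD : ∀ d ∈ D, d < ⊤) : IsGδ (oneEndedInfiniteRank D) := by
  rw [oneEndedInfiniteRank_eq hD, classes_congr (Q := fun Γ => ∀ n, LinkedShell n Γ ∧
    BoundedCrank n Γ) fun Γ => by
      rw [oneEndedGraph_iff (Γ.locallyFinite hD) Γ.walkConnected, forall_and]
      exact and_congr_right' (forall_congr' fun n => crank_iff Γ.walkConnected n)]
  exact isGδ_classes fun n => (isLocal_linkedShell n).and (isLocal_boundedCrank n)

end GraphSpace

/-! ### Attaching a one-ended tail of infinite rank -/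

theorem Set.encard_sum {α β : Type*} (S : Set (α ⊕ β)) :
    S.encard = (Sum.inl ⁻¹' S).encard + (Sum.inr ⁻¹' S).encard := by
  conv_lhs => rw [← Set.image_preimage_inl_union_image_preimage_inr S]
  rw [Set.encard_union_eq, Sum.inl_injective.encard_image, Sum.inr_injective.encard_image]
  refine Set.disjoint_left.2 ?_
  rintro _ ⟨x, -, rfl⟩ ⟨y, -, h⟩
  exact absurd h (by simp)

theorem encard_sigma_fst {ι : Type*} (f : ι → ℕ) (i : ι) :
    {x : Σ i, Fin (f i) | x.1 = i}.encard = f i := by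
  have : {x : Σ i, Fin (f i) | x.1 = i} = Sigma.mk i '' Set.univ := by
    ext ⟨j, x⟩
    constructor
    · rintro rfl
      exact ⟨x, trivial, rfl⟩
    · rintro ⟨y, -, h⟩
      exact (congrArg Sigma.fst h).symm
  rw [this, sigma_mk_injective.encard_image, Set.encard_univ]
  simp

/-- Finitely many half edges can be distributed over the vertices of a ray, and the edges of the
ray can be given multiplicities, so that all vertices of the ray have degree `K`. -/
theorem exists_multiplicities {H : Type*} [Finite H] [Nonempty H] {K : ℕ} (hK : 3 ≤ K) :
    ∃ (b : H → ℕ) (m : ℕ → ℕ), (∀ j, 1 ≤ m j) ∧ (∃ h, b h = 0) ∧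
      {h | b h = 0}.encard + m 0 = K ∧ (∀ j, {h | b h = j + 1}.encard + m j + m (j + 1) = K) ∧
      ∃ J, ∀ j, J ≤ j → m j + m (j + 1) = K := by
  obtain ⟨N, ⟨φ⟩⟩ := Finite.exists_equiv_fin H
  have hN : 0 < N := Fin.pos (φ (Classical.arbitrary H))
  -- By truncated subtraction the first two half edges go to the vertex `0` of the ray, and the
  -- others one each to the vertices `1, 2, …`.
  let c : ℕ → ℕ := fun j => {h | (φ h).val - 1 = j}.ncard
  have hc : ∀ j, {h | (φ h).val - 1 = j}.encard = c j := fun j =>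
    (Set.toFinite _).cast_ncard_eq.symm
  have hval : Function.Injective fun h => (φ h).val := Fin.val_injective.comp φ.injective
  have hc0 : c 0 = min N 2 := by
    have : (fun h => (φ h).val) '' {h | (φ h).val - 1 = 0} = Finset.range (min N 2) := by
      ext i
      simp only [Set.mem_image, Set.mem_ofPred_eq, Finset.coe_range, Set.mem_Iio]
      constructor
      · rintro ⟨h, hh, rfl⟩
        have := (φ h).isLt
        omega
      · intro hi
        exact ⟨φ.symm ⟨i, by omega⟩, by rw [Equiv.apply_symm_apply]; dsimp only; omega, by simp⟩
    change Set.ncard _ = _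
    rw [← Set.ncard_image_of_injective _ hval, this, Set.ncard_coe_finset, Finset.card_range]
  have hc1 : ∀ j, c (j + 1) = if j + 2 < N then 1 else 0 := by
    intro j
    change Set.ncard _ = _
    split_ifs with hj
    · refine Set.ncard_eq_one.2 ⟨φ.symm ⟨j + 2, hj⟩, ?_⟩
      ext h
      rw [Set.mem_ofPred_eq, Set.mem_singleton_iff, Equiv.eq_symm_apply, Fin.ext_iff]
      dsimp only
      omega
    · rw [Set.ncard_eq_zero]
      refine Set.eq_empty_of_forall_notMem fun h (hh : (φ h).val - 1 = j + 1) => ?_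
      have := (φ h).isLt
      omega
  let m : ℕ → ℕ := fun j => Nat.rec (K - c 0) (fun j x => K - x - c (j + 1)) j
  have hm0 : m 0 = K - c 0 := rfl
  have hm1 : ∀ j, m (j + 1) = K - m j - c (j + 1) := fun j => rfl
  -- If a half edge is still due at the vertex `j + 1`, two units must be left there: one for it and
  -- one for the next edge of the ray. The start `m 0 ≥ K - 2 ≥ 1` is where `3 ≤ K` enters.
  have hinv : ∀ j, 1 ≤ m j ∧ m j < K ∧ (j + 2 < N → m j + 2 ≤ K) := by
    intro j
    induction j with
    | zero =>
      rw [hm0, hc0]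
      omega
    | succ j ih =>
      rw [hm1, hc1]
      split_ifs with h <;> omega
  refine ⟨fun h => (φ h).val - 1, m, fun j => (hinv j).1, ⟨φ.symm ⟨0, hN⟩, by simp⟩, ?_, ?_, N, ?_⟩
  · rw [hc]
    have : c 0 + m 0 = K := by rw [hm0, hc0]; omega
    exact_mod_cast this
  · intro j
    rw [hc]
    have : c (j + 1) + m j + m (j + 1) = K := by
      have := hinv j
      rw [hm1, hc1]
      split_ifs with h <;> omega
    exact_mod_cast this
  · intro j hj
    have := hinv j
    rw [hm1, hc1, if_neg (by omega)]
    omega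

namespace PointedGraph

variable {Γ : PointedGraph}

theorem le_height_of_lipschitz (g : Γ.V → ℕ∞) (hb : g Γ.base = 0)
    (h : ∀ u v, Γ.adjGraph.Adj u v → g v ≤ g u + 1) (v : Γ.V) : g v ≤ Γ.height v := by
  have key : ∀ n : ℕ, ∀ v, Γ.height v = n → g v ≤ n := by
    intro n
    induction n with
    | zero =>
      intro v hv
      have : Γ.base = v := SimpleGraph.edist_eq_zero_iff.1 (hv.trans Nat.cast_zero)
      rw [← this, hb]
      simp
    | succ n ih =>
      intro v hv
      obtain ⟨u, huv, hu⟩ := exists_adj_of_height hv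
      refine (h u v huv).trans ?_
      push_cast
      gcongr
      exact ih u hu
  by_cases hv : Γ.height v = ⊤
  · rw [hv]; exact le_top
  · obtain ⟨n, hn⟩ := ENat.ne_top_iff_exists.1 hv
    rw [← hn]
    exact key n v hn.symm

theorem linkedIn_of_height {n : ℕ} : ∀ {v : Γ.V}, Γ.height v = n →
    Γ.adjGraph.LinkedIn Set.univ Γ.base v := by
  induction n with
  | zero =>
    intro v hv
    rw [SimpleGraph.edist_eq_zero_iff.1 (hv.trans Nat.cast_zero)]
    exact .refl
  | succ n ih =>
    intro v hv
    obtain ⟨u, huv, hu⟩ := exists_adj_of_height hv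
    exact (ih hu).tail ⟨trivial, trivial, huv⟩

section tail

variable (B : PointedGraph) {H : Type} (a : H → B.V) (b : H → ℕ) (m : ℕ → ℕ)

/-- The graph `B` with a ray attached: the ray has `m j` edges from its vertex `j` to its vertex
`j + 1`, and the edges `h : H` join the vertex `a h` of `B` to the vertex `b h` of the ray. -/
def withTail : PointedGraph where
  V := B.V ⊕ ℕ
  E := B.E ⊕ H ⊕ Σ j, Fin (m j)
  ends := Sum.elim (fun e => (B.ends e).map Sum.inl)
    (Sum.elim (fun h => s(Sum.inl (a h), Sum.inr (b h))) fun x => s(Sum.inr x.1, Sum.inr (x.1 + 1)))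
  base := Sum.inl B.base

/-- A vertex of `B`. -/
def tailInl (v : B.V) : (B.withTail a b m).V := Sum.inl v

/-- A vertex of the ray. -/
def tailInr (j : ℕ) : (B.withTail a b m).V := Sum.inr j

theorem tail_cases (x : (B.withTail a b m).V) :
    (∃ v, x = B.tailInl a b m v) ∨ ∃ j, x = B.tailInr a b m j := by
  rcases x with v | j
  · exact Or.inl ⟨v, rfl⟩
  · exact Or.inr ⟨j, rfl⟩

/-- An edge of `B`. -/
def tailEdge (e : B.E) : (B.withTail a b m).E := Sum.inl e

/-- An edge between `B` and the ray. -/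
def tailBridge (h : H) : (B.withTail a b m).E := Sum.inr (Sum.inl h)

/-- An edge of the ray. -/
def tailRung (x : Σ j, Fin (m j)) : (B.withTail a b m).E := Sum.inr (Sum.inr x)

theorem ends_tailEdge (e : B.E) :
    (B.withTail a b m).ends (B.tailEdge a b m e) = (B.ends e).map (B.tailInl a b m) := rfl

theorem ends_tailBridge (h : H) : (B.withTail a b m).ends (B.tailBridge a b m h) =
    s(B.tailInl a b m (a h), B.tailInr a b m (b h)) := rfl

theorem ends_tailRung (x : Σ j, Fin (m j)) : (B.withTail a b m).ends (B.tailRung a b m x) =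
    s(B.tailInr a b m x.1, B.tailInr a b m (x.1 + 1)) := rfl

theorem tailInl_injective : Function.Injective (B.tailInl a b m) := Sum.inl_injective

theorem tailInr_injective : Function.Injective (B.tailInr a b m) := Sum.inr_injective

theorem tailInl_ne_tailInr (v : B.V) (j : ℕ) : B.tailInl a b m v ≠ B.tailInr a b m j :=
  Sum.inl_ne_inr

theorem encard_tail_edges (S : Set (B.withTail a b m).E) : S.encard =
    {e | B.tailEdge a b m e ∈ S}.encard + ({h | B.tailBridge a b m h ∈ S}.encard +
      {x | B.tailRung a b m x ∈ S}.encard) :=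
  (Set.encard_sum _).trans (congrArg _ (Set.encard_sum _))

theorem degree_tailInl (v : B.V) :
    (B.withTail a b m).degree (B.tailInl a b m v) = B.degree v + {h | a h = v}.encard := by
  have h1 : ∀ e, B.tailInl a b m v ∈ (B.ends e).map (B.tailInl a b m) ↔ v ∈ B.ends e := fun e => by
    simp [Sym2.mem_map, (tailInl_injective B a b m).eq_iff]
  have h2 : ∀ e, (B.ends e).map (B.tailInl a b m) = s(B.tailInl a b m v, B.tailInl a b m v) ↔
      B.ends e = s(v, v) := fun e =>
    (Sym2.map.injective (tailInl_injective B a b m)).eq_iff (b := s(v, v))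
  rw [degree, degree, encard_tail_edges, encard_tail_edges]
  simp only [Set.mem_ofPred_eq, ends_tailEdge, ends_tailBridge, ends_tailRung, h1, h2,
    Sym2.mem_iff, tailInl_ne_tailInr, (tailInl_ne_tailInr B a b m _ _).symm,
    (tailInl_injective B a b m).eq_iff, Sym2.eq_iff, or_false, and_false, Set.ofPred_false,
    Set.encard_empty, add_zero, or_self, eq_comm (a := v)]
  exact add_right_comm _ _ _

theorem degree_tailInr (j : ℕ) : (B.withTail a b m).degree (B.tailInr a b m j) =
    {h | b h = j}.encard + {x : Σ j, Fin (m j) | x.1 = j ∨ x.1 + 1 = j}.encard := by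
  have h1 : ∀ e, ¬ B.tailInr a b m j ∈ (B.ends e).map (B.tailInl a b m) := fun e => by
    simp [Sym2.mem_map, tailInl_ne_tailInr]
  have h2 : ∀ e, ¬ (B.ends e).map (B.tailInl a b m) = s(B.tailInr a b m j, B.tailInr a b m j) :=
    fun e h => h1 e (by rw [h]; exact Sym2.mem_mk_left _ _)
  -- Edges of the ray are not self-loops, so none of them counts twice in the degree.
  have h3 : ∀ i : ℕ, ¬ (i = j ∧ i + 1 = j) := fun i h => by omega
  rw [degree, encard_tail_edges, encard_tail_edges]
  simp only [Set.mem_ofPred_eq, ends_tailEdge, ends_tailBridge, ends_tailRung, h1, h2, h3,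
    Sym2.mem_iff, tailInl_ne_tailInr, (tailInl_ne_tailInr B a b m _ _).symm,
    (tailInr_injective B a b m).eq_iff, Sym2.eq_iff, false_or, false_and,
    Set.ofPred_false, Set.encard_empty, add_zero, zero_add, or_self, eq_comm (a := j)]

theorem degree_tailInr_zero :
    (B.withTail a b m).degree (B.tailInr a b m 0) = {h | b h = 0}.encard + m 0 := by
  rw [degree_tailInr, ← encard_sigma_fst m 0]
  simp

theorem degree_tailInr_succ (j : ℕ) : (B.withTail a b m).degree (B.tailInr a b m (j + 1)) =
    {h | b h = j + 1}.encard + m j + m (j + 1) := by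
  rw [degree_tailInr, ← encard_sigma_fst m j, ← encard_sigma_fst m (j + 1), add_assoc,
    add_comm {x : Σ j, Fin (m j) | x.1 = j}.encard, ← Set.encard_union_eq]
  · congr 2
    ext x
    simp
  · refine Set.disjoint_left.2 fun x (hx : x.1 = j + 1) (hx' : x.1 = j) => ?_
    omega

variable {B a b m}

theorem adj_tailInl {u v : B.V} (h : B.adjGraph.Adj u v) :
    (B.withTail a b m).adjGraph.Adj (B.tailInl a b m u) (B.tailInl a b m v) := by
  obtain ⟨hne, e, he⟩ := h
  refine ⟨fun h => hne (Sum.inl_injective h), Sum.inl e, ?_⟩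
  change (B.ends e).map Sum.inl = _
  rw [he]
  rfl

theorem adj_tailInl_tailInr (h : H) :
    (B.withTail a b m).adjGraph.Adj (B.tailInl a b m (a h)) (B.tailInr a b m (b h)) :=
  ⟨fun h => Sum.inl_ne_inr h, Sum.inr (Sum.inl h), rfl⟩

theorem adj_tailInr {j : ℕ} (hm : 1 ≤ m j) :
    (B.withTail a b m).adjGraph.Adj (B.tailInr a b m j) (B.tailInr a b m (j + 1)) :=
  ⟨fun h => j.succ_ne_self (Sum.inr_injective h).symm, Sum.inr (Sum.inr ⟨j, ⟨0, hm⟩⟩), rfl⟩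

theorem linkedIn_tailInr (hm : ∀ j, 1 ≤ m j) {J j : ℕ} (hj : J ≤ j) :
    (B.withTail a b m).adjGraph.LinkedIn (B.tailInr a b m '' Set.Ici J)
      (B.tailInr a b m J) (B.tailInr a b m j) := by
  induction j, hj using Nat.le_induction with
  | base => exact .refl
  | succ j hj ih =>
    exact ih.tail ⟨⟨j, hj, rfl⟩, ⟨j + 1, Nat.le_succ_of_le hj, rfl⟩, adj_tailInr (hm j)⟩

variable {r : ℕ}

/-- The tail is attached at height exactly `r`, so the height of `B` extended by the constant `r +
1` still grows by at most one along every edge. Hence the tail offers no shortcuts. -/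
theorem le_height_tail (ha : ∀ h, B.height (a h) = r) (x : (B.withTail a b m).V) :
    Sum.elim B.height (fun _ => (r + 1 : ℕ∞)) x ≤ (B.withTail a b m).height x := by
  refine le_height_of_lipschitz (Γ := B.withTail a b m) (Sum.elim B.height fun _ => (r + 1 : ℕ∞))
    height_base ?_ x
  rintro u v ⟨hne, e, he⟩
  rcases e with e | h | x
  · change (B.ends e).map Sum.inl = s(u, v) at he
    rw [← mk_src_tgt] at he
    have hadj : B.src e ≠ B.tgt e → B.adjGraph.Adj (B.src e) (B.tgt e) := fun h =>
      ⟨h, e, (mk_src_tgt B e).symm⟩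
    rcases Sym2.eq_iff.1 he with ⟨rfl, rfl⟩ | ⟨rfl, rfl⟩
    · exact height_le_succ_of_adj (hadj fun h => hne (congrArg Sum.inl h))
    · exact height_le_succ_of_adj (hadj fun h => hne (congrArg Sum.inl h.symm)).symm
  · change s(Sum.inl (a h), Sum.inr (b h)) = s(u, v) at he
    rcases Sym2.eq_iff.1 he with ⟨rfl, rfl⟩ | ⟨rfl, rfl⟩
    · simp [ha]
    · simp only [Sum.elim_inl, Sum.elim_inr, ha]
      exact le_self_add.trans le_self_add
  · change s(Sum.inr x.1, Sum.inr (x.1 + 1)) = s(u, v) at he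
    rcases Sym2.eq_iff.1 he with ⟨rfl, rfl⟩ | ⟨rfl, rfl⟩ <;> exact le_self_add

theorem height_tailInl (ha : ∀ h, B.height (a h) = r) (hB : ∀ v, B.height v ≤ r) (v : B.V) :
    (B.withTail a b m).height (B.tailInl a b m v) = B.height v :=
  le_antisymm (height_le_of_adj_map (B.tailInl a b m) rfl (fun _ _ _ => adj_tailInl) (hB v))
    (le_height_tail ha (B.tailInl a b m v))

theorem lt_height_tailInr (ha : ∀ h, B.height (a h) = r) (j : ℕ) :
    r < (B.withTail a b m).height (B.tailInr a b m j) :=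
  lt_of_lt_of_le (show (r : ℕ∞) < r + 1 by exact_mod_cast r.lt_succ_self)
    (le_height_tail ha (B.tailInr a b m j))

/-- Heights in `B` are unchanged and the tail lies above height `r`. The connecting edges have no
end of height below `r`, so the ball contains none of them. -/
theorem nonempty_iso_ball_withTail (ha : ∀ h, B.height (a h) = r) (hB : ∀ v, B.height v ≤ r)
    (hE : ∀ e, ∃ v ∈ B.ends e, B.height v < r) :
    Nonempty (Iso B ((B.withTail a b m).ball r)) := by
  have hmem : ∀ e, ∀ v ∈ B.ends e,
      B.tailInl a b m v ∈ (B.withTail a b m).ends (Sum.inl e) := fun e v hv => by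
    change Sum.inl v ∈ (B.ends e).map Sum.inl
    simpa
  let α : B.V → ((B.withTail a b m).ball r).V := fun v =>
    toBall (B.tailInl a b m v) (by rw [height_tailInl ha hB]; exact hB v)
  let β : B.E → ((B.withTail a b m).ball r).E := fun e =>
    toBallE (Sum.inl e) ((hE e).elim fun v hv => ⟨B.tailInl a b m v, hmem e v hv.1, by
      rw [height_tailInl ha hB]; exact hv.2⟩)
  have hα : Function.Bijective α := by
    refine ⟨fun u v h => Sum.inl_injective (congrArg ofBall h), fun x => ?_⟩
    rcases B.tail_cases a b m (ofBall x) with ⟨v, hv⟩ | ⟨j, hj⟩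
    · exact ⟨v, ofBall_injective hv.symm⟩
    · exact absurd (ofBall_le x) (not_le.2 (hj ▸ lt_height_tailInr ha j))
  have hβ : Function.Bijective β := by
    refine ⟨fun u v h => Sum.inl_injective (congrArg ofBallE h), fun x => ?_⟩
    obtain ⟨v, hv, hlt⟩ := ofBallE_lt x
    rcases hx : ofBallE x with e | h | y
    · exact ⟨e, ofBallE_injective hx.symm⟩
    · rw [hx] at hv
      change v ∈ s(Sum.inl (a h), Sum.inr (b h)) at hv
      rcases Sym2.mem_iff.1 hv with rfl | rfl
      · exact absurd hlt (not_lt.2 ((height_tailInl ha hB (a h)).trans (ha h)).ge)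
      · exact absurd hlt (not_lt.2 (lt_height_tailInr ha _).le)
    · rw [hx] at hv
      change v ∈ s(Sum.inr y.1, Sum.inr (y.1 + 1)) at hv
      rcases Sym2.mem_iff.1 hv with rfl | rfl <;>
        exact absurd hlt (not_lt.2 (lt_height_tailInr ha _).le)
  exact ⟨{
    onV := Equiv.ofBijective α hα
    onE := Equiv.ofBijective β hβ
    ends_onE := fun e => by
      refine Sym2.map.injective ofBall_injective ?_
      rw [ball_ends_map, Sym2.map_map]
      rfl
    onV_base := rfl }⟩

theorem walkConnected_withTail (ha : ∀ h, B.height (a h) = r) (hB : ∀ v, B.height v ≤ r)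
    (hm : ∀ j, 1 ≤ m j) (hb : ∃ h, b h = 0) : (B.withTail a b m).WalkConnected := by
  have hl : ∀ v, (B.withTail a b m).adjGraph.LinkedIn Set.univ (B.withTail a b m).base
      (B.tailInl a b m v) := fun v => by
    obtain ⟨n, hn⟩ := ENat.ne_top_iff_exists.1 (ne_top_of_le_ne_top (ENat.natCast_ne_top r) (hB v))
    exact linkedIn_of_height (n := n) (by rw [height_tailInl ha hB, hn])
  obtain ⟨h, hh⟩ := hb
  have key : ∀ x, (B.withTail a b m).adjGraph.LinkedIn Set.univ (B.withTail a b m).base x := by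
    intro x
    rcases B.tail_cases a b m x with ⟨v, rfl⟩ | ⟨j, rfl⟩
    · exact hl v
    · refine SimpleGraph.LinkedIn.trans ((hl (a h)).tail ⟨trivial, trivial, adj_tailInl_tailInr h⟩) ?_
      rw [hh]
      exact (linkedIn_tailInr hm j.zero_le).mono (Set.subset_univ _)
  exact fun u v => (key u).symm.trans (key v)

theorem oneEndedGraph_withTail [Finite B.V] (hm : ∀ j, 1 ≤ m j) :
    (B.withTail a b m).adjGraph.OneEndedGraph := by
  intro D hD
  have hinj : Function.Injective (B.tailInr a b m) := Sum.inr_injective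
  obtain ⟨J, hJ⟩ := (hD.preimage hinj.injOn).bddAbove
  refine ⟨B.tailInr a b m '' Set.Ici (J + 1), ?_, ?_, ?_⟩
  · refine ((Set.finite_range (B.tailInl a b m)).union
      ((Set.finite_Iic J).image (B.tailInr a b m))).subset fun x hx => ?_
    rcases B.tail_cases a b m x with ⟨v, rfl⟩ | ⟨j, rfl⟩
    · exact Or.inl ⟨v, rfl⟩
    · refine Or.inr ⟨j, ?_, rfl⟩
      by_contra hj
      exact hx ⟨j, Nat.lt_of_not_le hj, rfl⟩
  · refine Set.disjoint_left.2 ?_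
    rintro _ ⟨j, hj, rfl⟩ hjD
    have h1 := hJ hjD
    have h2 : J + 1 ≤ j := hj
    omega
  · rintro _ ⟨i, hi, rfl⟩ _ ⟨j, hj, rfl⟩
    exact (linkedIn_tailInr hm hi).symm.trans (linkedIn_tailInr hm hj) |>.mono
      subset_rfl

/-- Two consecutive bundles of ray edges have at least three edges but add only two vertices. After
`n + 1` such pairs there are `2 * (n + 1) + 1` vertices and at least `3 * (n + 1)` edges, a surplus
of at least `n`. -/
theorem crank_withTail {J : ℕ} (hJ : ∀ j, J ≤ j → 3 ≤ m j + m (j + 1)) (n : ℕ) :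
    (B.withTail a b m).Crank n := by
  have hsum : ∀ t, 3 * t ≤ ∑ j ∈ Finset.Ico J (J + 2 * t), m j := by
    intro t
    induction t with
    | zero => simp
    | succ t ih =>
      have := hJ (J + 2 * t) (by omega)
      rw [show J + 2 * (t + 1) = J + 2 * t + 1 + 1 by ring, Finset.sum_Ico_succ_top (by omega),
        Finset.sum_Ico_succ_top (by omega)]
      omega
  let α : ℕ ↪ (B.withTail a b m).V := ⟨B.tailInr a b m, Sum.inr_injective⟩
  let β : (Σ j, Fin (m j)) ↪ (B.withTail a b m).E :=
    ⟨fun x => Sum.inr (Sum.inr x), Sum.inr_injective.comp Sum.inr_injective⟩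
  refine ⟨(Finset.Icc J (J + 2 * (n + 1))).map α,
    ((Finset.Ico J (J + 2 * (n + 1))).sigma fun _ => Finset.univ).map β, ?_, ?_⟩
  · intro e he v hv
    obtain ⟨x, hx, rfl⟩ := Finset.mem_map.1 he
    have hx := (Finset.mem_Ico.1 (Finset.mem_sigma.1 hx).1)
    change v ∈ s(Sum.inr x.1, Sum.inr (x.1 + 1)) at hv
    rcases Sym2.mem_iff.1 hv with rfl | rfl
    · exact Finset.mem_map.2 ⟨x.1, Finset.mem_Icc.2 (by omega), rfl⟩
    · exact Finset.mem_map.2 ⟨x.1 + 1, Finset.mem_Icc.2 (by omega), rfl⟩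
  · have := hsum (n + 1)
    simp only [Finset.card_map, Finset.card_sigma, Finset.card_univ, Fintype.card_fin, Nat.card_Icc]
    omega

end tail

end PointedGraph

/-! ### Density -/

namespace PointedGraph

variable {Γ : PointedGraph}

theorem ball_degree_le {r : ℕ} (v : (Γ.ball r).V) : (Γ.ball r).degree v ≤ Γ.degree (ofBall v) := by
  rw [degree, degree, ← ofBallE_injective.encard_image,
    ← ofBallE_injective.encard_image {e | (Γ.ball r).ends e = _}]
  refine add_le_add (Set.encard_le_encard ?_) (Set.encard_le_encard ?_)
  · rintro _ ⟨e, he, rfl⟩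
    exact mem_ball_ends.1 he
  · rintro _ ⟨e, he, rfl⟩
    rw [Set.mem_ofPred_eq, ← ball_ends_map, he]
    rfl

theorem ball_degree {r : ℕ} {v : (Γ.ball r).V} (hv : Γ.height (ofBall v) < r) :
    (Γ.ball r).degree v = Γ.degree (ofBall v) := by
  refine le_antisymm (ball_degree_le v) ?_
  have hmem : ∀ e, ofBall v ∈ Γ.ends e → ∃ v ∈ Γ.ends e, Γ.height v < r := fun e he => ⟨_, he, hv⟩
  rw [degree, degree, ← ofBallE_injective.encard_image,
    ← ofBallE_injective.encard_image {e | (Γ.ball r).ends e = _}]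
  refine add_le_add (Set.encard_le_encard fun e he => ?_) (Set.encard_le_encard fun e he => ?_)
  · exact ⟨toBallE e (hmem e he), mem_ball_ends.2 he, rfl⟩
  · refine ⟨toBallE e (hmem e (by rw [he]; exact Sym2.mem_mk_left _ _)), ?_, rfl⟩
    refine Sym2.map.injective ofBall_injective ?_
    rw [ball_ends_map]
    exact he

/-- The infinite graph leaves the finite ball along an edge from height `r` to height `r + 1`, which
the ball omits. -/
theorem exists_ball_degree_lt [Infinite Γ.V] (hlf : Γ.LocallyFinite) (hc : Γ.WalkConnected)
    (r : ℕ) : ∃ v : (Γ.ball r).V, Γ.height (ofBall v) = r ∧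
      (Γ.ball r).degree v + 1 ≤ Γ.degree (ofBall v) := by
  obtain ⟨x, hx⟩ := (hlf.finite_ball r).exists_notMem
  obtain ⟨w, hw, -⟩ := hc.exists_linkedIn_sphere r.lt_succ_self x (by
    push_cast
    exact Order.add_one_le_of_lt (not_le.1 hx))
  obtain ⟨u, ⟨-, e, he⟩, hu⟩ := exists_adj_of_height hw
  refine ⟨toBall u hu.le, hu, ?_⟩
  have hsub : (insert e (ofBallE '' {e | toBall u hu.le ∈ (Γ.ball r).ends e})) ⊆
      {e | u ∈ Γ.ends e} := by
    rintro _ (rfl | ⟨e, he, rfl⟩)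
    · rw [Set.mem_ofPred_eq, he]; exact Sym2.mem_mk_left _ _
    · exact mem_ball_ends.1 he
  have h1 := Set.encard_le_encard hsub
  rw [Set.encard_insert_of_notMem, ofBallE_injective.encard_image] at h1
  · rw [degree, degree, add_right_comm, ofBall_toBall]
    refine add_le_add h1 ?_
    rw [← ofBallE_injective.encard_image]
    refine Set.encard_le_encard ?_
    rintro _ ⟨e, he, rfl⟩
    rw [Set.mem_ofPred_eq, ← ball_ends_map, he]
    rfl
  · rintro ⟨e', -, rfl⟩
    obtain ⟨v, hv, hvr⟩ := ofBallE_lt e'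
    rw [he, Sym2.mem_iff] at hv
    rcases hv with rfl | rfl
    · exact absurd hvr (by rw [hu]; exact lt_irrefl _)
    · rw [hw] at hvr
      have : r.succ < r := by exact_mod_cast hvr
      omega

/-- Every ball of a graph is the ball of a one-ended graph of infinite rank, with all degrees
unchanged inside the ball and otherwise equal to a given number. -/
theorem exists_ballIso_crank [Infinite Γ.V] (hlf : Γ.LocallyFinite) (hc : Γ.WalkConnected)
    (r : ℕ) {K : ℕ} (hK : 3 ≤ K) (hdeg : ∀ v, Γ.height v ≤ r → Γ.degree v ≤ K) :
    ∃ Δ : PointedGraph, BallIso r Γ Δ ∧ Δ.WalkConnected ∧ Infinite Δ.V ∧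
      (∀ x, Δ.degree x = K ∨ ∃ v, Δ.degree x = Γ.degree v) ∧
      Δ.adjGraph.OneEndedGraph ∧ ∀ n, Δ.Crank n := by
  classical
  let B := Γ.ball r
  have : Finite B.V := (hlf.finite_ball r).to_subtype
  have hBdeg : ∀ v : B.V, B.degree v ≤ K := fun v => (ball_degree_le v).trans (hdeg _ (ofBall_le v))
  -- The number of half edges to be added at a vertex: sphere vertices are filled up to degree `K`,
  -- inner vertices already have their degree in `Γ`.
  let f : B.V → ℕ := fun v => if B.height v = r then K - (B.degree v).toNat else 0
  have hf : ∀ v, B.height v = r → B.degree v + f v = K := fun v hv => by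
    have h := hBdeg v
    obtain ⟨d, hd⟩ := ENat.ne_top_iff_exists.1 (ne_top_of_le_ne_top (ENat.natCast_ne_top K) h)
    rw [← hd] at h ⊢
    have h : d ≤ K := by exact_mod_cast h
    have : f v = K - d := by
      change ite _ _ _ = _
      rw [if_pos hv, ← hd]
      simp
    rw [this]
    exact_mod_cast Nat.add_sub_cancel' h
  let H := Σ v, Fin (f v)
  let a : H → B.V := Sigma.fst
  have ha : ∀ h : H, B.height (a h) = r := by
    rintro ⟨v, x⟩
    by_contra hv
    have : f v = 0 := if_neg hv
    exact absurd x.isLt (by omega)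
  have hHa : ∀ v, {h | a h = v}.encard = f v := encard_sigma_fst f
  have : Finite H := inferInstance
  have : Nonempty H := by
    obtain ⟨v, hv, hd⟩ := exists_ball_degree_lt hlf hc r
    rw [← ball_height] at hv
    have h1 := hd.trans (hdeg _ (ofBall_le v))
    have h2 := hf v hv
    refine ⟨⟨v, ⟨0, Nat.pos_of_ne_zero fun h0 => ?_⟩⟩⟩
    rw [h0, Nat.cast_zero, add_zero] at h2
    change B.degree v + 1 ≤ K at h1
    rw [h2] at h1
    have : K + 1 ≤ K := by exact_mod_cast h1
    omega
  obtain ⟨b, m, hm, hb, h0, h1, J, hJ⟩ := exists_multiplicities (H := H) hK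
  have hB : ∀ v, B.height v ≤ r := fun v => by rw [ball_height]; exact ofBall_le v
  refine ⟨B.withTail a b m, nonempty_iso_ball_withTail ha hB fun e => ?_,
    walkConnected_withTail ha hB hm hb, Infinite.of_injective _ (B.tailInr_injective a b m),
    fun x => ?_, oneEndedGraph_withTail hm, crank_withTail fun j hj => hK.trans (hJ j hj).ge⟩
  · exact (ball_exists_lt_iff e).2 (ofBallE_lt e)
  · rcases B.tail_cases a b m x with ⟨v, rfl⟩ | ⟨_ | j, rfl⟩
    · rw [degree_tailInl, hHa]
      by_cases hv : B.height v = r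
      · exact Or.inl (hf v hv)
      · refine Or.inr ⟨ofBall v, ?_⟩
        rw [show f v = 0 from if_neg hv, Nat.cast_zero, add_zero]
        exact ball_degree (by rw [← ball_height]; exact lt_of_le_of_ne (hB v) hv)
    · exact Or.inl (by rw [degree_tailInr_zero, h0])
    · exact Or.inl (by rw [degree_tailInr_succ, h1])

end PointedGraph

/-! ### Density and the three spaces -/

namespace GraphSpace

open PointedGraph

variable {D : Set ℕ∞}

/-- The degree `K` used for the tail must be allowed, at least `3`, and at least every degree in the
given ball; `hK` is applied to the largest of these degrees, which exists because the ball is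
finite. -/
theorem dense_oneEndedInfiniteRank (hD : ∀ d ∈ D, d < ⊤)
    (hK : ∀ n : ℕ, (n : ℕ∞) ∈ D → ∃ K : ℕ, 3 ≤ K ∧ n ≤ K ∧ (K : ℕ∞) ∈ D) :
    Dense (oneEndedInfiniteRank D) := by
  rw [oneEndedInfiniteRank_eq hD]
  refine dense_classes fun Γ r => ?_
  have := Γ.infinite_vertices hD
  have hlf := Γ.locallyFinite hD
  obtain ⟨v, -, hv⟩ := (hlf.finite_ball r).exists_maximalFor Γ.graph.degree _
    ⟨Γ.graph.base, by rw [Set.mem_ofPred_eq, height_base]; simp⟩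
  obtain ⟨n, hn⟩ := ENat.ne_top_iff_exists.1 (hlf v).ne
  obtain ⟨K, hK, hnK, hKD⟩ := hK n (by rw [hn]; exact Γ.degree_mem v)
  obtain ⟨Δ, hΔ, hc, hinf, hdeg, h⟩ := exists_ballIso_crank hlf Γ.walkConnected r hK fun w hw =>
    ((le_total _ _).elim id fun h => hv hw h).trans (hn.ge.trans (by exact_mod_cast hnK))
  have := hc.pathConnectedSpace
  exact ⟨⟨Δ, inferInstance, Or.inl hinf, fun x => by
    rcases hdeg x with h | ⟨w, h⟩
    · rw [h]; exact hKD
    · rw [h]; exact Γ.degree_mem w⟩, hΔ, h⟩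

theorem dense_isGδ_oneEndedInfiniteRank (hD : ∀ d ∈ D, d < ⊤)
    (hK : ∀ n : ℕ, (n : ℕ∞) ∈ D → ∃ K : ℕ, 3 ≤ K ∧ n ≤ K ∧ (K : ℕ∞) ∈ D) :
    Dense (oneEndedInfiniteRank D) ∧ IsGδ (oneEndedInfiniteRank D) ∧
      oneEndedInfiniteRank D = properHomotopyClass D lochNessMonster :=
  ⟨dense_oneEndedInfiniteRank hD hK, isGδ_oneEndedInfiniteRank hD,
    (oneEndedInfiniteRank_eq hD).trans (properHomotopyClass_lochNess_eq hD).symm⟩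

end GraphSpace

theorem proposition4p3 :
    (∀ k : ℕ, 3 ≤ k →
      Dense (GraphSpace.oneEndedInfiniteRank {(k : ℕ∞)} : Set (RegularGraphs k)) ∧
      IsGδ (GraphSpace.oneEndedInfiniteRank {(k : ℕ∞)} : Set (RegularGraphs k)) ∧
      (GraphSpace.oneEndedInfiniteRank {(k : ℕ∞)} : Set (RegularGraphs k)) =
        GraphSpace.properHomotopyClass {(k : ℕ∞)} lochNessMonster) ∧
    (∀ k : ℕ, 3 ≤ k →
      Dense (GraphSpace.oneEndedInfiniteRank (Set.Iic (k : ℕ∞)) : Set (BoundedDegreeGraphs k)) ∧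
      IsGδ (GraphSpace.oneEndedInfiniteRank (Set.Iic (k : ℕ∞)) : Set (BoundedDegreeGraphs k)) ∧
      (GraphSpace.oneEndedInfiniteRank (Set.Iic (k : ℕ∞)) : Set (BoundedDegreeGraphs k)) =
        GraphSpace.properHomotopyClass (Set.Iic (k : ℕ∞)) lochNessMonster) ∧
    (Dense (GraphSpace.oneEndedInfiniteRank (Set.Iio (⊤ : ℕ∞)) : Set LocallyFiniteGraphs) ∧
      IsGδ (GraphSpace.oneEndedInfiniteRank (Set.Iio (⊤ : ℕ∞)) : Set LocallyFiniteGraphs) ∧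
      (GraphSpace.oneEndedInfiniteRank (Set.Iio (⊤ : ℕ∞)) : Set LocallyFiniteGraphs) =
        GraphSpace.properHomotopyClass (Set.Iio (⊤ : ℕ∞)) lochNessMonster) := by
  refine ⟨fun k hk => GraphSpace.dense_isGδ_oneEndedInfiniteRank ?_ ?_,
    fun k hk => GraphSpace.dense_isGδ_oneEndedInfiniteRank ?_ ?_,
    GraphSpace.dense_isGδ_oneEndedInfiniteRank (fun _ h => h) fun n _ =>
      ⟨max 3 n, le_max_left _ _, le_max_right _ _, ENat.natCast_lt_top _⟩⟩
  · rintro d rfl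
    exact ENat.natCast_lt_top k
  · intro n hn
    exact ⟨k, hk, by exact_mod_cast hn.le, rfl⟩
  · exact fun d hd => lt_of_le_of_lt hd (ENat.natCast_lt_top k)
  · exact fun n hn => ⟨k, hk, by exact_mod_cast Set.mem_Iic.1 hn, Set.mem_Iic.2 le_rfl⟩
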